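/- Let $\Omega=\mathbb T^2\times(-1,1)$ with $\mathbb T=\mathbb R/2\pi\mathbb Z$, $\Gamma=\mathbb T^2\times\{\pm1\}$, and consider the Stokes eigenvalue problem with Dirichlet boundary conditions (the limit case $\beta\to\infty$ of the Navier conditions with friction coefficient $\beta$) $$-\Delta u+\nabla q=\lambda u,\qquad \nabla\cdot u=0\ \text{ in }\Omega,\qquad u=0\ \text{ on }\Gamma,\qquad u\not\equiv0,$$ in the weak sense: $u\in H^1(\Omega)^3$ has zero trace on $\Gamma$, is divergence free, $q\in L^2(\Omega)$, and the first equation holds against test fields in $C_c^\infty(\Omega)^3$. For $m,n\in\mathbb N=\{0,1,2,\dots\}$ put $\mu=\sqrt{m^2+n^2}$ and, for $a,b,c,d\in\mathbb R$, $$\begin{aligned} \mathcal P^u_{m,n}&=a\cos(mx)\sin(ny)-b\sin(mx)\sin(ny)-c\sin(mx)\cos(ny)+d\cos(mx)\cos(ny),\\ \mathcal P^v_{m,n}&=a\sin(mx)\cos(ny)+b\cos(mx)\cos(ny)-c\cos(mx)\sin(ny)-d\sin(mx)\sin(ny),\\ \mathcal P_{m,n}&=a\sin(mx)\sin(ny)+b\cos(mx)\sin(ny)+c\cos(mx)\cos(ny)+d\sin(mx)\cos(ny).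 \end{aligned}$$ An eigenfunction is of mode $(m,n)$ if, for some $a,b,c,d$ and some functions $\mathcal U,\mathcal V,\mathcal W$ of $z$, it has the separated form $$\big(\mathcal U(z)\,\mathcal P^u_{m,n}(x,y),\ \mathcal V(z)\,\mathcal P^v_{m,n}(x,y),\ \mathcal W(z)\,\mathcal P_{m,n}(x,y)\big).\qquad(\ast)$$ For any $m,n\in\mathbb N$ there are two positive, increasing and divergent sequences of eigenvalues, $\lambda^D_{m,n,p}$ ($p\ge1$) and, if $\mu>0$, $\Lambda^D_{m,n,p}$ ($p\ge0$), such that: i) the eigenvalues having an eigenfunction of mode $(m,n)$ with constant pressure ($\nabla q\equiv0$) are exactly $$\lambda^D_{m,n,p}=\mu^2+\frac{\pi^2}{4}p^2,\qquad p\ge1;$$ ii) the eigenvalues having an eigenfunction of mode $(m,n)$ with non-constant pressure ($\nabla q\not\equiv0$) are exactly the $\Lambda^D_{m,n,p}$, $p\ge0$, if $\mu>0$, and there are none if $\mu=0$; moreover $\Lambda^D=\Lambda^D_{m,n,p}$ lies in $\big(\mu^2+\frac{\pi^2}{4}(1+p)^2,\ \mu^2+\frac{\pi^2}{4}(2+p)^2\big)$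 and satisfies $$\begin{cases}\sqrt{\Lambda^D-\mu^2}\,\tan\sqrt{\Lambda^D-\mu^2}=-\mu\tanh\mu & \text{if } p \text{ is even (including } p=0),\\ \sqrt{\Lambda^D-\mu^2}\,\cot\sqrt{\Lambda^D-\mu^2}=\mu\coth\mu & \text{if } p\text{ is odd}.\end{cases}$$ In both cases the eigenfunctions have the separated form: for each $\lambda^D_{m,n,p}$ and each $\Lambda^D_{m,n,p}$ there are smooth profiles $\mathcal U_{m,n,p},\mathcal V_{m,n,p},\mathcal W_{m,n,p}$ (one triple for each of the two classes), depending only on $m,n,p$, such that the fields $(\ast)$ with these profiles are not all zero, and each of them that is not identically zero is an eigenfunction with that eigenvalue and with smooth pressure, constant for $\lambda^D_{m,n,p}$ and non-constant for $\Lambda^D_{m,n,p}$; if $m,n\ge1$, the field is not identically zero for every $(a,b,c,d)\ne0$. The sequences list the eigenvalues with their multiplicity: every eigenfunction with eigenvalue $\lambda$ is (a.e.) a finite sum $u_1+u_2$, where $u_1$ is a linear combination of those separated eigenfunctions that belong to the indices with $\lambda^D_{m,n,p}=\lambda$, and $u_2$ of those that belong to the indices with $\Lambda^D_{m,n,p}=\lambda$;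 and $u_1,u_2$ can be chosen so that $u_2=0$ if and only if the pressure of the eigenfunction is constant. -/

import Mathlib

open MeasureTheory Filter Set
open scoped ContDiff

namespace StokesChannel

noncomputable section

/-- Points `(x, y, z)`. Functions on `Ω = 𝕋² × (-1, 1)`, `𝕋 = ℝ / 2πℤ`, are functions of
`(x, y, z)` that are `2π`-periodic in `x` and in `y`; only the values for `-1 < z < 1` matter. -/
abbrev Pt : Type := ℝ × ℝ × ℝ

/-- A fundamental cell of `Ω = 𝕋² × (-1, 1)`. -/
def cell : Set Pt := Ioc 0 (2 * Real.pi) ×ˢ (Ioc 0 (2 * Real.pi) ×ˢ Ioo (-1) 1)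

/-- Lebesgue measure on `Ω`. -/
def volΩ : Measure Pt := volume.restrict cell

/-- Periodicity with period `2π` in the two horizontal variables. -/
def HPeriodic (f : Pt → ℝ) : Prop :=
  ∀ x y z : ℝ, f (x + 2 * Real.pi, y, z) = f (x, y, z) ∧ f (x, y + 2 * Real.pi, z) = f (x, y, z)

/-- The coordinate directions. -/
def dir : Fin 3 → Pt := ![(1, 0, 0), (0, 1, 0), (0, 0, 1)]

/-- Classical partial derivative (only applied to smooth functions). -/
def pd (i : Fin 3) (f : Pt → ℝ) : Pt → ℝ := fun X => fderiv ℝ f X (dir i)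

/-- Restrictions of these functions to the closed strip are the elements of `C^∞(closure Ω)`. -/
def SmoothPeriodic (φ : Pt → ℝ) : Prop := ContDiff ℝ ∞ φ ∧ HPeriodic φ

/-- Test functions, `C_c^∞(Ω)`: smooth, periodic, vanishing near the walls `z = ±1`. -/
def IsTest (φ : Pt → ℝ) : Prop :=
  SmoothPeriodic φ ∧ ∃ r : ℝ, r < 1 ∧ ∀ X : Pt, r ≤ |X.2.2| → φ X = 0

/-- `f ∈ H¹(Ω)` with weak gradient `g`. -/
structure HasH1Grad (f : Pt → ℝ) (g : Fin 3 → Pt → ℝ) : Prop where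
  periodic : HPeriodic f
  memLp : MemLp f 2 volΩ
  memLp_grad : ∀ i, MemLp (g i) 2 volΩ
  weak : ∀ i, ∀ φ, IsTest φ → ∫ X, f X * pd i φ X ∂volΩ = - ∫ X, g i X * φ X ∂volΩ

/-- The trace on `Γ = 𝕋² × {±1}` of `f ∈ H¹(Ω)` (with weak gradient `g`) vanishes. By Green's
formula the left-hand side is `∫_Γ f φ ν₃`, and the traces on `Γ` of the smooth functions `φ`
are dense in `L²(Γ)`. -/
def TraceZero (f : Pt → ℝ) (g : Fin 3 → Pt → ℝ) : Prop :=
  ∀ φ, SmoothPeriodic φ → ∫ X, (f X * pd 2 φ X + g 2 X * φ X) ∂volΩ = 0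

/-- `u ∈ V^D(Ω)`, with `G i j = ∂ⱼ uᵢ`: the field `u` is in `H¹(Ω)`, solenoidal, and zero
on `Γ`. -/
structure InVD (u : Pt → Fin 3 → ℝ) (G : Fin 3 → Fin 3 → Pt → ℝ) : Prop where
  h1 : ∀ i, HasH1Grad (fun X => u X i) (G i)
  div_free : ∀ᵐ X ∂volΩ, ∑ i, G i i X = 0
  trace : ∀ i, TraceZero (fun X => u X i) (G i)

/-- `(u, q)` is a weak solution, with `u ∈ V^D(Ω)` not zero and `q ∈ L²(Ω)`, of
`-Δu + ∇q = lam u` and `∇ · u = 0` in `Ω`, `u = 0` on `Γ`. So `lam` is a Dirichlet eigenvalue of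
the Stokes problem, `u` an eigenfunction and `q` its pressure. -/
structure IsStokesEigenpair (lam : ℝ) (u : Pt → Fin 3 → ℝ) (q : Pt → ℝ) : Prop where
  ne_zero : ¬ u =ᵐ[volΩ] 0
  periodic_q : HPeriodic q
  memLp_q : MemLp q 2 volΩ
  momentum : ∃ G, InVD u G ∧ ∀ φ : Fin 3 → Pt → ℝ, (∀ i, IsTest (φ i)) →
    ∫ X, (∑ i, ∑ j, G i j X * pd j (φ i) X - q X * ∑ i, pd i (φ i) X) ∂volΩ
      = lam * ∫ X, ∑ i, u X i * φ i X ∂volΩ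

/-- `∇q ≡ 0` in `Ω`, in the sense of distributions (constant pressure). -/
def GradZero (q : Pt → ℝ) : Prop := ∀ i, ∀ φ, IsTest φ → ∫ X, q X * pd i φ X ∂volΩ = 0

/-- `μ = √(m² + n²)`. -/
def mu (m n : ℕ) : ℝ := Real.sqrt ((m : ℝ) ^ 2 + (n : ℝ) ^ 2)

/-- `μ² + (π² / 4) p²`. -/
def lamD (m n p : ℕ) : ℝ := mu m n ^ 2 + Real.pi ^ 2 / 4 * (p : ℝ) ^ 2

/-- The horizontal factor of the first component; `κ` holds the coefficients `(a, b, c, d)`. -/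
def Pu (m n : ℕ) (κ : Fin 4 → ℝ) (x y : ℝ) : ℝ :=
  κ 0 * Real.cos (m * x) * Real.sin (n * y) - κ 1 * Real.sin (m * x) * Real.sin (n * y)
    - κ 2 * Real.sin (m * x) * Real.cos (n * y) + κ 3 * Real.cos (m * x) * Real.cos (n * y)

/-- The horizontal factor of the second component. -/
def Pv (m n : ℕ) (κ : Fin 4 → ℝ) (x y : ℝ) : ℝ :=
  κ 0 * Real.sin (m * x) * Real.cos (n * y) + κ 1 * Real.cos (m * x) * Real.cos (n * y)
    - κ 2 * Real.cos (m * x) * Real.sin (n * y) - κ 3 * Real.sin (m * x) * Real.sin (n * y)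

/-- The horizontal factor of the third component. -/
def Pw (m n : ℕ) (κ : Fin 4 → ℝ) (x y : ℝ) : ℝ :=
  κ 0 * Real.sin (m * x) * Real.sin (n * y) + κ 1 * Real.cos (m * x) * Real.sin (n * y)
    + κ 2 * Real.cos (m * x) * Real.cos (n * y) + κ 3 * Real.sin (m * x) * Real.cos (n * y)

/-- The separated field with vertical profiles `F 0, F 1, F 2` (written `𝒰, 𝒱, 𝒲` in the
literature): `(F 0 (z) Pu(x,y), F 1 (z) Pv(x,y), F 2 (z) Pw(x,y))`. -/
def sepField (m n : ℕ) (κ : Fin 4 → ℝ) (F : Fin 3 → ℝ → ℝ) : Pt → Fin 3 → ℝ := fun X =>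
  ![F 0 X.2.2 * Pu m n κ X.1 X.2.1, F 1 X.2.2 * Pv m n κ X.1 X.2.1, F 2 X.2.2 * Pw m n κ X.1 X.2.1]

end

end StokesChannel

open StokesChannel

/-! Separation of variables. The products of sines and cosines in `x` and `y` form a complete system
on the torus, and for each `(m, n)` the four coefficients `a, b, c, d` pick out four triples of such
products on which the Stokes system closes. With signs absorbed, the Fourier coefficients of `u` and
`q` along every triple solve the same first-order linear system in `z`, `ModeSol`, with `s = lam -
μ²`. They solve it only weakly at first; a matrix exponential and the lemma of du Bois-Reymond
(`weak_linear_system`) make them classical solutions, and the trace condition gives zero values at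
`z = ±1`.

For `s ≤ 0` an energy identity leaves only the zero velocity. For `s > 0` and `μ > 0` the system
splits. The combination `T = nU - mV` does not see the pressure: `T'' = -sT`, `T(±1) = 0`, so `T` is
a sine and `s = π²p²/4`. The vertical velocity `W` satisfies `W = W' = 0` at both walls, because `W'
= mU + nV`. As `Q'' = μ²Q`, `W` is the sum of an oscillation of frequency `σ = √s` and a hyperbolic
part of rate `μ`. The four wall conditions split by parity into two 2×2 systems, with determinants
`charEven` and `charOdd`. The positive zeros of the two functions alternate, exactly one in each
interval `(π/2 (1+p), π/2 (2+p))`; this yields the second sequence and its equations. For `μ = 0`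
the pressure drops out of the horizontal equations, `W = 0`, and `U`, `V` are independent sines.

Conversely, these profiles give smooth classical solutions, hence weak ones. A mode can contribute
to the eigenvalue `lam` only if `m² + n² ≤ lam`, so finitely many modes occur and completeness gives
the finite decomposition (`IsStokesEigenpair.decomposition`). Constant pressure forces `Q = 0` in
all modes with `μ > 0`, which removes the second part. In the other direction, the very weak form of
the equation shows that `∇q` depends only on `u` and `lam`, and it vanishes on the span of the first
class. Within one mode the two sequences are disjoint, since the `p`-th interval lies strictly
between consecutive values of `lamD`. -/

namespace StokesChannel

/-! ### Trigonometric functions and the measures on circle, torus and interval. -/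

/-- `cos (m x)` for `false`, `sin (m x)` for `true`. -/
noncomputable def tr (b : Bool) (m : ℕ) (x : ℝ) : ℝ :=
  if b then Real.sin (m * x) else Real.cos (m * x)

/-- The squared `L²(0, 2π)` norm of `tr b m`. -/
noncomputable def trN (b : Bool) (m : ℕ) : ℝ :=
  if m = 0 then (if b then 0 else 2 * Real.pi) else Real.pi

lemma contDiff_tr (b : Bool) (m : ℕ) : ContDiff ℝ ∞ (tr b m) := by
  unfold tr
  cases b <;> simp <;> fun_prop

lemma tr_add_two_pi (b : Bool) (m : ℕ) (x : ℝ) : tr b m (x + 2 * Real.pi) = tr b m x := by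
  have h : (m : ℝ) * (x + 2 * Real.pi) = m * x + m * (2 * Real.pi) := by ring
  cases b <;> simp [tr, h, Real.cos_add_nat_mul_two_pi, Real.sin_add_nat_mul_two_pi]

lemma abs_tr_le (b : Bool) (m : ℕ) (x : ℝ) : |tr b m x| ≤ 1 := by
  cases b <;> simp [tr, Real.abs_cos_le_one, Real.abs_sin_le_one]

/-- The horizontal circle, with Lebesgue measure. -/
noncomputable def cm : Measure ℝ := volume.restrict (Ioc 0 (2 * Real.pi))

/-- The horizontal torus, with Lebesgue measure. -/
noncomputable def hm : Measure (ℝ × ℝ) := cm.prod cm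

/-- The vertical interval, with Lebesgue measure. -/
noncomputable def zm : Measure ℝ := volume.restrict (Ioo (-1) 1)

instance : IsFiniteMeasure cm := by unfold cm; infer_instance
instance : IsFiniteMeasure zm := by unfold zm; infer_instance
instance : IsFiniteMeasure hm := by unfold hm; infer_instance

lemma volΩ_eq : volΩ = cm.prod (cm.prod zm) := by
  unfold volΩ cell cm zm
  rw [Measure.prod_restrict, Measure.prod_restrict]
  rfl

instance : IsFiniteMeasure volΩ := by rw [volΩ_eq]; infer_instance

lemma measurePreserving_assoc :
    MeasurePreserving (MeasurableEquiv.prodAssoc : (ℝ × ℝ) × ℝ ≃ᵐ Pt) (hm.prod zm) volΩ := by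
  refine ⟨MeasurableEquiv.measurable _, ?_⟩
  rw [volΩ_eq, hm, Measure.prodAssoc_prod]

lemma integral_volΩ (f : Pt → ℝ) :
    ∫ X, f X ∂volΩ = ∫ p : (ℝ × ℝ) × ℝ, f (p.1.1, p.1.2, p.2) ∂(hm.prod zm) :=
  (measurePreserving_assoc.integral_comp' f).symm

lemma integrable_volΩ_iff (f : Pt → ℝ) :
    Integrable f volΩ ↔ Integrable (fun p : (ℝ × ℝ) × ℝ => f (p.1.1, p.1.2, p.2)) (hm.prod zm) :=
  (measurePreserving_assoc.integrable_comp_emb (MeasurableEquiv.measurableEmbedding _)).symm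

lemma integral_cos_int_mul (k : ℤ) :
    ∫ x, Real.cos (k * x) ∂cm = if k = 0 then 2 * Real.pi else 0 := by
  have h0 : (0 : ℝ) ≤ 2 * Real.pi := by positivity
  rw [cm, ← intervalIntegral.integral_of_le h0]
  split_ifs with h
  · simp [h]
  · have hk : (k : ℝ) ≠ 0 := by exact_mod_cast h
    rw [intervalIntegral.integral_comp_mul_left (fun x => Real.cos x) hk]
    have h2 : Real.sin (k * (2 * Real.pi)) = 0 := by
      have := Real.sin_int_mul_pi (2 * k)
      push_cast at this
      rw [← this]; ring_nf
    simp [h2]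

lemma integral_sin_int_mul (k : ℤ) : ∫ x, Real.sin (k * x) ∂cm = 0 := by
  have h0 : (0 : ℝ) ≤ 2 * Real.pi := by positivity
  rw [cm, ← intervalIntegral.integral_of_le h0]
  by_cases h : k = 0
  · simp [h]
  · have hk : (k : ℝ) ≠ 0 := by exact_mod_cast h
    rw [intervalIntegral.integral_comp_mul_left (fun x => Real.sin x) hk]
    simp [Real.cos_int_mul_two_pi]

lemma integrable_cm {f : ℝ → ℝ} (hf : Continuous f) : Integrable f cm :=
  (hf.integrableOn_Icc (a := 0) (b := 2 * Real.pi)).mono_set Ioc_subset_Icc_self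

lemma integral_tr_mul_tr (a b : Bool) (m n : ℕ) :
    ∫ x, tr a m x * tr b n x ∂cm = if a = b ∧ m = n then trN a m else 0 := by
  have ic : ∀ k : ℤ, Integrable (fun x : ℝ => Real.cos (k * x) / 2) cm := fun k =>
    integrable_cm (by fun_prop)
  have is : ∀ k : ℤ, Integrable (fun x : ℝ => Real.sin (k * x) / 2) cm := fun k =>
    integrable_cm (by fun_prop)
  cases a <;> cases b
  · have h : ∀ x, tr false m x * tr false n x
        = Real.cos (((m - n : ℤ) : ℝ) * x) / 2 + Real.cos (((m + n : ℤ) : ℝ) * x) / 2 := by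
      intro x; simp [tr, sub_mul, add_mul, Real.cos_add, Real.cos_sub]; ring
    simp_rw [h]
    rw [integral_add (ic _) (ic _), integral_div, integral_div, integral_cos_int_mul,
      integral_cos_int_mul]
    rcases eq_or_ne m n with rfl | hmn
    · rcases eq_or_ne m 0 with rfl | hm0
      · simp [trN, two_mul]
      · have : (m : ℤ) + m ≠ 0 := by omega
        simp [trN, hm0, this]
    · have h1 : (m : ℤ) - n ≠ 0 := by omega
      have h2 : (m : ℤ) + n ≠ 0 := by omega
      simp [hmn, h1, h2]
  · have h : ∀ x, tr false m x * tr true n x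
        = Real.sin (((m + n : ℤ) : ℝ) * x) / 2 - Real.sin (((m - n : ℤ) : ℝ) * x) / 2 := by
      intro x; simp [tr, sub_mul, add_mul, Real.sin_add, Real.sin_sub]; ring
    simp_rw [h]
    rw [integral_sub (is _) (is _), integral_div, integral_div, integral_sin_int_mul,
      integral_sin_int_mul]
    simp
  · have h : ∀ x, tr true m x * tr false n x
        = Real.sin (((m + n : ℤ) : ℝ) * x) / 2 + Real.sin (((m - n : ℤ) : ℝ) * x) / 2 := by
      intro x; simp [tr, sub_mul, add_mul, Real.sin_add, Real.sin_sub]; ring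
    simp_rw [h]
    rw [integral_add (is _) (is _), integral_div, integral_div, integral_sin_int_mul,
      integral_sin_int_mul]
    simp
  · have h : ∀ x, tr true m x * tr true n x
        = Real.cos (((m - n : ℤ) : ℝ) * x) / 2 - Real.cos (((m + n : ℤ) : ℝ) * x) / 2 := by
      intro x; simp [tr, sub_mul, add_mul, Real.cos_add, Real.cos_sub]; ring
    simp_rw [h]
    rw [integral_sub (ic _) (ic _), integral_div, integral_div, integral_cos_int_mul,
      integral_cos_int_mul]
    rcases eq_or_ne m n with rfl | hmn
    · rcases eq_or_ne m 0 with rfl | hm0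
      · simp [trN, two_mul]
      · have : (m : ℤ) + m ≠ 0 := by omega
        simp [trN, hm0, this]
    · have h1 : (m : ℤ) - n ≠ 0 := by omega
      have h2 : (m : ℤ) + n ≠ 0 := by omega
      simp [hmn, h1, h2]

/-! ### Horizontal Fourier coefficients and completeness. -/

/-- The pairing of the horizontal slices of `f` with `e`. -/
noncomputable def S (f : Pt → ℝ) (e : ℝ × ℝ → ℝ) (z : ℝ) : ℝ :=
  ∫ p, f (p.1, p.2, z) * e p ∂hm

lemma integrable_mul_bdd {α : Type*} [MeasurableSpace α] {ν : Measure α} {f g : α → ℝ}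
    (hf : Integrable f ν) (hg : AEStronglyMeasurable g ν) (C : ℝ) (hC : ∀ x, |g x| ≤ C) :
    Integrable (fun x => f x * g x) ν :=
  hf.mul_bdd (c := C) hg (Eventually.of_forall hC)

lemma integrable_S {f : Pt → ℝ} (hf : Integrable f volΩ) {e : ℝ × ℝ → ℝ} (he : Continuous e)
    {C : ℝ} (hC : ∀ p, |e p| ≤ C) : Integrable (S f e) zm := by
  have h : Integrable (fun p : (ℝ × ℝ) × ℝ => f (p.1.1, p.1.2, p.2) * e p.1) (hm.prod zm) :=
    integrable_mul_bdd ((integrable_volΩ_iff f).1 hf)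
      (by fun_prop : Continuous fun p : (ℝ × ℝ) × ℝ => e p.1).aestronglyMeasurable C
      (fun p => hC _)
  exact h.integral_prod_right

lemma integral_mul_eq_integral_S {f : Pt → ℝ} (hf : Integrable f volΩ) {e : ℝ × ℝ → ℝ}
    (he : Continuous e) {C : ℝ} (hC : ∀ p, |e p| ≤ C) {χ : ℝ → ℝ} (hχ : Continuous χ) :
    ∫ X, f X * (e (X.1, X.2.1) * χ X.2.2) ∂volΩ = ∫ z, S f e z * χ z ∂zm := by
  obtain ⟨D, hD⟩ : ∃ D, ∀ z ∈ Icc (-1 : ℝ) 1, |χ z| ≤ D :=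
    isCompact_Icc.exists_bound_of_continuousOn hχ.continuousOn
  rw [integral_volΩ]
  have h1 : Integrable (fun p : (ℝ × ℝ) × ℝ => f (p.1.1, p.1.2, p.2) * e p.1) (hm.prod zm) :=
    integrable_mul_bdd ((integrable_volΩ_iff f).1 hf)
      (by fun_prop : Continuous fun p : (ℝ × ℝ) × ℝ => e p.1).aestronglyMeasurable C
      (fun p => hC _)
  have hz : ∀ᵐ p ∂(hm.prod zm), |χ p.2| ≤ D := by
    have : ∀ᵐ z ∂zm, |χ z| ≤ D := by
      unfold zm
      filter_upwards [ae_restrict_mem measurableSet_Ioo] with z hz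
      exact hD z (Ioo_subset_Icc_self hz)
    exact Measure.quasiMeasurePreserving_snd.ae this
  have h2 : Integrable (fun p : (ℝ × ℝ) × ℝ => f (p.1.1, p.1.2, p.2) * (e p.1 * χ p.2))
      (hm.prod zm) := by
    have := h1.mul_bdd (c := D) (by fun_prop : Continuous fun p : (ℝ × ℝ) × ℝ => χ p.2).aestronglyMeasurable hz
    refine this.congr (Eventually.of_forall fun p => ?_)
    simp only; ring
  rw [integral_prod_symm _ h2]
  refine integral_congr_ae (Eventually.of_forall fun z => ?_)
  simp only [S, ← mul_assoc]
  rw [integral_mul_const]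

lemma integrable_mul_tr {g : ℝ → ℝ} (hg : Integrable g cm) (b : Bool) (m : ℕ) :
    Integrable (fun x => g x * tr b m x) cm :=
  integrable_mul_bdd hg (contDiff_tr b m).continuous.aestronglyMeasurable 1 (abs_tr_le b m)

/-- An integrable function on the circle with vanishing Fourier coefficients vanishes. -/
lemma ae_eq_zero_of_integral_mul_tr {g : ℝ → ℝ} (hg : Integrable g cm)
    (h : ∀ b m, ∫ x, g x * tr b m x ∂cm = 0) : g =ᵐ[cm] 0 := by
  have hpi : 0 < 2 * Real.pi := by positivity
  have : Fact (0 < 2 * Real.pi) := ⟨hpi⟩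
  have hgc : Integrable (fun x => (g x : ℂ)) cm := hg.ofReal
  have hint : ∀ φ : C(AddCircle (2 * Real.pi), ℂ),
      Integrable (fun x : ℝ => (g x : ℂ) * φ (x : AddCircle (2 * Real.pi))) cm := fun φ =>
    hgc.mul_bdd (c := ‖φ‖) (φ.continuous.comp (AddCircle.continuous_mk' _)).aestronglyMeasurable
      (Eventually.of_forall fun x => φ.norm_coe_le_norm _)
  -- Integration against `g` is a bounded functional on the continuous functions on the circle. It
  -- kills the exponentials, whose span is dense, so it is zero; testing it on bump functions then
  -- gives `g = 0` almost everywhere.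
  let L0 : C(AddCircle (2 * Real.pi), ℂ) →ₗ[ℂ] ℂ :=
    { toFun := fun φ => ∫ x : ℝ, (g x : ℂ) * φ (x : AddCircle (2 * Real.pi)) ∂cm
      map_add' := fun φ ψ => by
        simp only [ContinuousMap.add_apply, mul_add]
        exact integral_add (hint φ) (hint ψ)
      map_smul' := fun c φ => by
        simp only [ContinuousMap.smul_apply, smul_eq_mul, RingHom.id_apply]
        rw [← integral_const_mul]
        congr 1; ext x; ring }
  let L : C(AddCircle (2 * Real.pi), ℂ) →L[ℂ] ℂ := L0.mkContinuous (∫ x, ‖(g x : ℂ)‖ ∂cm) (by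
    intro φ
    calc ‖∫ x : ℝ, (g x : ℂ) * φ (x : AddCircle (2 * Real.pi)) ∂cm‖
        ≤ ∫ x : ℝ, ‖(g x : ℂ)‖ * ‖φ‖ ∂cm := by
          refine norm_integral_le_of_norm_le (hgc.norm.mul_const _) (Eventually.of_forall ?_)
          intro x
          rw [norm_mul]
          exact mul_le_mul_of_nonneg_left (φ.norm_coe_le_norm _) (norm_nonneg _)
      _ = _ := integral_mul_const _ _)
  -- The parameter `ε` will be the sign of the frequency, so that `m = |k|` covers every integer
  -- `k`.
  have hexp : ∀ m : ℕ, ∀ ε : ℝ, ∫ x : ℝ, (g x : ℂ) * ((Real.cos (m * x) : ℝ) +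
      ε * (Real.sin (m * x) : ℝ) * Complex.I) ∂cm = 0 := by
    intro m ε
    have e : ∀ x : ℝ, (g x : ℂ) * ((Real.cos (m * x) : ℝ) + ε * (Real.sin (m * x) : ℝ) * Complex.I)
        = ((g x * tr false m x : ℝ) : ℂ) + ((g x * tr true m x : ℝ) : ℂ) * (ε * Complex.I) := by
      intro x; simp [tr]; ring
    simp_rw [e]
    rw [integral_add (integrable_mul_tr hg false m).ofReal
      ((integrable_mul_tr hg true m).ofReal.mul_const _), integral_mul_const, integral_complex_ofReal,
      integral_complex_ofReal, h, h]
    simp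
  have hL : L = 0 := by
    have hd : Dense (Submodule.span ℂ (range (@fourier (2 * Real.pi))) :
        Set C(AddCircle (2 * Real.pi), ℂ)) := by
      exact Submodule.dense_iff_topologicalClosure_eq_top.2 span_fourier_closure_eq_top
    refine ContinuousLinearMap.ext_on hd ?_
    rintro _ ⟨k, rfl⟩
    change ∫ x : ℝ, (g x : ℂ) * fourier k (x : AddCircle (2 * Real.pi)) ∂cm = 0
    have key : ∀ x : ℝ, fourier k (x : AddCircle (2 * Real.pi))
        = (Real.cos (k.natAbs * x) : ℝ) + ((k.sign : ℝ) : ℂ) * (Real.sin (k.natAbs * x) : ℝ) *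
          Complex.I := by
      intro x
      rw [fourier_coe_apply]
      have : 2 * (Real.pi : ℂ) * Complex.I * k * x / (2 * Real.pi : ℝ)
          = ((k * x : ℝ) : ℂ) * Complex.I := by
        have : (Real.pi : ℂ) ≠ 0 := by exact_mod_cast Real.pi_ne_zero
        push_cast; field_simp
      rw [this, Complex.exp_mul_I, ← Complex.ofReal_cos, ← Complex.ofReal_sin]
      obtain ⟨n, rfl | rfl⟩ := k.eq_nat_or_neg
      · rcases Nat.eq_zero_or_pos n with rfl | hn
        · simp
        · simp [Int.sign_natCast_of_ne_zero hn.ne']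
      · rcases Nat.eq_zero_or_pos n with rfl | hn
        · simp
        · simp [Int.sign_natCast_of_ne_zero hn.ne']
    simp_rw [key]
    exact hexp _ _
  have hz : ∀ᵐ x ∂(volume : Measure ℝ), x ∈ Ioo 0 (2 * Real.pi) → g x = 0 := by
    refine isOpen_Ioo.ae_eq_zero_of_integral_contDiff_smul_eq_zero ?_ ?_
    · have : IntegrableOn g (Ioo 0 (2 * Real.pi)) :=
        IntegrableOn.mono_set hg Ioo_subset_Ioc_self
      exact this.locallyIntegrableOn
    · intro ψ hψ _ hs
      have hout : ∀ x, x ∉ Ioo 0 (2 * Real.pi) → ψ x = 0 := fun x hx =>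
        image_eq_zero_of_notMem_tsupport fun h => hx (hs h)
      -- The bump `ψ` vanishes at `0` and at `2π`, so it descends to a continuous function on the
      -- circle.
      let φ : C(AddCircle (2 * Real.pi), ℂ) :=
        ⟨AddCircle.liftIco (2 * Real.pi) 0 (fun x => (ψ x : ℂ)),
          AddCircle.liftIco_zero_continuous
            (by simp [hout 0 (by simp), hout (2 * Real.pi) (by simp)])
            (Complex.continuous_ofReal.comp hψ.continuous).continuousOn⟩
      have h1 : L φ = 0 := by rw [hL]; rfl
      have h2 : L φ = ∫ x : ℝ, ((ψ x * g x : ℝ) : ℂ) ∂cm := by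
        change ∫ x : ℝ, (g x : ℂ) * AddCircle.liftIco (2 * Real.pi) 0 (fun x => (ψ x : ℂ))
          (x : AddCircle (2 * Real.pi)) ∂cm = _
        refine integral_congr_ae ?_
        have hne : ∀ᵐ x ∂cm, x ≠ 2 * Real.pi :=
          ae_restrict_of_ae (Measure.ae_ne volume _)
        have hmem : ∀ᵐ x ∂cm, x ∈ Ioc 0 (2 * Real.pi) := ae_restrict_mem measurableSet_Ioc
        filter_upwards [hne, hmem] with x hx1 hx2
        rw [AddCircle.liftIco_zero_coe_apply ⟨hx2.1.le, lt_of_le_of_ne hx2.2 hx1⟩]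
        push_cast; ring
      rw [h1, integral_complex_ofReal] at h2
      have h3 : ∫ x, ψ x * g x ∂cm = 0 := by exact_mod_cast h2.symm
      rw [cm, setIntegral_eq_integral_of_forall_compl_eq_zero] at h3
      · simpa using h3
      · intro x hx
        rw [hout x (fun h => hx (Ioo_subset_Ioc_self h)), zero_mul]
  rw [cm, ← restrict_Ioo_eq_restrict_Ioc]
  exact (ae_restrict_iff' measurableSet_Ioo).2 hz

/-- Fubini for the norm of `f`. Integrability supplies the measurability without which null slices
would not make `f` null. -/
lemma ae_eq_zero_of_ae_slice {α β : Type*} [MeasurableSpace α] [MeasurableSpace β]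
    {ν : Measure α} {τ : Measure β} [SFinite ν] [SFinite τ] {f : α × β → ℝ}
    (hf : Integrable f (ν.prod τ)) (h : ∀ᵐ x ∂ν, ∀ᵐ y ∂τ, f (x, y) = 0) :
    f =ᵐ[ν.prod τ] 0 := by
  have h1 : ∫ p, ‖f p‖ ∂(ν.prod τ) = 0 := by
    rw [integral_prod _ hf.norm]
    refine integral_eq_zero_of_ae ?_
    filter_upwards [h] with x hx
    refine integral_eq_zero_of_ae ?_
    filter_upwards [hx] with y hy
    simp [hy]
  have h2 := (integral_eq_zero_iff_of_nonneg (fun p => norm_nonneg (f p)) hf.norm).1 h1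
  filter_upwards [h2] with p hp
  simpa using hp

/-- One-dimensional completeness is used twice: in `x` for each coefficient in `y`, then in `y` on
almost every slice. The pairs `(b, n)` are countable, so one null set of `x` serves them all. -/
lemma ae_eq_zero_of_integral_mul_tr_tr {g : ℝ × ℝ → ℝ} (hg : Integrable g hm)
    (h : ∀ a m b n, ∫ p, g p * (tr a m p.1 * tr b n p.2) ∂hm = 0) : g =ᵐ[hm] 0 := by
  refine ae_eq_zero_of_ae_slice hg ?_
  have h1 : ∀ᵐ x ∂cm, ∀ b n, ∫ y, g (x, y) * tr b n y ∂cm = 0 := by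
    rw [ae_all_iff]; intro b
    rw [ae_all_iff]; intro n
    have hi : Integrable (fun p : ℝ × ℝ => g p * tr b n p.2) hm :=
      integrable_mul_bdd hg
        ((contDiff_tr b n).continuous.comp continuous_snd).aestronglyMeasurable 1
        (fun p => abs_tr_le b n p.2)
    refine ae_eq_zero_of_integral_mul_tr (hi.integral_prod_left) fun a m => ?_
    rw [← h a m b n, hm, integral_prod]
    · refine integral_congr_ae (Eventually.of_forall fun x => ?_)
      simp only
      rw [← integral_mul_const]
      congr 1; ext y; ring
    · refine (integrable_mul_bdd hi
        ((contDiff_tr a m).continuous.comp continuous_fst).aestronglyMeasurable 1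
        (fun p => abs_tr_le a m p.1)).congr (Eventually.of_forall fun p => ?_)
      simp only [Function.comp]; ring
  filter_upwards [h1, hg.prod_right_ae] with x hx hx2
  exact ae_eq_zero_of_integral_mul_tr hx2 hx

/-- Completeness of the horizontal trigonometric system in `L¹(Ω)`. -/
lemma ae_eq_zero_of_S_eq_zero {f : Pt → ℝ} (hf : Integrable f volΩ)
    (h : ∀ a m b n, S f (fun p => tr a m p.1 * tr b n p.2) =ᵐ[zm] 0) : f =ᵐ[volΩ] 0 := by
  have hf' := (integrable_volΩ_iff f).1 hf
  -- The slices are taken at fixed `z`, so the vertical variable is moved to the front.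
  have h1 : (fun q : ℝ × (ℝ × ℝ) => f (q.2.1, q.2.2, q.1)) =ᵐ[zm.prod hm] 0 := by
    refine ae_eq_zero_of_ae_slice hf'.swap ?_
    have h2 : ∀ᵐ z ∂zm, ∀ a m b n, S f (fun p => tr a m p.1 * tr b n p.2) z = 0 := by
      simp_rw [ae_all_iff]
      exact h
    filter_upwards [h2, hf'.prod_left_ae] with z hz hz2
    exact ae_eq_zero_of_integral_mul_tr_tr hz2 hz
  have h3 : ∀ᵐ p ∂(hm.prod zm), f (p.1.1, p.1.2, p.2) = 0 :=
    (Measure.measurePreserving_swap (μ := hm) (ν := zm)).quasiMeasurePreserving.ae h1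
  have h4 := (measurePreserving_assoc.symm _).quasiMeasurePreserving.ae h3
  filter_upwards [h4] with X hX
  exact hX

/-! ### Weak derivatives and weak linear systems on the interval. -/

/-- Test functions on `(-1, 1)`. -/
def IsTestZ (χ : ℝ → ℝ) : Prop :=
  ContDiff ℝ ∞ χ ∧ ∃ r : ℝ, r < 1 ∧ ∀ z : ℝ, r ≤ |z| → χ z = 0

lemma IsTestZ.continuous {χ : ℝ → ℝ} (h : IsTestZ χ) : Continuous χ := h.1.continuous

lemma IsTestZ.contDiff_deriv {χ : ℝ → ℝ} (h : IsTestZ χ) : ContDiff ℝ ∞ (deriv χ) :=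
  (contDiff_infty_iff_deriv.1 h.1).2

lemma IsTestZ.deriv {χ : ℝ → ℝ} (h : IsTestZ χ) : IsTestZ (deriv χ) := by
  refine ⟨h.contDiff_deriv, ?_⟩
  obtain ⟨r, hr, h0⟩ := h.2
  -- The derivative is known to vanish where `χ` vanishes on a whole neighbourhood, hence a radius
  -- strictly between `r` and `1`.
  refine ⟨(r + 1) / 2, by linarith, fun z hz => ?_⟩
  have : χ =ᶠ[nhds z] fun _ => 0 := by
    have hop : IsOpen {w : ℝ | r < |w|} := isOpen_lt continuous_const continuous_abs
    filter_upwards [hop.mem_nhds (show r < |z| by linarith)] with w hw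
    exact h0 w hw.le
  rw [this.deriv_eq]; simp

lemma IsTestZ.mul_left {χ g : ℝ → ℝ} (h : IsTestZ χ) (hg : ContDiff ℝ ∞ g) :
    IsTestZ (fun z => g z * χ z) := by
  obtain ⟨r, hr, h0⟩ := h.2
  exact ⟨hg.mul h.1, r, hr, fun z hz => by simp [h0 z hz]⟩

lemma IsTestZ.sub {χ ψ : ℝ → ℝ} (h : IsTestZ χ) (h' : IsTestZ ψ) :
    IsTestZ (fun z => χ z - ψ z) := by
  obtain ⟨r, hr, h0⟩ := h.2
  obtain ⟨r', hr', h0'⟩ := h'.2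
  refine ⟨h.1.sub h'.1, max r r', max_lt hr hr', fun z hz => ?_⟩
  simp only
  rw [h0 z ((le_max_left _ _).trans hz), h0' z ((le_max_right _ _).trans hz), sub_zero]

lemma integrable_zm_mul {f g : ℝ → ℝ} (hf : Integrable f zm) (hg : Continuous g) :
    Integrable (fun z => f z * g z) zm := by
  obtain ⟨D, hD⟩ : ∃ D, ∀ z ∈ Icc (-1 : ℝ) 1, ‖g z‖ ≤ D :=
    isCompact_Icc.exists_bound_of_continuousOn hg.continuousOn
  refine hf.mul_bdd (c := D) hg.aestronglyMeasurable ?_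
  unfold zm
  filter_upwards [ae_restrict_mem measurableSet_Ioo] with z hz
  exact hD z (Ioo_subset_Icc_self hz)

lemma integrable_zm {g : ℝ → ℝ} (hg : Continuous g) : Integrable g zm := by
  simpa using integrable_zm_mul (integrable_const (1 : ℝ)) hg

lemma integral_zm (g : ℝ → ℝ) : ∫ z, g z ∂zm = ∫ z in (-1)..1, g z := by
  rw [intervalIntegral.integral_of_le (by norm_num), zm, restrict_Ioo_eq_restrict_Ioc]

lemma ae_zm_eq_zero {f : ℝ → ℝ} (hf : Integrable f zm)
    (h : ∀ χ, IsTestZ χ → ∫ z, f z * χ z ∂zm = 0) : f =ᵐ[zm] 0 := by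
  have hz : ∀ᵐ x ∂(volume : Measure ℝ), x ∈ Ioo (-1 : ℝ) 1 → f x = 0 := by
    refine isOpen_Ioo.ae_eq_zero_of_integral_contDiff_smul_eq_zero
      (IntegrableOn.locallyIntegrableOn hf) ?_
    intro ψ hψ hc hs
    have hout : ∀ x, x ∉ Ioo (-1 : ℝ) 1 → ψ x = 0 := fun x hx =>
      image_eq_zero_of_notMem_tsupport fun h => hx (hs h)
    have ht : IsTestZ ψ := by
      refine ⟨hψ, ?_⟩
      rcases (tsupport ψ).eq_empty_or_nonempty with he | hne
      · exact ⟨0, one_pos, fun z _ => image_eq_zero_of_notMem_tsupport (by simp [he])⟩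
      · obtain ⟨w, hw, hmax⟩ := hc.isCompact.exists_isMaxOn hne continuous_abs.continuousOn
        have hw1 : |w| < 1 := abs_lt.2 (hs hw)
        refine ⟨(|w| + 1) / 2, by linarith, fun z hz => ?_⟩
        refine image_eq_zero_of_notMem_tsupport fun hz' => ?_
        have : |z| ≤ |w| := hmax hz'
        linarith
    have h1 := h ψ ht
    rw [zm, setIntegral_eq_integral_of_forall_compl_eq_zero] at h1
    · simpa [mul_comm] using h1
    · intro x hx
      rw [hout x hx, mul_zero]
  exact (ae_restrict_iff' measurableSet_Ioo).2 hz

/-- The primitive that starts at `-1` vanishes below the support of `ψ`, and above it because the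
mean of `ψ` is zero. -/
lemma exists_isTestZ_deriv {ψ : ℝ → ℝ} (h : IsTestZ ψ) (h0 : ∫ z, ψ z ∂zm = 0) :
    ∃ χ, IsTestZ χ ∧ deriv χ = ψ := by
  have hc := h.continuous
  have hd : ∀ z, HasDerivAt (fun z => ∫ t in (-1)..z, ψ t) (ψ z) z := fun z =>
    intervalIntegral.integral_hasDerivAt_right (hc.intervalIntegrable _ _)
      (hc.stronglyMeasurableAtFilter _ _) hc.continuousAt
  have hd' : deriv (fun z => ∫ t in (-1)..z, ψ t) = ψ := funext fun z => (hd z).deriv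
  refine ⟨fun z => ∫ t in (-1)..z, ψ t, ⟨?_, ?_⟩, hd'⟩
  · refine contDiff_infty_iff_deriv.2 ⟨fun z => (hd z).differentiableAt, ?_⟩
    rw [hd']; exact h.1
  · obtain ⟨r, hr, hr0⟩ := h.2
    refine ⟨max r 0, max_lt hr one_pos, fun z hz => ?_⟩
    have hr1 : max r 0 < 1 := max_lt hr one_pos
    simp only
    have hvan : ∀ t, max r 0 ≤ |t| → ψ t = 0 := fun t ht => hr0 t ((le_max_left _ _).trans ht)
    rcases le_total 0 z with hz0 | hz0
    · rw [abs_of_nonneg hz0] at hz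
      rw [← intervalIntegral.integral_add_adjacent_intervals (hc.intervalIntegrable (-1) 1)
        (hc.intervalIntegrable 1 z), ← integral_zm, h0, zero_add]
      refine intervalIntegral.integral_zero_ae (Eventually.of_forall fun t ht => hvan t ?_)
      have : max r 0 ≤ t := (le_min hr1.le hz).trans ht.1.le
      exact this.trans (le_abs_self t)
    · rw [abs_of_nonpos hz0] at hz
      refine intervalIntegral.integral_zero_ae (Eventually.of_forall fun t ht => hvan t ?_)
      have : t ≤ - max r 0 := ht.2.trans (max_le (by linarith) (by linarith))
      exact (by linarith : max r 0 ≤ -t).trans (neg_le_abs t)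

/-- The lemma of du Bois-Reymond. -/
lemma ae_zm_const {f : ℝ → ℝ} (hf : Integrable f zm)
    (h : ∀ χ, IsTestZ χ → ∫ z, f z * deriv χ z ∂zm = 0) : ∃ c, f =ᵐ[zm] fun _ => c := by
  let b : ContDiffBump (0 : ℝ) := ⟨1 / 4, 1 / 2, by norm_num, by norm_num⟩
  have hb : IsTestZ b := by
    refine ⟨b.contDiff, 1 / 2, by norm_num, fun z hz => b.zero_of_le_dist ?_⟩
    simpa [Real.dist_eq, b] using hz
  have hbp : 0 < ∫ z, b z ∂zm := by
    have : ∫ z, b z ∂zm = ∫ z, b z := by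
      rw [zm, setIntegral_eq_integral_of_forall_compl_eq_zero]
      intro x hx
      obtain ⟨r, hr, h0⟩ := hb.2
      refine h0 x (hr.le.trans ?_)
      by_contra hlt
      exact hx (abs_lt.1 (not_le.1 hlt))
    rw [this]; exact b.integral_pos
  set c0 := ∫ z, b z ∂zm with hc0
  refine ⟨(∫ z, f z * b z ∂zm) / c0, ?_⟩
  set c := (∫ z, f z * b z ∂zm) / c0 with hc
  have key : (fun z => f z - c) =ᵐ[zm] 0 := by
    refine ae_zm_eq_zero (hf.sub (integrable_const c)) fun ψ hψ => ?_
    -- With this `d` the function `ψ - d b` has mean zero, so it is the derivative of a test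
    -- function and the hypothesis applies to it.
    set d := (∫ z, ψ z ∂zm) / c0 with hd
    have ht : IsTestZ (fun z => ψ z - d * b z) := hψ.sub (hb.mul_left contDiff_const)
    have hib := integrable_zm hb.continuous
    have hiψ := integrable_zm hψ.continuous
    obtain ⟨χ, hχ, hχd⟩ := exists_isTestZ_deriv ht (by
      rw [integral_sub hiψ (hib.const_mul d), integral_const_mul, hd]
      field_simp; simp [hc0])
    have h1 := h χ hχ
    rw [hχd] at h1
    have e1 : ∀ z, f z * (ψ z - d * b z) = f z * ψ z - d * (f z * b z) := fun z => by ring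
    simp_rw [e1] at h1
    rw [integral_sub (integrable_zm_mul hf hψ.continuous)
      ((integrable_zm_mul hf hb.continuous).const_mul d), integral_const_mul] at h1
    have e2 : ∀ z, (f z - c) * ψ z = f z * ψ z - c * ψ z := fun z => by ring
    simp_rw [e2]
    rw [integral_sub (integrable_zm_mul hf hψ.continuous) (hiψ.const_mul c), integral_const_mul,
      ← h1, hc, hd]
    field_simp
  filter_upwards [key] with z hz
  simpa [sub_eq_zero] using hz

/-- Weak solutions of a linear system with constant coefficients are classical solutions. -/
lemma weak_linear_system {N : ℕ} (M : Fin N → Fin N → ℝ) (y : Fin N → ℝ → ℝ)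
    (hy : ∀ i, Integrable (y i) zm)
    (h : ∀ i χ, IsTestZ χ →
      ∫ z, y i z * deriv χ z ∂zm = - ∫ z, (∑ k, M i k * y k z) * χ z ∂zm) :
    ∃ Y : Fin N → ℝ → ℝ, (∀ i z, HasDerivAt (Y i) (∑ k, M i k * Y k z) z) ∧
      ∀ i, y i =ᵐ[zm] Y i := by
  let A : (Fin N → ℝ) →L[ℝ] (Fin N → ℝ) := LinearMap.toContinuousLinearMap (Matrix.toLin' (Matrix.of M))
  have hA : ∀ v i, A v i = ∑ k, M i k * v k := fun v i => by
    change Matrix.toLin' (Matrix.of M) v i = _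
    rw [Matrix.toLin'_apply]; rfl
  -- Variation of constants: the vector `X (-z) y(z)` has weak derivative zero, so it is a constant
  -- `c`, and `y = X(z) c` almost everywhere.
  let X : ℝ → ((Fin N → ℝ) →L[ℝ] (Fin N → ℝ)) := fun z => NormedSpace.exp (z • A)
  have hX : ∀ z, HasDerivAt X (X z * A) z := fun z => hasDerivAt_exp_smul_const A z
  have hX' : ∀ z, HasDerivAt X (A * X z) z := fun z => hasDerivAt_exp_smul_const' A z
  have hXs : ContDiff ℝ ∞ X := by
    have key : ∀ n : ℕ, ContDiff ℝ n X := by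
      intro n
      induction n with
      | zero =>
        exact contDiff_zero.2 (continuous_iff_continuousAt.2 fun z => (hX z).continuousAt)
      | succ n ih =>
        have : deriv X = fun z => X z * A := funext fun z => (hX z).deriv
        have h2 := contDiff_succ_iff_deriv (n := (n : WithTop ℕ∞)) (f := X)
        push_cast
        refine h2.2 ⟨fun z => (hX z).differentiableAt, by simp, ?_⟩
        rw [this]
        exact ih.mul contDiff_const
    exact contDiff_infty.2 key
  have hXinv : ∀ z, X z * X (-z) = 1 := fun z => by
    let _ : NormedAlgebra ℚ ((Fin N → ℝ) →L[ℝ] (Fin N → ℝ)) := NormedAlgebra.restrictScalars ℚ ℝ _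
    change NormedSpace.exp (z • A) * NormedSpace.exp (-z • A) = 1
    rw [← NormedSpace.exp_add_of_commute (((Commute.refl A).smul_left _).smul_right _)]
    have : z • A + -z • A = 0 := by rw [← add_smul, add_neg_cancel, zero_smul]
    rw [this, NormedSpace.exp_zero]
  -- The entries of `X (-z)`. They are smooth, so their products with a test function are again test
  -- functions, which is all that the weak equations for `y` allow.
  let E : Fin N → Fin N → ℝ → ℝ := fun i j z => X (-z) (Pi.single j 1) i
  have hlin : ∀ z v i, X (-z) v i = ∑ j, E i j z * v j := fun z v i => by
    conv_lhs => rw [pi_eq_sum_univ' v]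
    simp [E, map_sum, mul_comm]
  have hEs : ∀ i j, ContDiff ℝ ∞ (E i j) := fun i j => by
    have h1 : ContDiff ℝ ∞ fun z => X (-z) (Pi.single j 1) :=
      (hXs.comp contDiff_neg).clm_apply contDiff_const
    exact (contDiff_pi.1 h1) i
  have hEd : ∀ i j z, HasDerivAt (E i j) (- ∑ k, E i k z * M k j) z := fun i j z => by
    have h1 : HasDerivAt (fun z => X (-z)) (-(X (-z) * A)) z := by
      have := (hX (-z)).scomp z (hasDerivAt_neg z)
      rw [neg_one_smul] at this
      exact this
    have h2 := h1.clm_apply (hasDerivAt_const z (Pi.single j (1 : ℝ) : Fin N → ℝ))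
    have h3 := (hasDerivAt_pi.1 h2) i
    have h4 : (X (-z) * A) (Pi.single j 1) = X (-z) (A (Pi.single j 1)) := rfl
    have h5 : (-(X (-z) * A)) (Pi.single j 1) i = -(X (-z) (A (Pi.single j 1)) i) := rfl
    have h6 : ((-(X (-z) * A)) (Pi.single j 1) + (X (-z)) 0) i = - ∑ k, E i k z * M k j := by
      rw [map_zero, add_zero, h5, hlin]
      simp [hA, Pi.single_apply]
    rw [← h6]
    exact h3
  have hint : ∀ i j χ, Continuous χ → Integrable (fun z => y j z * (E i j z * χ z)) zm :=
    fun i j χ hχ => integrable_zm_mul (hy j) ((hEs i j).continuous.mul hχ)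
  have hc : ∀ i, ∃ c, (fun z => ∑ j, E i j z * y j z) =ᵐ[zm] fun _ => c := by
    intro i
    refine ae_zm_const ?_ fun χ hχ => ?_
    · refine integrable_finsetSum _ fun j _ => ?_
      simpa [mul_comm] using hint i j (fun _ => 1) continuous_const
    · have hχ' := hχ.deriv.continuous
      have e1 : ∀ j, ∫ z, y j z * (E i j z * deriv χ z) ∂zm
          = - ∑ k, M j k * ∫ z, y k z * (E i j z * χ z) ∂zm
            + ∑ k, M k j * ∫ z, y j z * (E i k z * χ z) ∂zm := by
        intro j
        have h1 := h j _ (hχ.mul_left (hEs i j))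
        have hder : ∀ z, deriv (fun z => E i j z * χ z) z
            = (- ∑ k, E i k z * M k j) * χ z + E i j z * deriv χ z := fun z =>
          ((hEd i j z).mul ((hχ.1.differentiable (by simp)) z).hasDerivAt).deriv
        have e2 : ∀ z, y j z * deriv (fun z => E i j z * χ z) z
            = y j z * (E i j z * deriv χ z) - ∑ k, M k j * (y j z * (E i k z * χ z)) := by
          intro z
          rw [hder, neg_mul, Finset.sum_mul, mul_add, mul_neg, Finset.mul_sum]
          rw [add_comm, ← sub_eq_add_neg]
          congr 1
          refine Finset.sum_congr rfl fun k _ => ?_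
          ring
        have e3 : ∀ z, (∑ k, M j k * y k z) * (E i j z * χ z)
            = ∑ k, M j k * (y k z * (E i j z * χ z)) := by
          intro z; rw [Finset.sum_mul]
          refine Finset.sum_congr rfl fun k _ => ?_
          ring
        simp_rw [e2, e3] at h1
        have i1 : ∀ k, Integrable (fun z => M k j * (y j z * (E i k z * χ z))) zm := fun k =>
          (integrable_zm_mul (hy j) ((hEs i k).continuous.mul hχ.continuous)).const_mul _
        have i2 : ∀ k, Integrable (fun z => M j k * (y k z * (E i j z * χ z))) zm := fun k =>
          (integrable_zm_mul (hy k) ((hEs i j).continuous.mul hχ.continuous)).const_mul _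
        rw [integral_sub (hint i j _ hχ') (integrable_finsetSum _ fun k _ => i1 k),
          integral_finsetSum _ fun k _ => i1 k, integral_finsetSum _ fun k _ => i2 k] at h1
        simp_rw [integral_const_mul] at h1
        linarith
      have e4 : ∀ z, (∑ j, E i j z * y j z) * deriv χ z
          = ∑ j, y j z * (E i j z * deriv χ z) := by
        intro z; rw [Finset.sum_mul]
        refine Finset.sum_congr rfl fun k _ => ?_
        ring
      simp_rw [e4]
      rw [integral_finsetSum _ fun j _ => hint i j _ hχ']
      simp_rw [e1]
      rw [Finset.sum_add_distrib, Finset.sum_neg_distrib]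
      -- After exchanging `j` and `k`, the terms from the equation for `y` cancel those from the
      -- derivative of `E`.
      rw [Finset.sum_comm (f := fun j k => M k j * ∫ z, y j z * (E i k z * χ z) ∂zm)]
      simp
  choose c hc using hc
  have hY : ∀ z, HasDerivAt (fun z => X z c) (A (X z c)) z := fun z => by
    simpa using (hX' z).clm_apply (hasDerivAt_const z c)
  refine ⟨fun i z => X z c i, fun i z => ?_, fun i => ?_⟩
  · have := (hasDerivAt_pi.1 (hY z)) i
    rwa [hA] at this
  · have hall : ∀ᵐ z ∂zm, ∀ i, ∑ j, E i j z * y j z = c i := ae_all_iff.2 hc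
    filter_upwards [hall] with z hz
    have h1 : X (-z) (fun j => y j z) = c := by
      ext k; rw [hlin]; exact hz k
    rw [← h1]
    have := congrArg (fun T => T (fun j => y j z)) (hXinv z)
    simp only [mul_apply_eq_comp, one_apply_eq_self] at this
    rw [this]

/-! ### The characteristic equations and their zeros. -/

/-- The function whose positive zeros give the even vertical velocities. -/
noncomputable def charEven (μ σ : ℝ) : ℝ :=
  σ * Real.sin σ * Real.cosh μ + μ * Real.sinh μ * Real.cos σ

/-- The function whose positive zeros give the odd vertical velocities. -/
noncomputable def charOdd (μ σ : ℝ) : ℝ :=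
  σ * Real.cos σ * Real.sinh μ - μ * Real.cosh μ * Real.sin σ

/-- The function whose positive zeros give the `p`-th vertical velocities, by the parity of `p`. -/
noncomputable def charFn (p : ℕ) (μ σ : ℝ) : ℝ :=
  if Even p then charEven μ σ else charOdd μ σ

lemma charEven_add_nat_mul_pi (μ t : ℝ) (k : ℕ) : charEven μ (t + k * Real.pi)
    = (-1) ^ k * ((t + k * Real.pi) * Real.sin t * Real.cosh μ
      + μ * Real.sinh μ * Real.cos t) := by
  rw [charEven, Real.sin_add_nat_mul_pi, Real.cos_add_nat_mul_pi]; ring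

lemma charOdd_add_nat_mul_pi (μ t : ℝ) (k : ℕ) : charOdd μ (t + k * Real.pi)
    = (-1) ^ k * ((t + k * Real.pi) * Real.cos t * Real.sinh μ
      - μ * Real.cosh μ * Real.sin t) := by
  rw [charOdd, Real.sin_add_nat_mul_pi, Real.cos_add_nat_mul_pi]; ring

/-- The intermediate value theorem on a quarter period: at each end one of `sin` and `cos` vanishes,
and the surviving terms have opposite signs. For `p = 2k` the interval is `kπ + (π/2, π)`, for `p =
2k + 1` it is `(k + 1)π + (0, π/2)`. -/
lemma exists_charFn_eq_zero {μ : ℝ} (hμ : 0 < μ) (p : ℕ) :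
    ∃ σ, Real.pi / 2 * (1 + p) < σ ∧ σ < Real.pi / 2 * (2 + p) ∧ charFn p μ σ = 0 := by
  have hpi := Real.pi_pos
  have hs : 0 < Real.sinh μ := Real.sinh_pos_iff.2 hμ
  have hc : 0 < Real.cosh μ := Real.cosh_pos μ
  rcases Nat.even_or_odd p with hp | hp
  · obtain ⟨k, rfl⟩ := hp
    have hcont : ContinuousOn (fun t : ℝ => (t + k * Real.pi) * Real.sin t * Real.cosh μ
      + μ * Real.sinh μ * Real.cos t) (Icc (Real.pi / 2) Real.pi) := by fun_prop
    have h0 := intermediate_value_Ioo' (by linarith) hcont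
    have hm : (0 : ℝ) ∈ Ioo (((Real.pi + k * Real.pi) * Real.sin Real.pi * Real.cosh μ
      + μ * Real.sinh μ * Real.cos Real.pi)) ((Real.pi / 2 + k * Real.pi) *
        Real.sin (Real.pi / 2) * Real.cosh μ + μ * Real.sinh μ * Real.cos (Real.pi / 2)) := by
      constructor
      · simp; positivity
      · simp; positivity
    obtain ⟨t, ht, h1⟩ := h0 hm
    refine ⟨t + k * Real.pi, ?_, ?_, ?_⟩
    · push_cast; linarith [ht.1]
    · push_cast; linarith [ht.2]
    · rw [charFn, if_pos ⟨k, rfl⟩, charEven_add_nat_mul_pi]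
      simp only at h1
      rw [h1, mul_zero]
  · have hnp : ¬ Even p := Nat.not_even_iff_odd.2 hp
    obtain ⟨k, rfl⟩ := hp
    have hcont : ContinuousOn (fun t : ℝ => (t + (k + 1 : ℕ) * Real.pi) * Real.cos t * Real.sinh μ
      - μ * Real.cosh μ * Real.sin t) (Icc 0 (Real.pi / 2)) := by fun_prop
    have h0 := intermediate_value_Ioo' (by linarith) hcont
    have hm : (0 : ℝ) ∈ Ioo (((Real.pi / 2 + (k + 1 : ℕ) * Real.pi) * Real.cos (Real.pi / 2)
      * Real.sinh μ - μ * Real.cosh μ * Real.sin (Real.pi / 2))) ((0 + (k + 1 : ℕ) * Real.pi) *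
        Real.cos 0 * Real.sinh μ - μ * Real.cosh μ * Real.sin 0) := by
      constructor
      · simp; positivity
      · simp; positivity
    obtain ⟨t, ht, h1⟩ := h0 hm
    refine ⟨t + (k + 1 : ℕ) * Real.pi, ?_, ?_, ?_⟩
    · push_cast; linarith [ht.1]
    · push_cast; linarith [ht.2]
    · rw [charFn, if_neg hnp, charOdd_add_nat_mul_pi]
      simp only at h1
      rw [h1, mul_zero]

/-- Two zeros in one of the intervals coincide. -/
lemma charFn_zero_unique {μ : ℝ} {p : ℕ} {σ τ : ℝ}
    (hσ : Real.pi / 2 * (1 + p) < σ) (hτ : τ < Real.pi / 2 * (2 + p))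
    (h1 : charFn p μ σ = 0) (h2 : charFn p μ τ = 0) (hμ : 0 < μ) : τ ≤ σ := by
  by_contra! hlt
  have hpi := Real.pi_pos
  have hp : (0 : ℝ) ≤ p := p.cast_nonneg
  have hpp : 0 ≤ Real.pi / 2 * p := by positivity
  have hs : 0 < Real.sinh μ := Real.sinh_pos_iff.2 hμ
  have hc : 0 < Real.cosh μ := Real.cosh_pos μ
  have hA : Real.pi < σ + τ := by nlinarith
  have hB : τ - σ < Real.pi / 2 := by nlinarith
  have hj := Real.mul_le_sin (sub_pos.2 hlt).le hB.le
  -- Eliminating `μ` from the two equations gives `(σ + τ) sin(τ - σ) = ∓(τ - σ) sin(σ + τ)`, with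
  -- the upper sign in the even case. With Jordan's inequality `sin x ≥ 2x/π` for `x = τ - σ`, the
  -- bound forces `σ + τ ≤ π/2`, against `σ + τ > π`.
  have key : (σ + τ) * Real.sin (τ - σ) ≤ τ - σ := by
    unfold charFn at h1 h2
    split_ifs at h1 h2
    · have e : σ * Real.sin σ * Real.cos τ - τ * Real.sin τ * Real.cos σ = 0 := by
        have : Real.cosh μ * (σ * Real.sin σ * Real.cos τ - τ * Real.sin τ * Real.cos σ) = 0 := by
          unfold charEven at h1 h2
          linear_combination Real.cos τ * h1 - Real.cos σ * h2
        exact (mul_eq_zero.1 this).resolve_left hc.ne'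
      have e2 : (σ + τ) * Real.sin (τ - σ) = - ((τ - σ) * Real.sin (σ + τ)) := by
        rw [Real.sin_sub, Real.sin_add]; linear_combination -2 * e
      rw [e2]
      nlinarith [Real.neg_one_le_sin (σ + τ)]
    · have e : σ * Real.cos σ * Real.sin τ - τ * Real.cos τ * Real.sin σ = 0 := by
        have : Real.sinh μ * (σ * Real.cos σ * Real.sin τ - τ * Real.cos τ * Real.sin σ) = 0 := by
          unfold charOdd at h1 h2
          linear_combination Real.sin τ * h1 - Real.sin σ * h2
        exact (mul_eq_zero.1 this).resolve_left hs.ne'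
      have e2 : (σ + τ) * Real.sin (τ - σ) = (τ - σ) * Real.sin (σ + τ) := by
        rw [Real.sin_sub, Real.sin_add]; linear_combination 2 * e
      rw [e2]
      nlinarith [Real.sin_le_one (σ + τ)]
  have hj' : (σ + τ) * (2 / Real.pi * (τ - σ)) ≤ τ - σ :=
    (mul_le_mul_of_nonneg_left hj (by linarith)).trans key
  have h3 : (σ + τ) * (2 / Real.pi) ≤ 1 := by
    by_contra! h
    nlinarith [sub_pos.2 hlt]
  rw [mul_div_assoc', div_le_one hpi] at h3
  linarith

open Classical in
/-- The zero of `charFn p μ` between `(π/2)(1+p)` and `(π/2)(2+p)`. -/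
noncomputable def root (μ : ℝ) (p : ℕ) : ℝ :=
  -- The value `0` is a default for `μ ≤ 0`, where no zero is claimed.
  if h : 0 < μ then (exists_charFn_eq_zero h p).choose else 0

lemma lt_root {μ : ℝ} (hμ : 0 < μ) (p : ℕ) : Real.pi / 2 * (1 + p) < root μ p := by
  rw [root, dif_pos hμ]; exact (exists_charFn_eq_zero hμ p).choose_spec.1

lemma root_lt {μ : ℝ} (hμ : 0 < μ) (p : ℕ) : root μ p < Real.pi / 2 * (2 + p) := by
  rw [root, dif_pos hμ]; exact (exists_charFn_eq_zero hμ p).choose_spec.2.1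

lemma charFn_root {μ : ℝ} (hμ : 0 < μ) (p : ℕ) : charFn p μ (root μ p) = 0 := by
  rw [root, dif_pos hμ]; exact (exists_charFn_eq_zero hμ p).choose_spec.2.2

lemma root_pos {μ : ℝ} (hμ : 0 < μ) (p : ℕ) : 0 < root μ p := by
  refine lt_trans ?_ (lt_root hμ p)
  have := Real.pi_pos
  positivity

lemma root_strictMono {μ : ℝ} (hμ : 0 < μ) : StrictMono (root μ) := by
  refine strictMono_nat_of_lt_succ fun p => ?_
  have h1 := root_lt hμ p
  have h2 := lt_root hμ (p + 1)
  push_cast at h2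
  linarith

lemma eq_root {μ σ : ℝ} (hμ : 0 < μ) {p : ℕ} (h1 : Real.pi / 2 * (1 + p) < σ)
    (h2 : σ < Real.pi / 2 * (2 + p)) (h : charFn p μ σ = 0) : σ = root μ p :=
  le_antisymm (charFn_zero_unique (lt_root hμ p) h2 (charFn_root hμ p) h hμ)
    (charFn_zero_unique h1 (root_lt hμ p) h (charFn_root hμ p) hμ)

lemma exists_nat_mul_pi_add {σ : ℝ} (hσ : 0 < σ) :
    ∃ (k : ℕ) (t : ℝ), 0 ≤ t ∧ t < Real.pi ∧ σ = t + k * Real.pi := by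
  have hpi := Real.pi_pos
  refine ⟨⌊σ / Real.pi⌋₊, σ - ⌊σ / Real.pi⌋₊ * Real.pi, ?_, ?_, by ring⟩
  · have := Nat.floor_le (div_nonneg hσ.le hpi.le)
    rw [le_div_iff₀ hpi] at this
    linarith
  · have := Nat.lt_floor_add_one (σ / Real.pi)
    rw [div_lt_iff₀ hpi] at this
    linarith

/-- Modulo `π` and up to sign, both terms of `charEven` are nonnegative on `[0, π/2]` and do not
vanish together. A zero therefore has its remainder in `(π/2, π)`, which is the interval of an even
index. -/
lemma eq_root_of_charEven {μ σ : ℝ} (hμ : 0 < μ) (hσ : 0 < σ) (h : charEven μ σ = 0) :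
    ∃ p, Even p ∧ σ = root μ p := by
  have hpi := Real.pi_pos
  have hs : 0 < Real.sinh μ := Real.sinh_pos_iff.2 hμ
  have hc : 0 < Real.cosh μ := Real.cosh_pos μ
  obtain ⟨k, t, ht0, ht1, rfl⟩ := exists_nat_mul_pi_add hσ
  refine ⟨2 * k, by simp, eq_root hμ ?_ ?_ (by rw [charFn, if_pos (by simp), h])⟩
  · have : Real.pi / 2 < t := by
      by_contra! hle
      rw [charEven_add_nat_mul_pi] at h
      have h1 := (mul_eq_zero.1 h).resolve_left (pow_ne_zero _ (by norm_num))
      have hcos : 0 ≤ Real.cos t := Real.cos_nonneg_of_neg_pi_div_two_le_of_le (by linarith) hle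
      have hsin : 0 ≤ Real.sin t := Real.sin_nonneg_of_nonneg_of_le_pi ht0 ht1.le
      rcases ht0.eq_or_lt with rfl | h0
      · rw [Real.cos_zero, Real.sin_zero] at h1
        have := mul_pos hμ hs
        linarith
      · have : 0 < Real.sin t := Real.sin_pos_of_pos_of_lt_pi h0 ht1
        have h2 : 0 < (t + k * Real.pi) * Real.sin t * Real.cosh μ := by positivity
        have h3 : 0 ≤ μ * Real.sinh μ * Real.cos t := by positivity
        linarith
    push_cast; linarith
  · push_cast; linarith

/-- The difference `x cosh x - sinh x` has derivative `x sinh x`. The inequality serves to exclude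
zeros of `charOdd` in `(0, π/2)`. -/
lemma sinh_lt_mul_cosh {μ : ℝ} (hμ : 0 < μ) : Real.sinh μ < μ * Real.cosh μ := by
  have hd : ∀ x, HasDerivAt (fun x => x * Real.cosh x - Real.sinh x) (x * Real.sinh x) x := by
    intro x
    exact (((hasDerivAt_id' x).fun_mul (Real.hasDerivAt_cosh x)).fun_sub
      (Real.hasDerivAt_sinh x)).congr_deriv (by ring)
  have hm : StrictMonoOn (fun x => x * Real.cosh x - Real.sinh x) (Ici 0) := by
    refine strictMonoOn_of_deriv_pos (convex_Ici 0) (by fun_prop) fun x hx => ?_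
    rw [(hd x).deriv]
    simp only [interior_Ici, mem_Ioi] at hx
    exact mul_pos hx (Real.sinh_pos_iff.2 hx)
  have := hm (mem_Ici.2 le_rfl) (mem_Ici.2 hμ.le) hμ
  simp at this
  linarith

lemma eq_root_of_charOdd {μ σ : ℝ} (hμ : 0 < μ) (hσ : 0 < σ) (h : charOdd μ σ = 0) :
    ∃ p, ¬ Even p ∧ σ = root μ p := by
  have hpi := Real.pi_pos
  have hs : 0 < Real.sinh μ := Real.sinh_pos_iff.2 hμ
  have hc : 0 < Real.cosh μ := Real.cosh_pos μ
  obtain ⟨k, t, ht0, ht1, rfl⟩ := exists_nat_mul_pi_add hσ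
  have h' := h
  rw [charOdd_add_nat_mul_pi] at h
  have h1 := (mul_eq_zero.1 h).resolve_left (pow_ne_zero _ (by norm_num))
  have ht : 0 < t := by
    rcases ht0.eq_or_lt with rfl | h0
    · rw [Real.cos_zero, Real.sin_zero] at h1
      have := mul_pos hσ hs
      linarith
    · exact h0
  have hsin : 0 < Real.sin t := Real.sin_pos_of_pos_of_lt_pi ht ht1
  have hlt : t < Real.pi / 2 := by
    by_contra! hle
    have hcos : Real.cos t ≤ 0 :=
      Real.cos_nonpos_of_pi_div_two_le_of_le hle (by linarith)
    have h2 : 0 < μ * Real.cosh μ * Real.sin t := by positivity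
    have h3 : 0 ≤ (t + k * Real.pi) * -Real.cos t * Real.sinh μ := by
      have : 0 ≤ -Real.cos t := by linarith
      positivity
    linarith
  -- For `k = 0` one would have `t cos t sinh μ < sin t sinh μ < μ cosh μ sin t`, from `t < tan t`
  -- and `sinh μ < μ cosh μ`. So the first odd zero lies beyond `π`, and the index is `2(k - 1) +
  -- 1`.
  have hk : 1 ≤ k := by
    by_contra! hk
    obtain rfl : k = 0 := by omega
    have hcos : 0 < Real.cos t := Real.cos_pos_of_mem_Ioo ⟨by linarith, hlt⟩
    have h2 : t * Real.cos t < Real.sin t := by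
      have := Real.lt_tan ht hlt
      rwa [Real.tan_eq_sin_div_cos, lt_div_iff₀ hcos] at this
    have h3 := sinh_lt_mul_cosh hμ
    simp at h1
    nlinarith
  obtain ⟨j, rfl⟩ : ∃ j, k = j + 1 := ⟨k - 1, by omega⟩
  have hodd : ¬ Even (2 * j + 1) := by simp
  refine ⟨2 * j + 1, hodd, eq_root hμ ?_ ?_ (by rw [charFn, if_neg hodd, h'])⟩
  · push_cast; linarith
  · push_cast; linarith

lemma tan_root {μ : ℝ} (hμ : 0 < μ) {p : ℕ} (hp : Even p) :
    root μ p * Real.tan (root μ p) = - μ * Real.tanh μ := by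
  have h := charFn_root hμ p
  rw [charFn, if_pos hp, charEven] at h
  have hc : 0 < Real.cosh μ := Real.cosh_pos μ
  -- If the cosine vanished, the characteristic equation would force the sine to vanish too.
  have hcos : Real.cos (root μ p) ≠ 0 := by
    intro h0
    have h1 := Real.sin_sq_add_cos_sq (root μ p)
    rw [h0] at h h1
    have h2 : Real.sin (root μ p) ≠ 0 := by intro h3; simp [h3] at h1
    have := mul_ne_zero (mul_ne_zero (root_pos hμ p).ne' h2) hc.ne'
    simp at h this
    tauto
  rw [Real.tan_eq_sin_div_cos, Real.tanh_eq_sinh_div_cosh]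
  field_simp
  linarith

lemma cot_root {μ : ℝ} (hμ : 0 < μ) {p : ℕ} (hp : Odd p) :
    root μ p * Real.cot (root μ p) = μ * (Real.cosh μ / Real.sinh μ) := by
  have h := charFn_root hμ p
  rw [charFn, if_neg (Nat.not_even_iff_odd.2 hp), charOdd] at h
  have hs : 0 < Real.sinh μ := Real.sinh_pos_iff.2 hμ
  have hsin : Real.sin (root μ p) ≠ 0 := by
    intro h0
    have h1 := Real.sin_sq_add_cos_sq (root μ p)
    rw [h0] at h h1
    have h2 : Real.cos (root μ p) ≠ 0 := by intro h3; simp [h3] at h1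
    have := mul_ne_zero (mul_ne_zero (root_pos hμ p).ne' h2) hs.ne'
    simp at h this
    tauto
  rw [Real.cot_eq_cos_div_sin]
  field_simp
  linarith

/-! ### The two sequences of eigenvalues. -/

/-- The eigenvalues with non-constant pressure. -/
noncomputable def LamD (m n p : ℕ) : ℝ := mu m n ^ 2 + root (mu m n) p ^ 2

lemma mu_sq (m n : ℕ) : mu m n ^ 2 = (m : ℝ) ^ 2 + (n : ℝ) ^ 2 := Real.sq_sqrt (by positivity)

lemma sqrt_LamD_sub {m n : ℕ} (h : 0 < mu m n) (p : ℕ) :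
    Real.sqrt (LamD m n p - mu m n ^ 2) = root (mu m n) p := by
  rw [LamD, add_sub_cancel_left, Real.sqrt_sq (root_pos h p).le]

lemma LamD_mem {m n : ℕ} (h : 0 < mu m n) (p : ℕ) :
    LamD m n p ∈ Set.Ioo (mu m n ^ 2 + Real.pi ^ 2 / 4 * (1 + (p : ℝ)) ^ 2)
          (mu m n ^ 2 + Real.pi ^ 2 / 4 * (2 + (p : ℝ)) ^ 2) := by
  have h1 := lt_root h p
  have h2 := root_lt h p
  have h3 := root_pos h p
  have hpi := Real.pi_pos
  have h0 : 0 < Real.pi / 2 * (1 + (p : ℝ)) := by positivity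
  unfold LamD
  constructor
  · nlinarith
  · nlinarith

/-- The endpoints of the interval of `LamD m n p` are consecutive values of `lamD m n`. This
separates the two classes within one mode, and it later shows that the pressure of the second class
is not constant. -/
lemma LamD_ne_lamD {m n : ℕ} (h : 0 < mu m n) (p k : ℕ) : LamD m n p ≠ lamD m n k := by
  intro he
  obtain ⟨h1, h2⟩ := LamD_mem h p
  rw [he, lamD] at h1 h2
  have hpi : 0 < Real.pi ^ 2 / 4 := by have := Real.pi_pos; positivity
  have h3 : (1 + (p : ℝ)) ^ 2 < (k : ℝ) ^ 2 := lt_of_mul_lt_mul_left (by linarith) hpi.le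
  have h4 : (k : ℝ) ^ 2 < (2 + (p : ℝ)) ^ 2 := lt_of_mul_lt_mul_left (by linarith) hpi.le
  have h5 : (1 + p) ^ 2 < k ^ 2 := by exact_mod_cast h3
  have h6 : k ^ 2 < (2 + p) ^ 2 := by exact_mod_cast h4
  have := lt_of_pow_lt_pow_left' 2 h5
  have := lt_of_pow_lt_pow_left' 2 h6
  omega

lemma LamD_strictMono {m n : ℕ} (h : 0 < mu m n) : StrictMono (LamD m n) := fun p k hpk => by
  have h1 := root_strictMono h hpk
  have h2 := root_pos h p
  unfold LamD
  nlinarith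

lemma LamD_pos {m n : ℕ} (h : 0 < mu m n) (p : ℕ) : 0 < LamD m n p := by
  have := root_pos h p
  unfold LamD
  positivity

lemma tendsto_lamD (m n : ℕ) : Tendsto (lamD m n) atTop atTop := by
  have hpi : 0 < Real.pi ^ 2 / 4 := by have := Real.pi_pos; positivity
  unfold lamD
  refine tendsto_atTop_add_const_left _ _ ?_
  exact ((tendsto_pow_atTop two_ne_zero).comp tendsto_natCast_atTop_atTop).const_mul_atTop hpi

lemma tendsto_LamD {m n : ℕ} (h : 0 < mu m n) : Tendsto (LamD m n) atTop atTop := by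
  refine tendsto_atTop_mono (fun p => ?_) (tendsto_lamD m n)
  have h1 := (LamD_mem h p).1
  have hpi : 0 < Real.pi ^ 2 / 4 := by have := Real.pi_pos; positivity
  have hp : (0 : ℝ) ≤ p := p.cast_nonneg
  unfold lamD
  nlinarith

lemma lamD_pos {m n p : ℕ} (hp : 1 ≤ p) : 0 < lamD m n p := by
  have := Real.pi_pos
  have : (0 : ℝ) < p := by exact_mod_cast hp
  unfold lamD
  positivity

lemma lamD_strictMonoOn (m n : ℕ) : StrictMonoOn (lamD m n) (Ici 1) := fun p _ k _ hpk => by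
  have hpi : 0 < Real.pi ^ 2 / 4 := by have := Real.pi_pos; positivity
  have h1 : (p : ℝ) < k := by exact_mod_cast hpk
  have hp : (0 : ℝ) ≤ p := p.cast_nonneg
  unfold lamD
  have : (p : ℝ) ^ 2 < (k : ℝ) ^ 2 := by nlinarith
  nlinarith

/-! ### The ordinary differential equations of one mode. -/

lemma eq_zero_on_Icc_of_deriv {f f' : ℝ → ℝ} (hf : ∀ z, HasDerivAt f (f' z) z)
    (h0 : f (-1) = 0) (h : ∀ z ∈ Ioo (-1 : ℝ) 1, f' z = 0) : ∀ z ∈ Icc (-1 : ℝ) 1, f z = 0 := by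
  intro z hz
  rcases hz.1.eq_or_lt with rfl | hlt
  · exact h0
  · obtain ⟨c, hc, he⟩ := exists_hasDerivAt_eq_slope f f' hlt
      (fun x _ => (hf x).continuousAt.continuousWithinAt) (fun x _ => hf x)
    rw [h c ⟨hc.1, hc.2.trans_le hz.2⟩, h0] at he
    have : z - -1 ≠ 0 := by linarith
    have he' := he.symm
    rw [div_eq_zero_iff] at he'
    rcases he' with h1 | h1
    · linarith
    · exact absurd h1 this

/-- The horizontal Fourier coefficients of a Dirichlet eigenfunction and its pressure. -/
structure ModeSol (m n : ℕ) (s : ℝ) (U U₁ V V₁ W Q : ℝ → ℝ) : Prop where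
  dU : ∀ z, HasDerivAt U (U₁ z) z
  dU₁ : ∀ z, HasDerivAt U₁ (-s * U z + m * Q z) z
  dV : ∀ z, HasDerivAt V (V₁ z) z
  dV₁ : ∀ z, HasDerivAt V₁ (-s * V z + n * Q z) z
  dW : ∀ z, HasDerivAt W (m * U z + n * V z) z
  -- The third momentum equation, with `W''` expressed through the divergence condition; this keeps
  -- the system of first order.
  dQ : ∀ z, HasDerivAt Q (m * U₁ z + n * V₁ z + s * W z) z
  bU : U (-1) = 0 ∧ U 1 = 0
  bV : V (-1) = 0 ∧ V 1 = 0
  bW : W (-1) = 0 ∧ W 1 = 0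

/-- Energy identity: the function `E` below vanishes at both walls, and for `s ≤ 0` its derivative
is a sum of nonnegative terms. So `E` is constant, the squares of `U'`, `V'`, `W'` vanish inside,
and the wall conditions finish the proof. -/
lemma ModeSol.eq_zero {m n : ℕ} {s : ℝ} {U U₁ V V₁ W Q : ℝ → ℝ}
    (h : ModeSol m n s U U₁ V V₁ W Q) (hs : s ≤ 0) :
    ∀ z ∈ Icc (-1 : ℝ) 1, U z = 0 ∧ V z = 0 ∧ W z = 0 := by
  have hE : ∀ z, HasDerivAt
      (fun z => U z * U₁ z + V z * V₁ z + W z * (m * U z + n * V z - Q z))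
      (U₁ z ^ 2 + V₁ z ^ 2 + (m * U z + n * V z) ^ 2 + -s * (U z ^ 2 + V z ^ 2 + W z ^ 2)) z := by
    intro z
    exact ((((h.dU z).fun_mul (h.dU₁ z)).fun_add ((h.dV z).fun_mul (h.dV₁ z))).fun_add
      ((h.dW z).fun_mul ((((h.dU z).const_mul (m : ℝ)).fun_add
        ((h.dV z).const_mul (n : ℝ))).fun_sub (h.dQ z)))).congr_deriv (by ring)
  set E := fun z => U z * U₁ z + V z * V₁ z + W z * (m * U z + n * V z - Q z) with hEd
  have hns : 0 ≤ -s := by linarith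
  have hmono : Monotone E := monotone_of_deriv_nonneg (fun z => (hE z).differentiableAt)
    fun z => by rw [(hE z).deriv]; positivity
  have hE1 : E (-1) = 0 := by simp [hEd, h.bU.1, h.bV.1, h.bW.1]
  have hE2 : E 1 = 0 := by simp [hEd, h.bU.2, h.bV.2, h.bW.2]
  have hE0 : ∀ z ∈ Icc (-1 : ℝ) 1, E z = 0 := fun z hz =>
    le_antisymm (hE2 ▸ hmono hz.2) (hE1 ▸ hmono hz.1)
  have hd0 : ∀ z ∈ Ioo (-1 : ℝ) 1, U₁ z = 0 ∧ V₁ z = 0 ∧ m * U z + n * V z = 0 := by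
    intro z hz
    have h1 : HasDerivAt E 0 z := by
      refine (hasDerivAt_const z (0 : ℝ)).congr_of_eventuallyEq ?_
      filter_upwards [Ioo_mem_nhds hz.1 hz.2] with w hw
      exact hE0 w (Ioo_subset_Icc_self hw)
    have h2 := (hE z).unique h1
    have h3 : 0 ≤ -s * (U z ^ 2 + V z ^ 2 + W z ^ 2) := by positivity
    have h4 := sq_nonneg (U₁ z)
    have h5 := sq_nonneg (V₁ z)
    have h6 := sq_nonneg (m * U z + n * V z)
    refine ⟨?_, ?_, ?_⟩ <;> refine pow_eq_zero_iff two_ne_zero |>.1 ?_ <;> linarith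
  intro z hz
  exact ⟨eq_zero_on_Icc_of_deriv h.dU h.bU.1 (fun z hz => (hd0 z hz).1) z hz,
    eq_zero_on_Icc_of_deriv h.dV h.bV.1 (fun z hz => (hd0 z hz).2.1) z hz,
    eq_zero_on_Icc_of_deriv h.dW h.bW.1 (fun z hz => (hd0 z hz).2.2) z hz⟩

lemma eq_of_hasDerivAt_zero {f : ℝ → ℝ} (hf : ∀ z, HasDerivAt f 0 z) (x y : ℝ) : f x = f y :=
  is_const_of_deriv_eq_zero (fun z => (hf z).differentiableAt) (fun z => (hf z).deriv) x y

lemma hasDerivAt_cos_mul (σ z : ℝ) :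
    HasDerivAt (fun z => Real.cos (σ * z)) (-(σ * Real.sin (σ * z))) z :=
  (((hasDerivAt_id' z).const_mul σ).cos).congr_deriv (by ring)

lemma hasDerivAt_sin_mul (σ z : ℝ) :
    HasDerivAt (fun z => Real.sin (σ * z)) (σ * Real.cos (σ * z)) z :=
  (((hasDerivAt_id' z).const_mul σ).sin).congr_deriv (by ring)

lemma hasDerivAt_cosh_mul (σ z : ℝ) :
    HasDerivAt (fun z => Real.cosh (σ * z)) (σ * Real.sinh (σ * z)) z :=
  (((hasDerivAt_id' z).const_mul σ).cosh).congr_deriv (by ring)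

lemma hasDerivAt_sinh_mul (σ z : ℝ) :
    HasDerivAt (fun z => Real.sinh (σ * z)) (σ * Real.cosh (σ * z)) z :=
  (((hasDerivAt_id' z).const_mul σ).sinh).congr_deriv (by ring)

/-- Rotating the phase-plane vector of `f` and `g` back by the angle `σ z` gives two constants of
motion. In `hyperbolic_ode` a hyperbolic rotation plays this part. -/
lemma trig_ode {σ : ℝ} (hσ : 0 < σ) {f g : ℝ → ℝ} (hf : ∀ z, HasDerivAt f (g z) z)
    (hg : ∀ z, HasDerivAt g (-σ ^ 2 * f z) z) (z : ℝ) :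
    f z = f 0 * Real.cos (σ * z) + g 0 / σ * Real.sin (σ * z) ∧
      g z = - σ * f 0 * Real.sin (σ * z) + g 0 * Real.cos (σ * z) := by
  have h1 : ∀ z, HasDerivAt
      (fun z => f z * Real.cos (σ * z) - g z * Real.sin (σ * z) / σ) 0 z := fun z => by
    exact (((hf z).fun_mul (hasDerivAt_cos_mul σ z)).fun_sub
      (((hg z).fun_mul (hasDerivAt_sin_mul σ z)).div_const σ)).congr_deriv (by field_simp; ring)
  have h2 : ∀ z, HasDerivAt
      (fun z => g z * Real.cos (σ * z) + σ * (f z * Real.sin (σ * z))) 0 z := fun z => by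
    exact (((hg z).fun_mul (hasDerivAt_cos_mul σ z)).fun_add
      (((hf z).fun_mul (hasDerivAt_sin_mul σ z)).const_mul σ)).congr_deriv (by ring)
  have e1 := eq_of_hasDerivAt_zero h1 z 0
  have e2 := eq_of_hasDerivAt_zero h2 z 0
  simp at e1 e2
  have h3 := Real.sin_sq_add_cos_sq (σ * z)
  rw [← e1, ← e2]
  constructor
  · field_simp
    linear_combination (-(σ * f z)) * h3
  · field_simp
    linear_combination (-(g z)) * h3

lemma hyperbolic_ode {μ : ℝ} (hμ : 0 < μ) {f g : ℝ → ℝ} (hf : ∀ z, HasDerivAt f (g z) z)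
    (hg : ∀ z, HasDerivAt g (μ ^ 2 * f z) z) (z : ℝ) :
    f z = f 0 * Real.cosh (μ * z) + g 0 / μ * Real.sinh (μ * z) ∧
      g z = μ * f 0 * Real.sinh (μ * z) + g 0 * Real.cosh (μ * z) := by
  have h1 : ∀ z, HasDerivAt
      (fun z => f z * Real.cosh (μ * z) - g z * Real.sinh (μ * z) / μ) 0 z := fun z => by
    exact (((hf z).fun_mul (hasDerivAt_cosh_mul μ z)).fun_sub
      (((hg z).fun_mul (hasDerivAt_sinh_mul μ z)).div_const μ)).congr_deriv (by field_simp; ring)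
  have h2 : ∀ z, HasDerivAt
      (fun z => g z * Real.cosh (μ * z) - μ * (f z * Real.sinh (μ * z))) 0 z := fun z => by
    exact (((hg z).fun_mul (hasDerivAt_cosh_mul μ z)).fun_sub
      (((hf z).fun_mul (hasDerivAt_sinh_mul μ z)).const_mul μ)).congr_deriv (by ring)
  have e1 := eq_of_hasDerivAt_zero h1 z 0
  have e2 := eq_of_hasDerivAt_zero h2 z 0
  simp at e1 e2
  have h3 := Real.cosh_sq (μ * z)
  rw [← e1, ← e2]
  constructor
  · field_simp
    linear_combination (-(μ * f z)) * h3
  · field_simp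
    linear_combination (-(g z)) * h3

/-- The `p`-th Dirichlet eigenfunction of `-d²/dz²` on `(-1, 1)`. -/
noncomputable def sinProfile (p : ℕ) (z : ℝ) : ℝ := Real.sin (Real.pi / 2 * p * (z + 1))

/-- The amplitude `α = 0` stands for the trivial solution; `p` then carries no information, which is
why the conditions on `p` are tied to `α ≠ 0`. -/
lemma dirichlet_ode {s : ℝ} {T T₁ : ℝ → ℝ} (hT : ∀ z, HasDerivAt T (T₁ z) z)
    (hT₁ : ∀ z, HasDerivAt T₁ (-s * T z) z) (b0 : T (-1) = 0) (b1 : T 1 = 0) :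
    ∃ (α : ℝ) (p : ℕ), (α ≠ 0 → 1 ≤ p ∧ Real.pi ^ 2 / 4 * (p : ℝ) ^ 2 = s) ∧
      ∀ z ∈ Icc (-1 : ℝ) 1, T z = α * sinProfile p z := by
  rcases le_or_gt s 0 with hs | hs
  · refine ⟨0, 0, by simp, fun z hz => ?_⟩
    -- The scalar problem is the system of the mode `(0, 0)` with all other unknowns zero, so the
    -- energy argument covers `s ≤ 0`.
    have hm : ModeSol 0 0 s T T₁ (fun _ => 0) (fun _ => 0) (fun _ => 0) (fun _ => 0) :=
      ⟨hT, by simpa using hT₁, fun z => hasDerivAt_const z 0, by simpa using fun z => hasDerivAt_const z 0,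
        by simpa using fun z => hasDerivAt_const z 0, by simpa using fun z => hasDerivAt_const z 0,
        ⟨b0, b1⟩, by simp, by simp⟩
    simp [(hm.eq_zero hs z hz).1]
  · have hσ : 0 < Real.sqrt s := Real.sqrt_pos.2 hs
    set σ := Real.sqrt s with hσd
    have hσ2 : σ ^ 2 = s := Real.sq_sqrt hs.le
    -- Moving the left wall to the origin removes the cosine; the right wall then gives `sin (2σ) =
    -- 0`.
    have h1 := trig_ode hσ (f := fun z => T (z - 1)) (g := fun z => T₁ (z - 1))
      (fun z => (hT (z - 1)).comp_sub_const z 1)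
      (fun z => by rw [hσ2]; exact (hT₁ (z - 1)).comp_sub_const z 1)
    simp only [zero_sub, b0, zero_mul, zero_add] at h1
    have hTz : ∀ z, T z = T₁ (-1) / σ * Real.sin (σ * (z + 1)) := fun z => by
      have := (h1 (z + 1)).1
      rwa [add_sub_cancel_right] at this
    by_cases hα : T₁ (-1) / σ = 0
    · exact ⟨0, 0, by simp, fun z _ => by rw [hTz, hα]; simp⟩
    · have h2 : Real.sin (σ * (1 + 1)) = 0 := by
        have := hTz 1
        rw [b1] at this
        exact (mul_eq_zero.1 this.symm).resolve_left hα
      obtain ⟨k, hk⟩ := Real.sin_eq_zero_iff.1 h2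
      have hkpos : 0 < k := by
        have h3 : 0 < (k : ℝ) * Real.pi := by rw [hk]; positivity
        have := pos_of_mul_pos_left h3 Real.pi_pos.le
        exact_mod_cast this
      obtain ⟨p, rfl⟩ := Int.eq_ofNat_of_zero_le hkpos.le
      have hσp : σ = Real.pi / 2 * p := by push_cast at hk; linarith
      refine ⟨T₁ (-1) / σ, p, fun _ => ⟨by omega, ?_⟩, fun z _ => ?_⟩
      · rw [← hσ2, hσp]; ring
      · rw [hTz, sinProfile, ← hσp]

/-- The oscillating part of the vertical velocity. -/
noncomputable def oscPart (μ : ℝ) (p : ℕ) (z : ℝ) : ℝ :=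
  if Even p then Real.cos (root μ p * z) else Real.sin (root μ p * z)

/-- The derivative of `oscPart`. -/
noncomputable def oscPart' (μ : ℝ) (p : ℕ) (z : ℝ) : ℝ :=
  if Even p then -(root μ p * Real.sin (root μ p * z)) else root μ p * Real.cos (root μ p * z)

/-- The hyperbolic part of the vertical velocity. -/
noncomputable def hypPart (μ : ℝ) (p : ℕ) (z : ℝ) : ℝ :=
  if Even p then -(Real.cos (root μ p) / Real.cosh μ) * Real.cosh (μ * z)
    else -(Real.sin (root μ p) / Real.sinh μ) * Real.sinh (μ * z)

/-- The derivative of `hypPart`. -/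
noncomputable def hypPart' (μ : ℝ) (p : ℕ) (z : ℝ) : ℝ :=
  if Even p then -(Real.cos (root μ p) / Real.cosh μ) * (μ * Real.sinh (μ * z))
    else -(Real.sin (root μ p) / Real.sinh μ) * (μ * Real.cosh (μ * z))

lemma hasDerivAt_oscPart (μ : ℝ) (p : ℕ) (z : ℝ) : HasDerivAt (oscPart μ p) (oscPart' μ p z) z := by
  unfold oscPart oscPart'
  split_ifs
  · exact hasDerivAt_cos_mul _ _
  · exact hasDerivAt_sin_mul _ _

lemma hasDerivAt_oscPart' (μ : ℝ) (p : ℕ) (z : ℝ) :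
    HasDerivAt (oscPart' μ p) (-root μ p ^ 2 * oscPart μ p z) z := by
  unfold oscPart oscPart'
  split_ifs
  · exact (((hasDerivAt_sin_mul _ z).const_mul _).fun_neg).congr_deriv (by ring)
  · exact ((hasDerivAt_cos_mul _ z).const_mul _).congr_deriv (by ring)

lemma hasDerivAt_hypPart (μ : ℝ) (p : ℕ) (z : ℝ) : HasDerivAt (hypPart μ p) (hypPart' μ p z) z := by
  unfold hypPart hypPart'
  split_ifs
  · exact (hasDerivAt_cosh_mul _ z).const_mul _
  · exact (hasDerivAt_sinh_mul _ z).const_mul _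

lemma hasDerivAt_hypPart' (μ : ℝ) (p : ℕ) (z : ℝ) :
    HasDerivAt (hypPart' μ p) (μ ^ 2 * hypPart μ p z) z := by
  unfold hypPart hypPart'
  split_ifs
  · exact (((hasDerivAt_sinh_mul _ z).const_mul _).const_mul _).congr_deriv (by ring)
  · exact (((hasDerivAt_cosh_mul _ z).const_mul _).const_mul _).congr_deriv (by ring)

lemma contDiff_profile_parts (μ : ℝ) (p : ℕ) : ContDiff ℝ ∞ (oscPart μ p) ∧
    ContDiff ℝ ∞ (oscPart' μ p) ∧ ContDiff ℝ ∞ (hypPart μ p) ∧ ContDiff ℝ ∞ (hypPart' μ p) := by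
  unfold oscPart oscPart' hypPart hypPart'
  split_ifs <;> refine ⟨?_, ?_, ?_, ?_⟩ <;> fun_prop

/-- The coefficient in `hypPart` is chosen for the first identity; the second is then the
characteristic equation `charFn_root`. -/
lemma profile_boundary {μ : ℝ} (hμ : 0 < μ) (p : ℕ) {z : ℝ} (hz : z = 1 ∨ z = -1) :
    oscPart μ p z + hypPart μ p z = 0 ∧ oscPart' μ p z + hypPart' μ p z = 0 := by
  have hs : 0 < Real.sinh μ := Real.sinh_pos_iff.2 hμ
  have hc : 0 < Real.cosh μ := Real.cosh_pos μ
  have h := charFn_root hμ p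
  unfold charFn charEven charOdd at h
  unfold oscPart oscPart' hypPart hypPart'
  split_ifs at h ⊢ <;> rcases hz with rfl | rfl <;> simp <;> field_simp <;>
    refine ⟨by ring, ?_⟩ <;> linarith

/-- Here `R = Q'` satisfies `R'' = μ²R`, and since `lam = s + μ²`, the difference `W - R/lam`
satisfies the oscillator equation with frequency `√s`. Thus `W` has four free constants, which face
four wall conditions. The clause on `Q 0` and `R 0` says that without pressure there is no such
motion. -/
lemma poloidal_ode {μ s lam : ℝ} (hμ : 0 < μ) (hs : 0 < s) (hlam : s + μ ^ 2 = lam)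
    {W W₁ Q R : ℝ → ℝ} (dW : ∀ z, HasDerivAt W (W₁ z) z)
    (dW₁ : ∀ z, HasDerivAt W₁ (R z - s * W z) z) (dQ : ∀ z, HasDerivAt Q (R z) z)
    (dR : ∀ z, HasDerivAt R (μ ^ 2 * Q z) z) (bW : W (-1) = 0 ∧ W 1 = 0)
    (bW₁ : W₁ (-1) = 0 ∧ W₁ 1 = 0) :
    ∃ (β : ℝ) (p : ℕ), (β ≠ 0 → root μ p ^ 2 = s) ∧ (Q 0 = 0 → R 0 = 0 → β = 0) ∧
      ∀ z, W z = β * (oscPart μ p z + hypPart μ p z) ∧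
        W₁ z = β * (oscPart' μ p z + hypPart' μ p z) := by
  have hlam0 : 0 < lam := by rw [← hlam]; positivity
  have hσ : 0 < Real.sqrt s := Real.sqrt_pos.2 hs
  set σ := Real.sqrt s with hσd
  have hσ2 : σ ^ 2 = s := Real.sq_sqrt hs.le
  have hsh : 0 < Real.sinh μ := Real.sinh_pos_iff.2 hμ
  have hch : 0 < Real.cosh μ := Real.cosh_pos μ
  have hR := hyperbolic_ode hμ (f := R) (g := fun z => μ ^ 2 * Q z) dR
    (fun z => (dQ z).const_mul _)
  have hw := trig_ode hσ (f := fun z => W z - R z / lam) (g := fun z => W₁ z - μ ^ 2 * Q z / lam)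
    (fun z => (dW z).fun_sub ((dR z).div_const lam))
    (fun z => ((dW₁ z).fun_sub (((dQ z).const_mul (μ ^ 2)).div_const lam)).congr_deriv (by
      rw [hσ2, ← hlam]; field_simp; ring))
  obtain ⟨a, ha⟩ : ∃ a, a = W 0 - R 0 / lam := ⟨_, rfl⟩
  obtain ⟨b, hb⟩ : ∃ b, b = (W₁ 0 - μ ^ 2 * Q 0 / lam) / σ := ⟨_, rfl⟩
  obtain ⟨c, hc⟩ : ∃ c, c = R 0 / lam := ⟨_, rfl⟩
  obtain ⟨d, hd⟩ : ∃ d, d = μ * Q 0 / lam := ⟨_, rfl⟩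
  have hWz : ∀ z, W z = a * Real.cos (σ * z) + b * Real.sin (σ * z)
      + c * Real.cosh (μ * z) + d * Real.sinh (μ * z) := fun z => by
    have h1 := (hw z).1
    have h2 := (hR z).1
    rw [← ha, ← hb] at h1
    rw [eq_add_of_sub_eq h1, h2, hc, hd]
    field_simp
    ring
  have hW₁z : ∀ z, W₁ z = - a * σ * Real.sin (σ * z) + b * σ * Real.cos (σ * z)
      + c * μ * Real.sinh (μ * z) + d * μ * Real.cosh (μ * z) := fun z => by
    have h1 := (hw z).2
    have h2 := (hR z).2
    have hb' : W₁ 0 - μ ^ 2 * Q 0 / lam = b * σ := by rw [hb]; field_simp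
    rw [← ha, hb'] at h1
    rw [eq_add_of_sub_eq h1, h2, hc, hd]
    field_simp
    ring
  have e1 := hWz 1
  have e2 := hWz (-1)
  have e3 := hW₁z 1
  have e4 := hW₁z (-1)
  simp only [bW.1, bW.2, bW₁.1, bW₁.2, mul_one, mul_neg, Real.cos_neg, Real.sin_neg, Real.cosh_neg,
    Real.sinh_neg] at e1 e2 e3 e4
  -- Sums and differences of the conditions at `1` and `-1` separate the even constants `a, c` from
  -- the odd ones `b, d`.
  have f1 : a * Real.cos σ + c * Real.cosh μ = 0 := by linarith
  have f2 : b * Real.sin σ + d * Real.sinh μ = 0 := by linarith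
  have f3 : - a * σ * Real.sin σ + c * μ * Real.sinh μ = 0 := by linarith
  have f4 : b * σ * Real.cos σ + d * μ * Real.cosh μ = 0 := by linarith
  have gE : a * charEven μ σ = 0 := by
    unfold charEven
    linear_combination (μ * Real.sinh μ) * f1 - Real.cosh μ * f3
  have gO : b * charOdd μ σ = 0 := by
    unfold charOdd
    linear_combination Real.sinh μ * f4 - μ * Real.cosh μ * f2
  have hc' : c = -(a * Real.cos σ) / Real.cosh μ := by field_simp; linarith
  have hd' : d = -(b * Real.sin σ) / Real.sinh μ := by field_simp; linarith
  by_cases ha0 : a = 0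
  · have hc0 : c = 0 := by rw [hc', ha0]; simp
    by_cases hb0 : b = 0
    · have hd0 : d = 0 := by rw [hd', hb0]; simp
      refine ⟨0, 0, by simp, by simp, fun z => ?_⟩
      rw [hWz, hW₁z, ha0, hb0, hc0, hd0]; simp
    · obtain ⟨p, hp, hσp⟩ := eq_root_of_charOdd hμ hσ ((mul_eq_zero.1 gO).resolve_left hb0)
      refine ⟨b, p, fun _ => by rw [← hσp, hσ2], fun hQ0 hR0 => ?_, fun z => ?_⟩
      -- Without the hyperbolic part the wall conditions read `b sin σ = b cos σ = 0`.
      · have hd0 : d = 0 := by rw [hd, hQ0]; simp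
        rw [hd0] at f2 f4
        have h5 : b * Real.sin σ = 0 := by linarith
        have h6 : b * Real.cos σ = 0 := by
          have : σ * (b * Real.cos σ) = 0 := by linarith
          exact (mul_eq_zero.1 this).resolve_left hσ.ne'
        have : b = b * Real.sin σ * Real.sin σ + b * Real.cos σ * Real.cos σ := by
          linear_combination (-b) * Real.sin_sq_add_cos_sq σ
        rw [this, h5, h6]; simp
      · unfold oscPart oscPart' hypPart hypPart'
        simp only [if_neg hp, ← hσp]
        rw [hWz, hW₁z, ha0, hc0, hd']
        constructor <;> ring
  · obtain ⟨p, hp, hσp⟩ := eq_root_of_charEven hμ hσ ((mul_eq_zero.1 gE).resolve_left ha0)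
    -- The even and the odd part cannot both be present: `σ` would be a zero of both kinds, while
    -- the zeros are strictly increasing in an index whose parity tells the kind.
    have hb0 : b = 0 := by
      by_contra hb0
      obtain ⟨k, hk, hσk⟩ := eq_root_of_charOdd hμ hσ ((mul_eq_zero.1 gO).resolve_left hb0)
      have : p = k := (root_strictMono hμ).injective (hσp.symm.trans hσk)
      exact hk (this ▸ hp)
    have hd0 : d = 0 := by rw [hd', hb0]; simp
    refine ⟨a, p, fun _ => by rw [← hσp, hσ2], fun hQ0 hR0 => ?_, fun z => ?_⟩
    · have hc0 : c = 0 := by rw [hc, hR0]; simp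
      rw [hc0] at f1 f3
      have h5 : a * Real.cos σ = 0 := by linarith
      have h6 : a * Real.sin σ = 0 := by
        have : σ * (a * Real.sin σ) = 0 := by linarith
        exact (mul_eq_zero.1 this).resolve_left hσ.ne'
      have : a = a * Real.sin σ * Real.sin σ + a * Real.cos σ * Real.cos σ := by
        linear_combination (-a) * Real.sin_sq_add_cos_sq σ
      rw [this, h5, h6]; simp
    · unfold oscPart oscPart' hypPart hypPart'
      simp only [if_pos hp, ← hσp]
      rw [hWz, hW₁z, hb0, hd0, hc']
      constructor <;> ring

/-- The vertical profiles of the eigenfunctions with constant pressure. -/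
noncomputable def torProfile (m n p : ℕ) : Fin 3 → ℝ → ℝ :=
  -- The direction `(n, -m)` degenerates for `m = n = 0`. There the first two horizontal factors are
  -- the constants `d` and `b`, so one profile for both components still gives two independent
  -- fields.
  if m = 0 ∧ n = 0 then ![sinProfile p, sinProfile p, fun _ => 0]
  else ![fun z => n * sinProfile p z, fun z => -(m * sinProfile p z), fun _ => 0]

/-- The vertical profiles of the eigenfunctions with non-constant pressure. -/
noncomputable def polProfile (m n p : ℕ) : Fin 3 → ℝ → ℝ :=
  -- The conditions `nU = mV` and `mU + nV = W'` give `U = mW'/μ²` and `V = nW'/μ²`; all components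
  -- are multiplied by `μ²`.
  ![fun z => m * (oscPart' (mu m n) p z + hypPart' (mu m n) p z),
    fun z => n * (oscPart' (mu m n) p z + hypPart' (mu m n) p z),
    fun z => mu m n ^ 2 * (oscPart (mu m n) p z + hypPart (mu m n) p z)]

lemma mu_pos_iff (m n : ℕ) : 0 < mu m n ↔ ¬ (m = 0 ∧ n = 0) := by
  rw [mu, Real.sqrt_pos]
  constructor
  · rintro h ⟨rfl, rfl⟩; simp at h
  · intro h
    rcases Nat.eq_zero_or_pos m with rfl | hm
    · have : 0 < (n : ℝ) := by exact_mod_cast Nat.pos_of_ne_zero fun hn => h ⟨rfl, hn⟩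
      positivity
    · have : 0 < (m : ℝ) := by exact_mod_cast hm
      positivity

/-- `U` and `V` are recovered from `nU - mV`, which solves a Dirichlet problem, and from `mU + nV =
W'`. The inversion has determinant `μ²`, whence the division of the amplitudes by `μ²`. -/
lemma ModeSol.exists_profiles {m n : ℕ} {lam : ℝ} {U U₁ V V₁ W Q : ℝ → ℝ}
    (h : ModeSol m n (lam - mu m n ^ 2) U U₁ V V₁ W Q) (hμ : 0 < mu m n) :
    ∃ (α β : ℝ) (p k : ℕ), (α ≠ 0 → 1 ≤ p ∧ lamD m n p = lam) ∧
      (β ≠ 0 → LamD m n k = lam) ∧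
      ((∀ z ∈ Ioo (-1 : ℝ) 1, Q z = 0) → β = 0) ∧
      ∀ z ∈ Ioo (-1 : ℝ) 1,
        U z = α * torProfile m n p 0 z + β * polProfile m n k 0 z ∧
        V z = α * torProfile m n p 1 z + β * polProfile m n k 1 z ∧
        W z = α * torProfile m n p 2 z + β * polProfile m n k 2 z := by
  have hmn := (mu_pos_iff m n).1 hμ
  rcases le_or_gt (lam - mu m n ^ 2) 0 with hs | hs
  · refine ⟨0, 0, 0, 0, by simp, by simp, by simp, fun z hz => ?_⟩
    obtain ⟨h1, h2, h3⟩ := h.eq_zero hs z (Ioo_subset_Icc_self hz)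
    simp [h1, h2, h3]
  · obtain ⟨α, p, hα, hT⟩ := dirichlet_ode (s := lam - mu m n ^ 2)
      (T := fun z => n * U z - m * V z) (T₁ := fun z => n * U₁ z - m * V₁ z)
      (fun z => ((h.dU z).const_mul (n : ℝ)).fun_sub ((h.dV z).const_mul (m : ℝ)))
      (fun z => (((h.dU₁ z).const_mul (n : ℝ)).fun_sub
        ((h.dV₁ z).const_mul (m : ℝ))).congr_deriv (by ring))
      (by simp [h.bU.1, h.bV.1]) (by simp [h.bU.2, h.bV.2])
    have hμ2 := mu_sq m n
    obtain ⟨β, k, hβ, hβ0, hW⟩ := poloidal_ode (lam := lam) hμ hs (by ring) h.dW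
      (R := fun z => m * U₁ z + n * V₁ z + (lam - mu m n ^ 2) * W z) (Q := Q)
      (fun z => (((h.dU z).const_mul (m : ℝ)).fun_add
        ((h.dV z).const_mul (n : ℝ))).congr_deriv (by ring)) h.dQ
      (fun z => ((((h.dU₁ z).const_mul (m : ℝ)).fun_add
        ((h.dV₁ z).const_mul (n : ℝ))).fun_add ((h.dW z).const_mul _)).congr_deriv (by
          rw [hμ2]; ring))
      h.bW (by simp [h.bU, h.bV])
    have hμ0 : mu m n ^ 2 ≠ 0 := by positivity
    refine ⟨α / mu m n ^ 2, β / mu m n ^ 2, p, k, fun h0 => ?_, fun h0 => ?_, fun hQ => ?_,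
      fun z hz => ?_⟩
    · obtain ⟨h1, h2⟩ := hα (by rintro rfl; simp at h0)
      exact ⟨h1, by rw [lamD, h2]; ring⟩
    · have := hβ (by rintro rfl; simp at h0)
      rw [LamD, this]; ring
    · have h0 : (0 : ℝ) ∈ Ioo (-1 : ℝ) 1 := by norm_num
      rw [hβ0 (hQ 0 h0), zero_div]
      -- `Q` vanishes near `0`, so its derivative at `0` vanishes as well.
      refine (h.dQ 0).unique ((hasDerivAt_const 0 (0 : ℝ)).congr_of_eventuallyEq ?_)
      filter_upwards [Ioo_mem_nhds h0.1 h0.2] with w hw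
      exact hQ w hw
    · have hTz := hT z (Ioo_subset_Icc_self hz)
      obtain ⟨hWz, hW₁z⟩ := hW z
      simp only [torProfile, if_neg hmn, polProfile]
      simp only [Matrix.cons_val_zero, Matrix.cons_val_one, Matrix.cons_val]
      refine ⟨?_, ?_, ?_⟩
      · field_simp
        rw [hμ2]
        linear_combination n * hTz + m * hW₁z
      · field_simp
        rw [hμ2]
        linear_combination -m * hTz + n * hW₁z
      · rw [hWz]; field_simp; ring

/-- For `m = n = 0` the pressure leaves the horizontal equations and `W' = 0`, so `U` and `V` are
unrelated Dirichlet solutions, each with its own amplitude. -/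
lemma ModeSol.exists_profiles_zero {lam : ℝ} {U U₁ V V₁ W Q : ℝ → ℝ}
    (h : ModeSol 0 0 lam U U₁ V V₁ W Q) :
    (∃ (α : ℝ) (p : ℕ), (α ≠ 0 → 1 ≤ p ∧ lamD 0 0 p = lam) ∧
      ∀ z ∈ Ioo (-1 : ℝ) 1, U z = α * sinProfile p z) ∧
    (∃ (α : ℝ) (p : ℕ), (α ≠ 0 → 1 ≤ p ∧ lamD 0 0 p = lam) ∧
      ∀ z ∈ Ioo (-1 : ℝ) 1, V z = α * sinProfile p z) ∧
    ∀ z ∈ Ioo (-1 : ℝ) 1, W z = 0 := by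
  refine ⟨?_, ?_, fun z hz => ?_⟩
  · obtain ⟨α, p, h1, h2⟩ := dirichlet_ode h.dU (by simpa using h.dU₁) h.bU.1 h.bU.2
    exact ⟨α, p, fun h0 => ⟨(h1 h0).1, by simp [lamD, mu, (h1 h0).2]⟩,
      fun z hz => h2 z (Ioo_subset_Icc_self hz)⟩
  · obtain ⟨α, p, h1, h2⟩ := dirichlet_ode h.dV (by simpa using h.dV₁) h.bV.1 h.bV.2
    exact ⟨α, p, fun h0 => ⟨(h1 h0).1, by simp [lamD, mu, (h1 h0).2]⟩,
      fun z hz => h2 z (Ioo_subset_Icc_self hz)⟩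
  · exact eq_zero_on_Icc_of_deriv h.dW h.bW.1 (fun z _ => by simp) z (Ioo_subset_Icc_self hz)

/-! ### Separated test functions and coefficients of weak derivatives. -/

/-- The sign in the derivative of `tr b m`. -/
noncomputable def trSign (b : Bool) : ℝ := if b then 1 else -1

lemma hasDerivAt_tr (b : Bool) (m : ℕ) (x : ℝ) :
    HasDerivAt (tr b m) (trSign b * m * tr (!b) m x) x := by
  cases b
  · refine (hasDerivAt_cos_mul m x).congr_deriv ?_ |>.congr_of_eventuallyEq ?_
    · simp [tr, trSign]
    · exact Eventually.of_forall fun x => by simp [tr]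
  · refine (hasDerivAt_sin_mul m x).congr_deriv ?_ |>.congr_of_eventuallyEq ?_
    · simp [tr, trSign]
    · exact Eventually.of_forall fun x => by simp [tr]

lemma trSign_mul_not (b : Bool) : trSign b * trSign (!b) = -1 := by
  cases b <;> simp [trSign]

lemma pd_zero_eq {f : Pt → ℝ} {x y z d : ℝ} (hf : DifferentiableAt ℝ f (x, y, z))
    (h : HasDerivAt (fun t => f (t, y, z)) d x) : pd 0 f (x, y, z) = d := by
  have h1 : HasDerivAt (fun t : ℝ => ((t, y, z) : Pt)) (1, 0, 0) x :=
    (hasDerivAt_id x).prodMk (hasDerivAt_const x (y, z))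
  exact (hf.hasFDerivAt.comp_hasDerivAt x h1).unique h

lemma pd_one_eq {f : Pt → ℝ} {x y z d : ℝ} (hf : DifferentiableAt ℝ f (x, y, z))
    (h : HasDerivAt (fun t => f (x, t, z)) d y) : pd 1 f (x, y, z) = d := by
  have h1 : HasDerivAt (fun t : ℝ => ((x, t, z) : Pt)) (0, 1, 0) y :=
    (hasDerivAt_const y x).prodMk ((hasDerivAt_id y).prodMk (hasDerivAt_const y z))
  exact (hf.hasFDerivAt.comp_hasDerivAt y h1).unique h

lemma pd_two_eq {f : Pt → ℝ} {x y z d : ℝ} (hf : DifferentiableAt ℝ f (x, y, z))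
    (h : HasDerivAt (fun t => f (x, y, t)) d z) : pd 2 f (x, y, z) = d := by
  have h1 : HasDerivAt (fun t : ℝ => ((x, y, t) : Pt)) (0, 0, 1) z :=
    (hasDerivAt_const z x).prodMk ((hasDerivAt_const z y).prodMk (hasDerivAt_id z))
  exact (hf.hasFDerivAt.comp_hasDerivAt z h1).unique h

/-- The product `tr a m ⊗ tr b n` on the torus. -/
noncomputable def te (a : Bool) (m : ℕ) (b : Bool) (n : ℕ) (p : ℝ × ℝ) : ℝ :=
  tr a m p.1 * tr b n p.2

lemma continuous_te (a : Bool) (m : ℕ) (b : Bool) (n : ℕ) : Continuous (te a m b n) :=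
  ((contDiff_tr a m).continuous.comp continuous_fst).mul
    ((contDiff_tr b n).continuous.comp continuous_snd)

lemma abs_te_le (a : Bool) (m : ℕ) (b : Bool) (n : ℕ) (p : ℝ × ℝ) : |te a m b n p| ≤ 1 := by
  rw [te, abs_mul]
  exact mul_le_one₀ (abs_tr_le a m p.1) (abs_nonneg _) (abs_tr_le b n p.2)

/-- Separated scalar functions on the channel. -/
noncomputable def ten (a : Bool) (m : ℕ) (b : Bool) (n : ℕ) (χ : ℝ → ℝ) (X : Pt) : ℝ :=
  te a m b n (X.1, X.2.1) * χ X.2.2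

lemma smoothPeriodic_ten (a : Bool) (m : ℕ) (b : Bool) (n : ℕ) {χ : ℝ → ℝ}
    (hχ : ContDiff ℝ ∞ χ) : SmoothPeriodic (ten a m b n χ) := by
  refine ⟨?_, fun x y z => ?_⟩
  · have h1 := contDiff_tr a m
    have h2 := contDiff_tr b n
    unfold ten te
    fun_prop
  · simp [ten, te, tr_add_two_pi]

lemma isTest_ten (a : Bool) (m : ℕ) (b : Bool) (n : ℕ) {χ : ℝ → ℝ} (hχ : IsTestZ χ) :
    IsTest (ten a m b n χ) := by
  refine ⟨smoothPeriodic_ten a m b n hχ.1, ?_⟩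
  obtain ⟨r, hr, h0⟩ := hχ.2
  exact ⟨r, hr, fun X hX => by simp [ten, h0 _ hX]⟩

lemma pd_ten (a : Bool) (m : ℕ) (b : Bool) (n : ℕ) {χ : ℝ → ℝ} (hχ : ContDiff ℝ ∞ χ) (X : Pt) :
    pd 0 (ten a m b n χ) X = trSign a * m * ten (!a) m b n χ X ∧
    pd 1 (ten a m b n χ) X = trSign b * n * ten a m (!b) n χ X ∧
    pd 2 (ten a m b n χ) X = ten a m b n (deriv χ) X := by
  have hd : DifferentiableAt ℝ (ten a m b n χ) X :=
    ((smoothPeriodic_ten a m b n hχ).1.differentiable (by simp)) X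
  obtain ⟨x, y, z⟩ := X
  refine ⟨pd_zero_eq hd ?_, pd_one_eq hd ?_, pd_two_eq hd ?_⟩
  · exact (((hasDerivAt_tr a m x).mul_const (tr b n y)).mul_const (χ z)).congr_deriv (by
      simp only [ten, te]; ring)
  · exact (((hasDerivAt_tr b n y).const_mul (tr a m x)).mul_const (χ z)).congr_deriv (by
      simp only [ten, te]; ring)
  · exact (((hχ.differentiable (by simp)) z).hasDerivAt.const_mul (te a m b n (x, y)))

lemma memLp_integrable {f : Pt → ℝ} (hf : MemLp f 2 volΩ) : Integrable f volΩ :=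
  hf.integrable one_le_two

lemma integral_mul_ten {f : Pt → ℝ} (hf : Integrable f volΩ) (a : Bool) (m : ℕ) (b : Bool) (n : ℕ)
    {χ : ℝ → ℝ} (hχ : Continuous χ) :
    ∫ X, f X * ten a m b n χ X ∂volΩ = ∫ z, S f (te a m b n) z * χ z ∂zm :=
  integral_mul_eq_integral_S hf (continuous_te a m b n) (abs_te_le a m b n) hχ

lemma integrable_S_te {f : Pt → ℝ} (hf : Integrable f volΩ) (a : Bool) (m : ℕ) (b : Bool) (n : ℕ) :
    Integrable (S f (te a m b n)) zm :=
  integrable_S hf (continuous_te a m b n) (abs_te_le a m b n)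

lemma integrable_mul_of_continuous {f g : Pt → ℝ} (hf : Integrable f volΩ) (hg : Continuous g) :
    Integrable (fun X => f X * g X) volΩ := by
  have hK : IsCompact (Icc (0 : ℝ) (2 * Real.pi) ×ˢ (Icc (0 : ℝ) (2 * Real.pi) ×ˢ Icc (-1 : ℝ) 1)) :=
    isCompact_Icc.prod (isCompact_Icc.prod isCompact_Icc)
  obtain ⟨D, hD⟩ := hK.exists_bound_of_continuousOn hg.continuousOn
  refine hf.mul_bdd (c := D) hg.aestronglyMeasurable ?_
  have hms : MeasurableSet cell :=
    measurableSet_Ioc.prod (measurableSet_Ioc.prod measurableSet_Ioo)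
  unfold volΩ
  filter_upwards [ae_restrict_mem hms] with X hX
  exact hD X ⟨Ioc_subset_Icc_self hX.1, Ioc_subset_Icc_self hX.2.1, Ioo_subset_Icc_self hX.2.2⟩

lemma continuous_ten (a : Bool) (m : ℕ) (b : Bool) (n : ℕ) {χ : ℝ → ℝ} (hχ : Continuous χ) :
    Continuous (ten a m b n χ) := by
  have := continuous_te a m b n
  unfold ten
  fun_prop

section H1
variable {f : Pt → ℝ} {g : Fin 3 → Pt → ℝ}

lemma HasH1Grad.S_zero (h : HasH1Grad f g) (a : Bool) (m : ℕ) (b : Bool) (n : ℕ) {χ : ℝ → ℝ}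
    (hχ : IsTestZ χ) : ∫ z, S (g 0) (te a m b n) z * χ z ∂zm
      = - (trSign a * m * ∫ z, S f (te (!a) m b n) z * χ z ∂zm) := by
  have h1 := h.weak 0 _ (isTest_ten a m b n hχ)
  simp_rw [(pd_ten a m b n hχ.1 _).1, mul_left_comm (f _)] at h1
  rw [integral_const_mul, integral_mul_ten (memLp_integrable h.memLp) _ _ _ _ hχ.continuous,
    integral_mul_ten (memLp_integrable (h.memLp_grad 0)) _ _ _ _ hχ.continuous] at h1
  linarith

lemma HasH1Grad.S_one (h : HasH1Grad f g) (a : Bool) (m : ℕ) (b : Bool) (n : ℕ) {χ : ℝ → ℝ}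
    (hχ : IsTestZ χ) : ∫ z, S (g 1) (te a m b n) z * χ z ∂zm
      = - (trSign b * n * ∫ z, S f (te a m (!b) n) z * χ z ∂zm) := by
  have h1 := h.weak 1 _ (isTest_ten a m b n hχ)
  simp_rw [(pd_ten a m b n hχ.1 _).2.1, mul_left_comm (f _)] at h1
  rw [integral_const_mul, integral_mul_ten (memLp_integrable h.memLp) _ _ _ _ hχ.continuous,
    integral_mul_ten (memLp_integrable (h.memLp_grad 1)) _ _ _ _ hχ.continuous] at h1
  linarith

lemma HasH1Grad.S_two (h : HasH1Grad f g) (a : Bool) (m : ℕ) (b : Bool) (n : ℕ) {χ : ℝ → ℝ}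
    (hχ : IsTestZ χ) : ∫ z, S f (te a m b n) z * deriv χ z ∂zm
      = - ∫ z, S (g 2) (te a m b n) z * χ z ∂zm := by
  have h1 := h.weak 2 _ (isTest_ten a m b n hχ)
  simp_rw [(pd_ten a m b n hχ.1 _).2.2] at h1
  rwa [integral_mul_ten (memLp_integrable h.memLp) _ _ _ _ hχ.deriv.continuous,
    integral_mul_ten (memLp_integrable (h.memLp_grad 2)) _ _ _ _ hχ.continuous] at h1

/-- In contrast to `HasH1Grad.S_two`, `χ` need not vanish near the walls, so this identity carries
the boundary values of the coefficient. -/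
lemma HasH1Grad.S_trace (h : HasH1Grad f g) (ht : TraceZero f g) (a : Bool) (m : ℕ) (b : Bool)
    (n : ℕ) {χ : ℝ → ℝ} (hχ : ContDiff ℝ ∞ χ) :
    ∫ z, S f (te a m b n) z * deriv χ z ∂zm + ∫ z, S (g 2) (te a m b n) z * χ z ∂zm = 0 := by
  have hχ' : Continuous (deriv χ) := (contDiff_infty_iff_deriv.1 hχ).2.continuous
  have h1 := ht _ (smoothPeriodic_ten a m b n hχ)
  simp_rw [(pd_ten a m b n hχ _).2.2] at h1
  have hf := memLp_integrable h.memLp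
  have hg := memLp_integrable (h.memLp_grad 2)
  rwa [integral_add (integrable_mul_of_continuous hf (continuous_ten _ _ _ _ hχ'))
    (integrable_mul_of_continuous hg (continuous_ten _ _ _ _ hχ.continuous)),
    integral_mul_ten hf _ _ _ _ hχ', integral_mul_ten hg _ _ _ _ hχ.continuous] at h1

end H1

/-- The boundary values of a weakly differentiable profile with vanishing trace. -/
lemma boundary_eq_zero {f g Y Y' : ℝ → ℝ} (hY : ∀ z, HasDerivAt Y (Y' z) z) (hY' : Continuous Y')
    (hf : f =ᵐ[zm] Y) (hg : g =ᵐ[zm] Y')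
    (h : ∀ χ : ℝ → ℝ, ContDiff ℝ ∞ χ → ∫ z, f z * deriv χ z ∂zm + ∫ z, g z * χ z ∂zm = 0) :
    Y (-1) = 0 ∧ Y 1 = 0 := by
  have hYc : Continuous Y := continuous_iff_continuousAt.2 fun z => (hY z).continuousAt
  have key : ∀ χ : ℝ → ℝ, ContDiff ℝ ∞ χ → Y 1 * χ 1 - Y (-1) * χ (-1) = 0 := by
    intro χ hχ
    have hχ' : Continuous (deriv χ) := (contDiff_infty_iff_deriv.1 hχ).2.continuous
    have i1 : IntervalIntegrable (fun z => Y z * deriv χ z) volume (-1) 1 :=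
      (hYc.mul hχ').intervalIntegrable _ _
    have i2 : IntervalIntegrable (fun z => Y' z * χ z) volume (-1) 1 :=
      (hY'.mul hχ.continuous).intervalIntegrable _ _
    have h1 := h χ hχ
    rw [integral_congr_ae (g := fun z => Y z * deriv χ z)
        (by filter_upwards [hf] with z hz; rw [hz]),
      integral_congr_ae (f := fun z => g z * χ z) (g := fun z => Y' z * χ z)
        (by filter_upwards [hg] with z hz; rw [hz]),
      integral_zm, integral_zm, ← intervalIntegral.integral_add i1 i2] at h1
    rw [← h1]
    refine (intervalIntegral.integral_eq_sub_of_hasDerivAt (f := fun z => Y z * χ z)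
      (fun z _ => ?_) ?_).symm
    · exact ((hY z).fun_mul ((hχ.differentiable (by simp)) z).hasDerivAt).congr_deriv (by ring)
    · exact i1.add i2
  -- The functions `1` and `z` give the difference and the sum of the two boundary values.
  have h1 := key (fun _ => 1) contDiff_const
  have h2 := key (fun z => z) contDiff_id
  constructor <;> linarith

/-! ### From a weak eigenfunction to the equations of its modes. -/

/-- The parity in `x` of the horizontal basis functions. -/
def parX : Fin 3 → Fin 4 → Bool :=
  ![![false, true, true, false], ![true, false, false, true], ![true, false, false, true]]

/-- The parity in `y` of the horizontal basis functions. -/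
def parY : Fin 3 → Fin 4 → Bool :=
  ![![true, true, false, false], ![false, false, true, true], ![true, true, false, false]]

/-- The sign of the horizontal basis functions. -/
def hsgn : Fin 3 → Fin 4 → ℝ := ![![1, -1, -1, 1], ![1, 1, -1, -1], ![1, 1, 1, 1]]

lemma sepField_apply (m n : ℕ) (κ : Fin 4 → ℝ) (F : Fin 3 → ℝ → ℝ) (X : Pt) (j : Fin 3) :
    sepField m n κ F X j = ∑ i, κ i * hsgn j i * (F j X.2.2 *
      te (parX j i) m (parY j i) n (X.1, X.2.1)) := by
  fin_cases j <;>
  · simp [sepField, Fin.sum_univ_four, hsgn, te, parX, parY, tr, Pu, Pv, Pw]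
    ring

lemma hsgn_mul_self (j : Fin 3) (i : Fin 4) : hsgn j i * hsgn j i = 1 := by
  fin_cases j <;> fin_cases i <;> simp [hsgn]

/-- The combinatorial form of `∂ₓ 𝒫 = m 𝒫ᵘ` and `∂ᵧ 𝒫 = n 𝒫ᵛ`: each derivative flips one parity and
produces the recorded sign. -/
lemma basis_relations (i : Fin 4) : parX 0 i = !parX 2 i ∧ parY 0 i = parY 2 i ∧
    parX 1 i = parX 2 i ∧ parY 1 i = (!parY 2 i) ∧ hsgn 2 i = 1 ∧
    trSign (parX 2 i) = hsgn 0 i ∧ trSign (parY 2 i) = hsgn 1 i := by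
  fin_cases i <;> simp [parX, parY, hsgn, trSign]

lemma exists_par (j : Fin 3) (a b : Bool) : ∃ i, parX j i = a ∧ parY j i = b := by
  revert j a b; decide

lemma par_injective (j : Fin 3) (i i' : Fin 4) (h : parX j i = parX j i')
    (h' : parY j i = parY j i') : i = i' := by
  revert j i i'; decide

/-- The horizontal Fourier coefficient of the `j`-th component along the `i`-th basis field. -/
noncomputable def coef (u : Pt → Fin 3 → ℝ) (m n : ℕ) (i : Fin 4) (j : Fin 3) : ℝ → ℝ :=
  S (fun X => u X j) (te (parX j i) m (parY j i) n)

section Eigen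
variable {lam : ℝ} {u : Pt → Fin 3 → ℝ} {q : Pt → ℝ}

lemma integral_finThree_test {u v w : Pt → ℝ} {q : Pt → ℝ} (hu : Integrable u volΩ)
    (hv : Integrable v volΩ) (hw : Integrable w volΩ) (hq : Integrable q volΩ) {a b c d : Pt → ℝ}
    (ha : Continuous a) (hb : Continuous b) (hc : Continuous c) (hd : Continuous d) :
    ∫ X, (u X * a X + v X * b X + w X * c X - q X * d X) ∂volΩ
      = ∫ X, u X * a X ∂volΩ + ∫ X, v X * b X ∂volΩ + ∫ X, w X * c X ∂volΩ
        - ∫ X, q X * d X ∂volΩ := by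
  have h1 := integrable_mul_of_continuous hu ha
  have h2 := integrable_mul_of_continuous hv hb
  have h3 := integrable_mul_of_continuous hw hc
  have h4 := integrable_mul_of_continuous hq hd
  have h12 : Integrable (fun X => u X * a X + v X * b X) volΩ := h1.add h2
  have h123 : Integrable (fun X => u X * a X + v X * b X + w X * c X) volΩ := h12.add h3
  rw [integral_sub h123 h4, integral_add h12 h3, integral_add h1 h2]

lemma isTest_zero : IsTest (fun _ => (0 : ℝ)) :=
  ⟨⟨contDiff_const, fun _ _ _ => ⟨rfl, rfl⟩⟩, 0, one_pos, fun _ _ => rfl⟩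

lemma pd_zero_fun (i : Fin 3) (X : Pt) : pd i (fun _ => (0 : ℝ)) X = 0 := by
  simp [pd]

lemma IsStokesEigenpair.momentum_component {G : Fin 3 → Fin 3 → Pt → ℝ}
    (hmom : ∀ φ : Fin 3 → Pt → ℝ, (∀ i, IsTest (φ i)) →
    ∫ X, (∑ i, ∑ j, G i j X * pd j (φ i) X - q X * ∑ i, pd i (φ i) X) ∂volΩ
      = lam * ∫ X, ∑ i, u X i * φ i X ∂volΩ) (j : Fin 3) {ψ : Pt → ℝ} (hψ : IsTest ψ) :
    ∫ X, (G j 0 X * pd 0 ψ X + G j 1 X * pd 1 ψ X + G j 2 X * pd 2 ψ X - q X * pd j ψ X) ∂volΩ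
      = lam * ∫ X, u X j * ψ X ∂volΩ := by
  classical
  have h := hmom (fun i => if i = j then ψ else fun _ => 0) (fun i => by
    by_cases hi : i = j
    · simpa [hi] using hψ
    · simpa [hi] using isTest_zero)
  have e1 : ∀ (i k : Fin 3) X, pd k (if i = j then ψ else fun _ => 0) X
      = if i = j then pd k ψ X else 0 := fun i k X => by
    split_ifs
    · rfl
    · exact pd_zero_fun k X
  have e2 : ∀ (i : Fin 3) (X : Pt), (if i = j then ψ else fun _ => 0) X
      = if i = j then ψ X else 0 := fun i X => by split_ifs <;> rfl
  simp_rw [e1, e2] at h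
  simp only [mul_ite, mul_zero, Finset.sum_ite_eq', Finset.mem_univ, if_true] at h
  rw [← h]
  refine integral_congr_ae (Eventually.of_forall fun X => ?_)
  simp only
  rw [Finset.sum_eq_single j (fun b _ hb => by simp [hb]) (by simp)]
  simp [Fin.sum_univ_three]

/-- Two horizontal derivatives restore the parity and give the factors `-m²` and `-n²`, so the
horizontal Laplacian turns `lam` into `lam - μ²`. The pressure term stays unevaluated because its
form depends on `j`. -/
lemma IsStokesEigenpair.coef_momentum {G : Fin 3 → Fin 3 → Pt → ℝ} (hV : InVD u G)
    (hq : MemLp q 2 volΩ)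
    (hmom : ∀ φ : Fin 3 → Pt → ℝ, (∀ i, IsTest (φ i)) →
    ∫ X, (∑ i, ∑ j, G i j X * pd j (φ i) X - q X * ∑ i, pd i (φ i) X) ∂volΩ
      = lam * ∫ X, ∑ i, u X i * φ i X ∂volΩ) (j : Fin 3) (a : Bool) (m : ℕ) (b : Bool) (n : ℕ)
    {χ : ℝ → ℝ} (hχ : IsTestZ χ) :
    ∫ z, S (G j 2) (te a m b n) z * deriv χ z ∂zm
      = (lam - mu m n ^ 2) * ∫ z, S (fun X => u X j) (te a m b n) z * χ z ∂zm
        + ∫ X, q X * pd j (ten a m b n χ) X ∂volΩ := by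
  have h1 := hV.h1 j
  have hcd : ∀ k, Continuous (pd k (ten a m b n χ)) := fun k => by
    have := (isTest_ten a m b n hχ).1.1
    unfold pd
    exact (this.continuous_fderiv (by simp)).clm_apply continuous_const
  have hG := fun k => memLp_integrable (h1.memLp_grad k)
  have h := IsStokesEigenpair.momentum_component hmom j (isTest_ten a m b n hχ)
  rw [integral_finThree_test (hG 0) (hG 1) (hG 2) (memLp_integrable hq) (hcd 0) (hcd 1) (hcd 2)
    (hcd j)] at h
  simp_rw [(pd_ten a m b n hχ.1 _).1, (pd_ten a m b n hχ.1 _).2.1, (pd_ten a m b n hχ.1 _).2.2,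
    mul_left_comm (G _ _ _)] at h
  rw [integral_const_mul, integral_const_mul, integral_mul_ten (hG 0) _ _ _ _ hχ.continuous,
    integral_mul_ten (hG 1) _ _ _ _ hχ.continuous,
    integral_mul_ten (hG 2) _ _ _ _ hχ.deriv.continuous,
    integral_mul_ten (memLp_integrable h1.memLp) _ _ _ _ hχ.continuous,
    h1.S_zero (!a) m b n hχ, h1.S_one a m (!b) n hχ] at h
  simp only [Bool.not_not] at h
  rw [mu_sq]
  have ha := trSign_mul_not a
  have hb := trSign_mul_not b
  linear_combination h + (m ^ 2 * ∫ z, S (fun X => u X j) (te a m b n) z * χ z ∂zm) * ha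
    + (n ^ 2 * ∫ z, S (fun X => u X j) (te a m b n) z * χ z ∂zm) * hb

/-- The divergence condition is tested with the third horizontal factor. Moving the horizontal
derivatives onto it yields the first and second factors, hence the coefficients of `u` itself. -/
lemma InVD.coef_div {G : Fin 3 → Fin 3 → Pt → ℝ} (hV : InVD u G) (m n : ℕ) (i : Fin 4) :
    S (G 2 2) (te (parX 2 i) m (parY 2 i) n) =ᵐ[zm]
      fun z => m * (hsgn 0 i * coef u m n i 0 z) + n * (hsgn 1 i * coef u m n i 1 z) := by
  obtain ⟨r1, r2, r3, r4, r5, r6, r7⟩ := basis_relations i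
  have hG := fun k => memLp_integrable ((hV.h1 k).memLp_grad k)
  have i0 : Integrable (coef u m n i 0) zm := integrable_S_te (memLp_integrable (hV.h1 0).memLp) _ _ _ _
  have i1 : Integrable (coef u m n i 1) zm := integrable_S_te (memLp_integrable (hV.h1 1).memLp) _ _ _ _
  have i2 := integrable_S_te (hG 2) (parX 2 i) m (parY 2 i) n
  have key : (fun z => S (G 2 2) (te (parX 2 i) m (parY 2 i) n) z - (m * (hsgn 0 i * coef u m n i 0 z)
      + n * (hsgn 1 i * coef u m n i 1 z))) =ᵐ[zm] 0 := by
    refine ae_zm_eq_zero (i2.sub (((i0.const_mul _).const_mul _).add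
      ((i1.const_mul _).const_mul _))) fun χ hχ => ?_
    have e : ∀ z, (S (G 2 2) (te (parX 2 i) m (parY 2 i) n) z - (m * (hsgn 0 i * coef u m n i 0 z)
        + n * (hsgn 1 i * coef u m n i 1 z))) * χ z
        = S (G 2 2) (te (parX 2 i) m (parY 2 i) n) z * χ z
          - (m * hsgn 0 i * (coef u m n i 0 z * χ z) + n * hsgn 1 i * (coef u m n i 1 z * χ z)) :=
      fun z => by ring
    simp_rw [e]
    have j0 := (integrable_zm_mul i0 hχ.continuous).const_mul (m * hsgn 0 i)
    have j1 := (integrable_zm_mul i1 hχ.continuous).const_mul (n * hsgn 1 i)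
    have j2 : Integrable (fun z => m * hsgn 0 i * (coef u m n i 0 z * χ z)
        + n * hsgn 1 i * (coef u m n i 1 z * χ z)) zm := j0.add j1
    rw [integral_sub (integrable_zm_mul i2 hχ.continuous) j2, integral_add j0 j1,
      integral_const_mul, integral_const_mul]
    have hc := continuous_ten (parX 2 i) m (parY 2 i) n hχ.continuous
    have h := integral_finThree_test (hG 0) (hG 1) (hG 2) (hG 0) hc hc hc
      (continuous_const (y := (0 : ℝ)))
    rw [integral_eq_zero_of_ae (by
        filter_upwards [hV.div_free] with X hX
        rw [Fin.sum_univ_three] at hX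
        simp only [Pi.zero_apply]
        linear_combination ten (parX 2 i) m (parY 2 i) n χ X * hX),
      integral_mul_ten (hG 0) _ _ _ _ hχ.continuous, integral_mul_ten (hG 1) _ _ _ _ hχ.continuous,
      integral_mul_ten (hG 2) _ _ _ _ hχ.continuous, (hV.h1 0).S_zero _ _ _ _ hχ,
      (hV.h1 1).S_one _ _ _ _ hχ, r6, r7] at h
    simp only [mul_zero, integral_zero, sub_zero] at h
    unfold coef
    rw [r1, r2, r3, r4]
    linear_combination -h
  filter_upwards [key] with z hz
  simpa [sub_eq_zero] using hz

/-- The horizontal Fourier coefficients of an eigenfunction solve the mode equations. -/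
lemma IsStokesEigenpair.exists_modeSol (h : IsStokesEigenpair lam u q) (m n : ℕ) (i : Fin 4) :
    ∃ U U₁ V V₁ W Q, ModeSol m n (lam - mu m n ^ 2) U U₁ V V₁ W Q ∧
      (fun z => hsgn 0 i * coef u m n i 0 z) =ᵐ[zm] U ∧
      (fun z => hsgn 1 i * coef u m n i 1 z) =ᵐ[zm] V ∧
      coef u m n i 2 =ᵐ[zm] W ∧ S q (te (parX 2 i) m (parY 2 i) n) =ᵐ[zm] Q := by
  obtain ⟨G, hV, hmom⟩ := h.momentum
  obtain ⟨r1, r2, r3, r4, r5, r6, r7⟩ := basis_relations i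
  have hq := memLp_integrable h.memLp_q
  have hu := fun j => memLp_integrable (hV.h1 j).memLp
  have hG := fun j => memLp_integrable ((hV.h1 j).memLp_grad 2)
  set s := lam - mu m n ^ 2 with hs
  set E0 := te (parX 0 i) m (parY 0 i) n with hE0
  set E1 := te (parX 1 i) m (parY 1 i) n with hE1
  set E2 := te (parX 2 i) m (parY 2 i) n with hE2
  -- The signs are absorbed so that the resulting system is the same for all four `i`.
  set U := fun z => hsgn 0 i * coef u m n i 0 z with hUd
  set U₁ := fun z => hsgn 0 i * S (G 0 2) E0 z with hU₁d
  set V := fun z => hsgn 1 i * coef u m n i 1 z with hVd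
  set V₁ := fun z => hsgn 1 i * S (G 1 2) E1 z with hV₁d
  set W := coef u m n i 2 with hWd
  set Q := S q E2 with hQd
  have iU : Integrable U zm := (integrable_S_te (hu 0) _ _ _ _).const_mul _
  have iV : Integrable V zm := (integrable_S_te (hu 1) _ _ _ _).const_mul _
  have iW : Integrable W zm := integrable_S_te (hu 2) _ _ _ _
  have iU₁ : Integrable U₁ zm := (integrable_S_te (hG 0) _ _ _ _).const_mul _
  have iV₁ : Integrable V₁ zm := (integrable_S_te (hG 1) _ _ _ _).const_mul _
  have iQ : Integrable Q zm := integrable_S_te hq _ _ _ _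
  have hdiv := hV.coef_div m n i
  have lin2 : ∀ {f g : ℝ → ℝ} (a b : ℝ), Integrable f zm → Integrable g zm → ∀ {χ}, Continuous χ →
      ∫ z, (a * f z + b * g z) * χ z ∂zm = a * ∫ z, f z * χ z ∂zm + b * ∫ z, g z * χ z ∂zm := by
    intro f g a b hf hg χ hχ
    have e : ∀ z, (a * f z + b * g z) * χ z = a * (f z * χ z) + b * (g z * χ z) := fun z => by ring
    simp_rw [e]
    rw [integral_add ((integrable_zm_mul hf hχ).const_mul a) ((integrable_zm_mul hg hχ).const_mul b),
      integral_const_mul, integral_const_mul]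
  have sg : ∀ (f : ℝ → ℝ) (c : ℝ) (χ : ℝ → ℝ), ∫ z, (c * f z) * χ z ∂zm = c * ∫ z, f z * χ z ∂zm :=
    fun f c χ => by simp_rw [mul_assoc]; exact integral_const_mul _ _
  have w0 : ∀ χ, IsTestZ χ → ∫ z, U z * deriv χ z ∂zm = - ∫ z, U₁ z * χ z ∂zm := fun χ hχ => by
    rw [hUd, hU₁d, sg, sg]; unfold coef; rw [(hV.h1 0).S_two _ _ _ _ hχ]; ring
  have w2 : ∀ χ, IsTestZ χ → ∫ z, V z * deriv χ z ∂zm = - ∫ z, V₁ z * χ z ∂zm := fun χ hχ => by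
    rw [hVd, hV₁d, sg, sg]; unfold coef; rw [(hV.h1 1).S_two _ _ _ _ hχ]; ring
  have w1 : ∀ χ, IsTestZ χ → ∫ z, U₁ z * deriv χ z ∂zm
      = - ∫ z, (-s * U z + m * Q z) * χ z ∂zm := fun χ hχ => by
    have h1 := IsStokesEigenpair.coef_momentum hV h.memLp_q hmom 0 (parX 0 i) m (parY 0 i) n hχ
    simp_rw [(pd_ten _ _ _ _ hχ.1 _).1, mul_left_comm (q _)] at h1
    rw [integral_const_mul, integral_mul_ten hq _ _ _ _ hχ.continuous] at h1
    rw [lin2 _ _ iU iQ hχ.continuous, hU₁d, hUd, sg, sg, hQd]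
    unfold coef
    rw [h1, hE2]
    have h2 : trSign (parX 0 i) = - hsgn 0 i := by
      rw [r1, ← r6]; cases parX 2 i <;> simp [trSign]
    have h3 : (!parX 0 i) = parX 2 i := by rw [r1, Bool.not_not]
    rw [h2, h3, r2]
    linear_combination (-(m * ∫ z, S q (te (parX 2 i) m (parY 2 i) n) z * χ z ∂zm))
      * hsgn_mul_self 0 i
  have w3 : ∀ χ, IsTestZ χ → ∫ z, V₁ z * deriv χ z ∂zm
      = - ∫ z, (-s * V z + n * Q z) * χ z ∂zm := fun χ hχ => by
    have h1 := IsStokesEigenpair.coef_momentum hV h.memLp_q hmom 1 (parX 1 i) m (parY 1 i) n hχ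
    simp_rw [(pd_ten _ _ _ _ hχ.1 _).2.1, mul_left_comm (q _)] at h1
    rw [integral_const_mul, integral_mul_ten hq _ _ _ _ hχ.continuous] at h1
    rw [lin2 _ _ iV iQ hχ.continuous, hV₁d, hVd, sg, sg, hQd]
    unfold coef
    rw [h1, hE2]
    have h2 : trSign (parY 1 i) = - hsgn 1 i := by
      rw [r4, ← r7]; cases parY 2 i <;> simp [trSign]
    have h3 : (!parY 1 i) = parY 2 i := by rw [r4, Bool.not_not]
    rw [h2, h3, r3]
    linear_combination (-(n * ∫ z, S q (te (parX 2 i) m (parY 2 i) n) z * χ z ∂zm))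
      * hsgn_mul_self 1 i
  have hG22 : ∀ χ : ℝ → ℝ, ∫ z, S (G 2 2) E2 z * χ z ∂zm = ∫ z, (m * U z + n * V z) * χ z ∂zm :=
    fun χ => integral_congr_ae (by filter_upwards [hdiv] with z hz; rw [hz])
  have w4 : ∀ χ, IsTestZ χ → ∫ z, W z * deriv χ z ∂zm
      = - ∫ z, (m * U z + n * V z) * χ z ∂zm := fun χ hχ => by
    rw [← hG22]; exact (hV.h1 2).S_two _ _ _ _ hχ
  have w5 : ∀ χ, IsTestZ χ → ∫ z, Q z * deriv χ z ∂zm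
      = - ∫ z, (m * U₁ z + n * V₁ z + s * W z) * χ z ∂zm := fun χ hχ => by
    have h1 := IsStokesEigenpair.coef_momentum hV h.memLp_q hmom 2 (parX 2 i) m (parY 2 i) n hχ
    simp_rw [(pd_ten _ _ _ _ hχ.1 _).2.2] at h1
    -- The coefficient of `∂₃u₃` is replaced by `mU + nV`, whose weak derivative `mU₁ + nV₁` is
    -- already known.
    rw [integral_mul_ten hq _ _ _ _ hχ.deriv.continuous, hG22,
      lin2 _ _ iU iV hχ.deriv.continuous, w0 χ hχ, w2 χ hχ] at h1
    have e : ∀ z, (m * U₁ z + n * V₁ z + s * W z) * χ z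
        = (1 * (m * U₁ z + n * V₁ z) + s * W z) * χ z := fun z => by ring
    simp_rw [e]
    have iUV : Integrable (fun z => m * U₁ z + n * V₁ z) zm :=
      (iU₁.const_mul _).add (iV₁.const_mul _)
    rw [lin2 1 s iUV iW hχ.continuous,
      lin2 _ _ iU₁ iV₁ hχ.continuous]
    change _ = s * ∫ z, W z * χ z ∂zm + ∫ z, Q z * deriv χ z ∂zm at h1
    linarith
  -- The unknowns are ordered `U, U₁, V, V₁, W, Q`.
  obtain ⟨Y, hY, hae⟩ := weak_linear_system
    (![![0, 1, 0, 0, 0, 0], ![-s, 0, 0, 0, 0, m], ![0, 0, 0, 1, 0, 0], ![0, 0, -s, 0, 0, n],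
      ![m, 0, n, 0, 0, 0], ![0, m, 0, n, s, 0]] : Fin 6 → Fin 6 → ℝ) ![U, U₁, V, V₁, W, Q]
    (by
      intro k
      fin_cases k <;> assumption)
    (by
      intro k χ hχ
      fin_cases k
      · simpa [Fin.sum_univ_six] using w0 χ hχ
      · simpa [Fin.sum_univ_six] using w1 χ hχ
      · simpa [Fin.sum_univ_six] using w2 χ hχ
      · simpa [Fin.sum_univ_six] using w3 χ hχ
      · simpa [Fin.sum_univ_six] using w4 χ hχ
      · simpa [Fin.sum_univ_six] using w5 χ hχ)
  have dU : ∀ z, HasDerivAt (Y 0) (Y 1 z) z := fun z => by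
    simpa [Fin.sum_univ_six] using hY 0 z
  have dU₁ : ∀ z, HasDerivAt (Y 1) (-s * Y 0 z + m * Y 5 z) z := fun z => by
    simpa [Fin.sum_univ_six] using hY 1 z
  have dV : ∀ z, HasDerivAt (Y 2) (Y 3 z) z := fun z => by
    simpa [Fin.sum_univ_six] using hY 2 z
  have dV₁ : ∀ z, HasDerivAt (Y 3) (-s * Y 2 z + n * Y 5 z) z := fun z => by
    simpa [Fin.sum_univ_six] using hY 3 z
  have dW : ∀ z, HasDerivAt (Y 4) (m * Y 0 z + n * Y 2 z) z := fun z => by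
    simpa [Fin.sum_univ_six] using hY 4 z
  have dQ : ∀ z, HasDerivAt (Y 5) (m * Y 1 z + n * Y 3 z + s * Y 4 z) z := fun z => by
    simpa [Fin.sum_univ_six] using hY 5 z
  have aU : U =ᵐ[zm] Y 0 := hae 0
  have aU₁ : U₁ =ᵐ[zm] Y 1 := hae 1
  have aV : V =ᵐ[zm] Y 2 := hae 2
  have aV₁ : V₁ =ᵐ[zm] Y 3 := hae 3
  have aW : W =ᵐ[zm] Y 4 := hae 4
  have aQ : Q =ᵐ[zm] Y 5 := hae 5
  have cont : ∀ k, Continuous (Y k) := fun k =>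
    continuous_iff_continuousAt.2 fun z => (hY k z).continuousAt
  refine ⟨Y 0, Y 1, Y 2, Y 3, Y 4, Y 5, ⟨dU, dU₁, dV, dV₁, dW, dQ, ?_, ?_, ?_⟩, aU, aV, aW, aQ⟩
  · refine boundary_eq_zero dU (cont 1) aU aU₁ fun χ hχ => ?_
    rw [hUd, hU₁d, sg, sg, ← mul_add]
    unfold coef
    rw [(hV.h1 0).S_trace (hV.trace 0) _ _ _ _ hχ, mul_zero]
  · refine boundary_eq_zero dV (cont 3) aV aV₁ fun χ hχ => ?_
    rw [hVd, hV₁d, sg, sg, ← mul_add]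
    unfold coef
    rw [(hV.h1 1).S_trace (hV.trace 1) _ _ _ _ hχ, mul_zero]
  · refine boundary_eq_zero dW (((cont 0).const_mul _).add ((cont 2).const_mul _)) aW
      (hdiv.trans ?_) fun χ hχ => (hV.h1 2).S_trace (hV.trace 2) _ _ _ _ hχ
    filter_upwards [aU, aV] with z h1 h2
    rw [← h1, ← h2]

end Eigen

/-! ### Coefficients of an eigenfunction in terms of the profiles. -/

/-- The squared `L²(0, 2π)` norm of the nonzero ones among `tr b k`. -/
noncomputable def circN (k : ℕ) : ℝ := if k = 0 then 2 * Real.pi else Real.pi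

lemma circN_pos (k : ℕ) : 0 < circN k := by
  have := Real.pi_pos
  unfold circN
  split_ifs <;> positivity

lemma trN_eq (b : Bool) (k : ℕ) : trN b k = circN k ∨ (trN b k = 0 ∧ ∀ x, tr b k x = 0) := by
  unfold trN circN
  rcases eq_or_ne k 0 with rfl | hk
  · cases b
    · simp
    · right; simp [tr]
  · simp [hk]

/-- The squared norm of the horizontal basis functions. -/
noncomputable def hN (j : Fin 3) (i : Fin 4) (m n : ℕ) : ℝ := trN (parX j i) m * trN (parY j i) n

/-- Only a factor `sin 0` degenerates. The norm of a nonzero basis function does not depend on `i`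
or `j`, so one normalising constant serves all three components. -/
lemma hN_eq (j : Fin 3) (i : Fin 4) (m n : ℕ) : hN j i m n = circN m * circN n ∨
    (hN j i m n = 0 ∧ te (parX j i) m (parY j i) n = 0) := by
  rcases trN_eq (parX j i) m with h1 | ⟨h1, h1'⟩
  · rcases trN_eq (parY j i) n with h2 | ⟨h2, h2'⟩
    · left; rw [hN, h1, h2]
    · right; exact ⟨by rw [hN, h2, mul_zero], by ext; simp [te, h2']⟩
  · right; exact ⟨by rw [hN, h1, zero_mul], by ext; simp [te, h1']⟩

lemma S_zero_right (f : Pt → ℝ) : S f 0 = 0 := by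
  ext z; simp [S]

lemma eqOn_of_ae_zm {f g : ℝ → ℝ} (h : f =ᵐ[zm] g) (hf : Continuous f) (hg : Continuous g) :
    EqOn f g (Ioo (-1) 1) :=
  Measure.eqOn_open_of_ae_eq h isOpen_Ioo hf.continuousOn hg.continuousOn

/-- One of `m`, `n` is nonzero, and the corresponding horizontal derivative of a separated test
function is a nonzero multiple of the function paired with `q`. -/
lemma GradZero.S_eq_zero {q : Pt → ℝ} (hq : Integrable q volΩ) (h : GradZero q) {m n : ℕ}
    (hμ : 0 < mu m n) (a b : Bool) : S q (te a m b n) =ᵐ[zm] 0 := by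
  refine ae_zm_eq_zero (integrable_S_te hq _ _ _ _) fun χ hχ => ?_
  have h0 := h 0 _ (isTest_ten (!a) m b n hχ)
  have h1 := h 1 _ (isTest_ten a m (!b) n hχ)
  simp_rw [(pd_ten _ _ _ _ hχ.1 _).1, mul_left_comm (q _)] at h0
  simp_rw [(pd_ten _ _ _ _ hχ.1 _).2.1, mul_left_comm (q _)] at h1
  rw [integral_const_mul, integral_mul_ten hq _ _ _ _ hχ.continuous, Bool.not_not] at h0 h1
  have hs : ∀ c, trSign c ≠ 0 := fun c => by cases c <;> simp [trSign]
  rcases not_and_or.1 ((mu_pos_iff m n).1 hμ) with hm | hn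
  · exact (mul_eq_zero.1 h0).resolve_left (mul_ne_zero (hs _) (by exact_mod_cast hm))
  · exact (mul_eq_zero.1 h1).resolve_left (mul_ne_zero (hs _) (by exact_mod_cast hn))

lemma ae_zm_mem : ∀ᵐ z ∂zm, z ∈ Ioo (-1 : ℝ) 1 := ae_restrict_mem measurableSet_Ioo

lemma coef_eq_zero_of_hN {u : Pt → Fin 3 → ℝ} {m n : ℕ} {i : Fin 4} {j : Fin 3}
    (h : hN j i m n = 0) : coef u m n i j = 0 := by
  rcases hN_eq j i m n with h1 | ⟨_, h2⟩
  · exact absurd (h1.symm.trans h) (mul_pos (circN_pos m) (circN_pos n)).ne'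
  · rw [coef, h2, S_zero_right]

/-- The horizontal Fourier coefficients of an eigenfunction are combinations of the profiles. -/
lemma IsStokesEigenpair.exists_coef {lam : ℝ} {u : Pt → Fin 3 → ℝ} {q : Pt → ℝ}
    (h : IsStokesEigenpair lam u q) (m n : ℕ) (i : Fin 4) :
    ∃ (α β : ℝ) (p k : ℕ), (α ≠ 0 → 1 ≤ p ∧ lamD m n p = lam) ∧
      (β ≠ 0 → 0 < mu m n ∧ LamD m n k = lam) ∧ (GradZero q → β = 0) ∧
      ∀ j, coef u m n i j =ᵐ[zm] fun z =>
        hsgn j i * hN j i m n * (α * torProfile m n p j z + β * polProfile m n k j z) := by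
  obtain ⟨U, U₁, V, V₁, W, Q, hm, hU, hV, hW, hQ⟩ := h.exists_modeSol m n i
  have hcU : ∀ᵐ z ∂zm, coef u m n i 0 z = hsgn 0 i * U z := by
    filter_upwards [hU] with z hz
    rw [← hz, ← mul_assoc, hsgn_mul_self, one_mul]
  have hcV : ∀ᵐ z ∂zm, coef u m n i 1 z = hsgn 1 i * V z := by
    filter_upwards [hV] with z hz
    rw [← hz, ← mul_assoc, hsgn_mul_self, one_mul]
  have hcW : ∀ᵐ z ∂zm, coef u m n i 2 z = hsgn 2 i * W z := by
    filter_upwards [hW] with z hz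
    rw [hz, (basis_relations i).2.2.2.2.1, one_mul]
  set N := circN m * circN n with hNd
  have hN0 : N ≠ 0 := (mul_pos (circN_pos m) (circN_pos n)).ne'
  by_cases hμ : 0 < mu m n
  · obtain ⟨α, β, p, k, hα, hβ, hQ0, hz⟩ := hm.exists_profiles hμ
    have fin : ∀ (j : Fin 3) (Z : ℝ → ℝ), (∀ᵐ z ∂zm, coef u m n i j z = hsgn j i * Z z) →
        (∀ z ∈ Ioo (-1 : ℝ) 1, Z z = α * torProfile m n p j z + β * polProfile m n k j z) →
        coef u m n i j =ᵐ[zm] fun z => hsgn j i * hN j i m n *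
          (α / N * torProfile m n p j z + β / N * polProfile m n k j z) := by
      intro j Z hZ hZ'
      rcases hN_eq j i m n with h1 | ⟨h1, _⟩
      · filter_upwards [hZ, ae_zm_mem] with z hz1 hz2
        rw [hz1, hZ' z hz2, h1, ← hNd]
        field_simp
      · rw [coef_eq_zero_of_hN h1]
        filter_upwards with z
        simp [h1]
    refine ⟨α / N, β / N, p, k, fun h0 => hα (by rintro rfl; simp at h0),
      fun h0 => ⟨hμ, hβ (by rintro rfl; simp at h0)⟩, fun hg => ?_, fun j => ?_⟩
    · have h1 := hg.S_eq_zero (memLp_integrable h.memLp_q) hμ (parX 2 i) (parY 2 i)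
      have hQc : Continuous Q := continuous_iff_continuousAt.2 fun z => (hm.dQ z).continuousAt
      have h2 := eqOn_of_ae_zm (hQ.symm.trans h1) hQc continuous_const
      rw [hQ0 fun z hz => h2 hz, zero_div]
    · fin_cases j
      · exact fin 0 U hcU fun z hz' => (hz z hz').1
      · exact fin 1 V hcV fun z hz' => (hz z hz').2.1
      · exact fin 2 W hcW fun z hz' => (hz z hz').2.2
  · obtain ⟨rfl, rfl⟩ : m = 0 ∧ n = 0 := by
      by_contra hc; exact hμ ((mu_pos_iff m n).2 hc)
    have hm' : ModeSol 0 0 lam U U₁ V V₁ W Q := by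
      have : lam - mu 0 0 ^ 2 = lam := by simp [mu]
      rwa [this] at hm
    obtain ⟨⟨α₀, p₀, hα₀, hz₀⟩, ⟨α₁, p₁, hα₁, hz₁⟩, hz₂⟩ := hm'.exists_profiles_zero
    -- In the mode `(0, 0)` at most one of the first two basis functions with index `i` is nonzero,
    -- so a single pair `(α, p)` suffices although `U` and `V` may have different ones.
    have main : ∀ (α : ℝ) (p : ℕ), (α ≠ 0 → 1 ≤ p ∧ lamD 0 0 p = lam) →
        (hN 0 i 0 0 ≠ 0 → ∀ z ∈ Ioo (-1 : ℝ) 1, U z = α * sinProfile p z) →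
        (hN 1 i 0 0 ≠ 0 → ∀ z ∈ Ioo (-1 : ℝ) 1, V z = α * sinProfile p z) →
        ∃ (α β : ℝ) (p k : ℕ), (α ≠ 0 → 1 ≤ p ∧ lamD 0 0 p = lam) ∧
          (β ≠ 0 → 0 < mu 0 0 ∧ LamD 0 0 k = lam) ∧ (GradZero q → β = 0) ∧
          ∀ j, coef u 0 0 i j =ᵐ[zm] fun z =>
            hsgn j i * hN j i 0 0 * (α * torProfile 0 0 p j z + β * polProfile 0 0 k j z) := by
      intro α p hα hU' hV'
      have fin : ∀ (j : Fin 3) (Z : ℝ → ℝ), (∀ᵐ z ∂zm, coef u 0 0 i j z = hsgn j i * Z z) →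
          (hN j i 0 0 ≠ 0 → ∀ z ∈ Ioo (-1 : ℝ) 1, Z z = α * torProfile 0 0 p j z) →
          coef u 0 0 i j =ᵐ[zm] fun z => hsgn j i * hN j i 0 0 *
            (α / N * torProfile 0 0 p j z + 0 * polProfile 0 0 0 j z) := by
        intro j Z hZ hZ'
        rcases hN_eq j i 0 0 with h1 | ⟨h1, _⟩
        · filter_upwards [hZ, ae_zm_mem] with z hz1 hz2
          rw [hz1, hZ' (by rw [h1]; exact hN0) z hz2, h1, ← hNd]
          field_simp
          ring
        · rw [coef_eq_zero_of_hN h1]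
          filter_upwards with z
          simp [h1]
      refine ⟨α / N, 0, p, 0, fun h0 => hα (by rintro rfl; simp at h0), by simp, by simp,
        fun j => ?_⟩
      fin_cases j
      · exact fin 0 U hcU (by simpa [torProfile] using hU')
      · exact fin 1 V hcV (by simpa [torProfile] using hV')
      · refine fin 2 W hcW fun _ z hz => ?_
        rw [hz₂ z hz]
        simp [torProfile]
    by_cases h0 : hN 0 i 0 0 = 0
    · exact main α₁ p₁ hα₁ (fun h => absurd h0 h) fun _ => hz₁
    · refine main α₀ p₀ hα₀ (fun _ => hz₀) fun h1 => absurd ?_ h1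
      revert h0
      fin_cases i <;> simp [hN, parX, parY, trN]

/-! ### Orthogonality and the coefficients of separated fields. -/

lemma integral_te_mul_te (a a' : Bool) (m m' : ℕ) (b b' : Bool) (n n' : ℕ) :
    ∫ p, te a m b n p * te a' m' b' n' p ∂hm
      = if (a = a' ∧ m = m') ∧ (b = b' ∧ n = n') then trN a m * trN b n else 0 := by
  have e : ∀ p : ℝ × ℝ, te a m b n p * te a' m' b' n' p
      = (tr a m p.1 * tr a' m' p.1) * (tr b n p.2 * tr b' n' p.2) := fun p => by
    simp only [te]; ring
  simp_rw [e]
  rw [hm, integral_prod_mul (fun x => tr a m x * tr a' m' x) (fun y => tr b n y * tr b' n' y),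
    integral_tr_mul_tr, integral_tr_mul_tr]
  split_ifs <;> simp_all

lemma integrable_te_mul_te (a a' : Bool) (m m' : ℕ) (b b' : Bool) (n n' : ℕ) :
    Integrable (fun p => te a m b n p * te a' m' b' n' p) hm :=
  integrable_mul_bdd (((integrable_const (1 : ℝ)).mul_bdd (c := 1)
    (continuous_te a m b n).aestronglyMeasurable (Eventually.of_forall (abs_te_le a m b n))).congr
      (Eventually.of_forall fun _ => one_mul _))
    (continuous_te a' m' b' n').aestronglyMeasurable 1 (abs_te_le a' m' b' n')

lemma sepField_mul_te (m n : ℕ) (κ : Fin 4 → ℝ) (F : Fin 3 → ℝ → ℝ) (m' n' : ℕ) (i : Fin 4)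
    (j : Fin 3) (z : ℝ) (p : ℝ × ℝ) :
    sepField m n κ F (p.1, p.2, z) j * te (parX j i) m' (parY j i) n' p
      = ∑ i', κ i' * hsgn j i' * F j z *
        (te (parX j i') m (parY j i') n p * te (parX j i) m' (parY j i) n' p) := by
  rw [sepField_apply, Finset.sum_mul]
  exact Finset.sum_congr rfl fun i' _ => by ring

lemma integrable_sepField_mul_te (m n : ℕ) (κ : Fin 4 → ℝ) (F : Fin 3 → ℝ → ℝ) (m' n' : ℕ)
    (i : Fin 4) (j : Fin 3) (z : ℝ) :
    Integrable (fun p : ℝ × ℝ => sepField m n κ F (p.1, p.2, z) j *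
      te (parX j i) m' (parY j i) n' p) hm := by
  simp_rw [sepField_mul_te]
  exact integrable_finsetSum _ fun i' _ => (integrable_te_mul_te _ _ _ _ _ _ _ _).const_mul _

lemma coef_sepField (m n : ℕ) (κ : Fin 4 → ℝ) (F : Fin 3 → ℝ → ℝ) (m' n' : ℕ) (i : Fin 4)
    (j : Fin 3) (z : ℝ) : coef (sepField m n κ F) m' n' i j z
      = if m = m' ∧ n = n' then κ i * hsgn j i * F j z * hN j i m n else 0 := by
  unfold coef S
  simp_rw [sepField_mul_te]
  rw [integral_finsetSum _ fun i' _ => (integrable_te_mul_te _ _ _ _ _ _ _ _).const_mul _]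
  simp_rw [integral_const_mul, integral_te_mul_te]
  rw [Finset.sum_eq_single i]
  · by_cases h : m = m' ∧ n = n'
    · simp [h, hN]
    · rw [if_neg h, if_neg (fun h' => h ⟨h'.1.2, h'.2.2⟩), mul_zero]
  · intro i' _ hi
    rw [if_neg fun h' => hi (par_injective j i' i h'.1.1 h'.2.1), mul_zero]
  · simp

lemma coef_sum_sepField {ι : Type*} (s : Finset ι) (m n : ι → ℕ) (κ : ι → Fin 4 → ℝ)
    (F : ι → Fin 3 → ℝ → ℝ) (m' n' : ℕ) (i : Fin 4) (j : Fin 3) (z : ℝ) :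
    coef (∑ t ∈ s, sepField (m t) (n t) (κ t) (F t)) m' n' i j z
      = ∑ t ∈ s, coef (sepField (m t) (n t) (κ t) (F t)) m' n' i j z := by
  unfold coef S
  simp_rw [Finset.sum_apply, Finset.sum_mul]
  exact integral_finsetSum _ fun t _ => integrable_sepField_mul_te _ _ _ _ _ _ _ _ _

/-- Linearity holds only for almost every `z`, since only almost every slice is known to be
integrable. -/
lemma S_sub_ae {f g : Pt → ℝ} (hf : Integrable f volΩ) (hg : Integrable g volΩ)
    (a : Bool) (m : ℕ) (b : Bool) (n : ℕ) :
    S (fun X => f X - g X) (te a m b n) =ᵐ[zm]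
      fun z => S f (te a m b n) z - S g (te a m b n) z := by
  filter_upwards [((integrable_volΩ_iff f).1 hf).prod_left_ae,
    ((integrable_volΩ_iff g).1 hg).prod_left_ae] with z h1 h2
  have hte := (continuous_te a m b n).aestronglyMeasurable (μ := hm)
  unfold S
  rw [← integral_sub (integrable_mul_bdd h1 hte 1 (abs_te_le a m b n))
    (integrable_mul_bdd h2 hte 1 (abs_te_le a m b n))]
  congr 1; ext p; ring

/-- A field in `L¹(Ω)` is determined by its horizontal Fourier coefficients. -/
lemma ae_eq_of_coef_ae_eq {u v : Pt → Fin 3 → ℝ} (hu : ∀ j, Integrable (fun X => u X j) volΩ)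
    (hv : ∀ j, Integrable (fun X => v X j) volΩ)
    (h : ∀ m n i j, coef u m n i j =ᵐ[zm] coef v m n i j) : u =ᵐ[volΩ] v := by
  have key : ∀ j, (fun X => u X j - v X j) =ᵐ[volΩ] 0 := fun j => by
    refine ae_eq_zero_of_S_eq_zero ((hu j).sub (hv j)) fun a m b n => ?_
    obtain ⟨i, rfl, rfl⟩ := exists_par j a b
    filter_upwards [S_sub_ae (hu j) (hv j) (parX j i) m (parY j i) n, h m n i j] with z h1 h2
    refine h1.trans ?_
    unfold coef at h2
    rw [h2, sub_self]; rfl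
  filter_upwards [key 0, key 1, key 2] with X h0 h1 h2
  ext j
  fin_cases j
  · exact sub_eq_zero.1 h0
  · exact sub_eq_zero.1 h1
  · exact sub_eq_zero.1 h2

/-! ### Integration by parts: classical, weak and very weak solutions. -/

lemma contDiff_pd {f : Pt → ℝ} (hf : ContDiff ℝ ∞ f) (i : Fin 3) : ContDiff ℝ ∞ (pd i f) :=
  (hf.fderiv_right (m := ∞) (by simp)).clm_apply contDiff_const

lemma integrable_of_continuous {g : Pt → ℝ} (hg : Continuous g) : Integrable g volΩ := by
  simpa using integrable_mul_of_continuous (integrable_const (1 : ℝ)) hg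

lemma memLp_of_continuous {g : Pt → ℝ} (hg : Continuous g) : MemLp g 2 volΩ := by
  rw [memLp_two_iff_integrable_sq hg.aestronglyMeasurable]
  exact integrable_of_continuous (hg.pow 2)

lemma hasDerivAt_pd_zero {f : Pt → ℝ} (hf : ContDiff ℝ ∞ f) (x y z : ℝ) :
    HasDerivAt (fun t => f (t, y, z)) (pd 0 f (x, y, z)) x := by
  have h1 : HasDerivAt (fun t : ℝ => ((t, y, z) : Pt)) (1, 0, 0) x :=
    (hasDerivAt_id x).prodMk (hasDerivAt_const x (y, z))
  exact (((hf.differentiable (by simp)) (x, y, z)).hasFDerivAt.comp_hasDerivAt x h1)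

lemma hasDerivAt_pd_one {f : Pt → ℝ} (hf : ContDiff ℝ ∞ f) (x y z : ℝ) :
    HasDerivAt (fun t => f (x, t, z)) (pd 1 f (x, y, z)) y := by
  have h1 : HasDerivAt (fun t : ℝ => ((x, t, z) : Pt)) (0, 1, 0) y :=
    (hasDerivAt_const y x).prodMk ((hasDerivAt_id y).prodMk (hasDerivAt_const y z))
  exact (((hf.differentiable (by simp)) (x, y, z)).hasFDerivAt.comp_hasDerivAt y h1)

lemma hasDerivAt_pd_two {f : Pt → ℝ} (hf : ContDiff ℝ ∞ f) (x y z : ℝ) :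
    HasDerivAt (fun t => f (x, y, t)) (pd 2 f (x, y, z)) z := by
  have h1 : HasDerivAt (fun t : ℝ => ((x, y, t) : Pt)) (0, 0, 1) z :=
    (hasDerivAt_const z x).prodMk ((hasDerivAt_const z y).prodMk (hasDerivAt_id z))
  exact (((hf.differentiable (by simp)) (x, y, z)).hasFDerivAt.comp_hasDerivAt z h1)

lemma integral_cm (g : ℝ → ℝ) : ∫ x, g x ∂cm = ∫ x in (0)..(2 * Real.pi), g x := by
  rw [intervalIntegral.integral_of_le (by positivity), cm]

/-- The variable of differentiation is integrated first; periodicity or the zero wall values cancel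
the boundary terms. -/
lemma integral_pd_eq_zero {f : Pt → ℝ} (hf : ContDiff ℝ ∞ f) (hp : HPeriodic f)
    (h1 : ∀ x y, f (x, y, 1) = 0) (h2 : ∀ x y, f (x, y, -1) = 0) (i : Fin 3) :
    ∫ X, pd i f X ∂volΩ = 0 := by
  have h012 : i = 0 ∨ i = 1 ∨ i = 2 := by fin_cases i <;> simp
  have hc := (contDiff_pd hf i).continuous
  have hi : Integrable (pd i f) (cm.prod (cm.prod zm)) := by
    rw [← volΩ_eq]; exact integrable_of_continuous hc
  rw [volΩ_eq]
  rcases h012 with rfl | rfl | rfl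
  · rw [integral_prod_symm _ hi]
    refine integral_eq_zero_of_ae (Eventually.of_forall fun p => ?_)
    obtain ⟨y, z⟩ := p
    simp only [Pi.zero_apply]
    rw [integral_cm, intervalIntegral.integral_eq_sub_of_hasDerivAt
      (fun x _ => hasDerivAt_pd_zero hf x y z)
      ((hc.comp (by fun_prop : Continuous fun x : ℝ => ((x, y, z) : Pt))).intervalIntegrable _ _)]
    have := (hp 0 y z).1
    rw [zero_add] at this
    rw [this, sub_self]
  · rw [integral_prod _ hi]
    refine integral_eq_zero_of_ae ?_
    filter_upwards [hi.prod_right_ae] with x hx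
    simp only [Pi.zero_apply]
    rw [integral_prod_symm _ hx]
    refine integral_eq_zero_of_ae (Eventually.of_forall fun z => ?_)
    simp only [Pi.zero_apply]
    rw [integral_cm, intervalIntegral.integral_eq_sub_of_hasDerivAt
      (fun y _ => hasDerivAt_pd_one hf x y z)
      ((hc.comp (by fun_prop : Continuous fun y : ℝ => ((x, y, z) : Pt))).intervalIntegrable _ _)]
    have := (hp x 0 z).2
    rw [zero_add] at this
    rw [this, sub_self]
  · rw [integral_prod _ hi]
    refine integral_eq_zero_of_ae ?_
    filter_upwards [hi.prod_right_ae] with x hx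
    simp only [Pi.zero_apply]
    rw [integral_prod _ hx]
    refine integral_eq_zero_of_ae (Eventually.of_forall fun y => ?_)
    simp only [Pi.zero_apply]
    rw [integral_zm, intervalIntegral.integral_eq_sub_of_hasDerivAt
      (fun z _ => hasDerivAt_pd_two hf x y z)
      ((hc.comp (by fun_prop : Continuous fun z : ℝ => ((x, y, z) : Pt))).intervalIntegrable _ _),
      h1, h2, sub_self]

lemma pd_mul {f g : Pt → ℝ} (hf : ContDiff ℝ ∞ f) (hg : ContDiff ℝ ∞ g) (i : Fin 3) (X : Pt) :
    pd i (fun X => f X * g X) X = f X * pd i g X + pd i f X * g X := by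
  unfold pd
  rw [fderiv_fun_mul ((hf.differentiable (by simp)) X) ((hg.differentiable (by simp)) X)]
  simp
  ring

lemma HPeriodic.mul {f g : Pt → ℝ} (hf : HPeriodic f) (hg : HPeriodic g) :
    HPeriodic (fun X => f X * g X) := fun x y z => by
  simp only [(hf x y z).1, (hf x y z).2, (hg x y z).1, (hg x y z).2, and_self]

lemma HPeriodic.pd {f : Pt → ℝ} (hf : HPeriodic f) (i : Fin 3) :
    HPeriodic (pd i f) := by
  have shift : ∀ v : Pt, (∀ X, f (X + v) = f X) → ∀ X, StokesChannel.pd i f (X + v)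
      = StokesChannel.pd i f X := by
    intro v hv X
    have : (fun X => f (X + v)) = f := funext hv
    unfold StokesChannel.pd
    rw [← fderiv_comp_add_right v, this]
  intro x y z
  constructor
  · have := shift (2 * Real.pi, 0, 0) (fun X => by
      obtain ⟨a, b, c⟩ := X; simpa using (hf a b c).1) (x, y, z)
    simpa using this
  · have := shift (0, 2 * Real.pi, 0) (fun X => by
      obtain ⟨a, b, c⟩ := X; simpa using (hf a b c).2) (x, y, z)
    simpa using this

lemma IsTest.boundary {φ : Pt → ℝ} (h : IsTest φ) (x y : ℝ) :
    φ (x, y, 1) = 0 ∧ φ (x, y, -1) = 0 := by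
  obtain ⟨r, hr, h0⟩ := h.2
  exact ⟨h0 _ (by simpa using hr.le), h0 _ (by simpa using hr.le)⟩

lemma integral_pd_mul_test {f φ : Pt → ℝ} (hf : SmoothPeriodic f) (hφ : IsTest φ) (i : Fin 3) :
    ∫ X, pd i (fun X => f X * φ X) X ∂volΩ = 0 :=
  integral_pd_eq_zero (hf.1.mul hφ.1.1) (hf.2.mul hφ.1.2)
    (fun x y => by simp [(hφ.boundary x y).1]) (fun x y => by simp [(hφ.boundary x y).2]) i

lemma SmoothPeriodic.pd {f : Pt → ℝ} (hf : SmoothPeriodic f) (i : Fin 3) :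
    SmoothPeriodic (pd i f) := ⟨contDiff_pd hf.1 i, hf.2.pd i⟩

lemma integral_mul_pd_test {f φ : Pt → ℝ} (hf : SmoothPeriodic f) (hφ : IsTest φ) (i : Fin 3) :
    ∫ X, f X * pd i φ X ∂volΩ = - ∫ X, pd i f X * φ X ∂volΩ := by
  have h := integral_pd_mul_test hf hφ i
  simp_rw [pd_mul hf.1 hφ.1.1] at h
  have i1 : Integrable (fun X => f X * pd i φ X) volΩ :=
    integrable_of_continuous (hf.1.continuous.mul (contDiff_pd hφ.1.1 i).continuous)
  have i2 : Integrable (fun X => pd i f X * φ X) volΩ :=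
    integrable_of_continuous ((contDiff_pd hf.1 i).continuous.mul hφ.1.1.continuous)
  rw [integral_add i1 i2] at h
  linarith

lemma hasH1Grad_of_smooth {f : Pt → ℝ} (hf : SmoothPeriodic f) : HasH1Grad f fun j => pd j f where
  periodic := hf.2
  memLp := memLp_of_continuous hf.1.continuous
  memLp_grad i := memLp_of_continuous (contDiff_pd hf.1 i).continuous
  weak i _ hφ := integral_mul_pd_test hf hφ i

/-- Classical solutions are weak solutions. -/
lemma isStokesEigenpair_of_classical {lam : ℝ} {u : Pt → Fin 3 → ℝ} {q : Pt → ℝ}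
    (hu : ∀ i, SmoothPeriodic fun X => u X i) (hq : SmoothPeriodic q)
    (h1 : ∀ x y i, u (x, y, 1) i = 0) (h2 : ∀ x y i, u (x, y, -1) i = 0)
    (hdiv : ∀ X, ∑ i, pd i (fun X => u X i) X = 0)
    (heq : ∀ i X, - ∑ j, pd j (pd j fun X => u X i) X + pd i q X = lam * u X i)
    (hne : ¬ u =ᵐ[volΩ] 0) : IsStokesEigenpair lam u q := by
  refine ⟨hne, hq.2, memLp_of_continuous hq.1.continuous,
    fun i j => pd j fun X => u X i, ⟨fun i => hasH1Grad_of_smooth (hu i),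
      Eventually.of_forall hdiv, fun i φ hφ => ?_⟩, fun φ hφ => ?_⟩
  · have h := integral_pd_eq_zero ((hu i).1.mul hφ.1) ((hu i).2.mul hφ.2)
      (fun x y => by simp [h1]) (fun x y => by simp [h2]) 2
    simp_rw [pd_mul (hu i).1 hφ.1] at h
    exact h
  · have cu : ∀ i, Continuous fun X => u X i := fun i => (hu i).1.continuous
    have cφ : ∀ i, Continuous (φ i) := fun i => (hφ i).1.1.continuous
    have cpu : ∀ i j, Continuous (pd j fun X => u X i) := fun i j =>
      (contDiff_pd (hu i).1 j).continuous
    have cppu : ∀ i j, Continuous (pd j (pd j fun X => u X i)) := fun i j =>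
      (contDiff_pd (contDiff_pd (hu i).1 j) j).continuous
    have cpφ : ∀ i j, Continuous (pd j (φ i)) := fun i j => (contDiff_pd (hφ i).1.1 j).continuous
    have cq : Continuous q := hq.1.continuous
    -- The product rule and the equation turn the weak integrand into `lam u · φ` plus derivatives
    -- of products with a test function, which integrate to zero.
    have e : ∀ X, ∑ i, ∑ j, pd j (fun X => u X i) X * pd j (φ i) X - q X * ∑ i, pd i (φ i) X
        = lam * ∑ i, u X i * φ i X
          + (∑ i, ((∑ j, pd j (fun X => (pd j fun X => u X i) X * φ i X) X)
            - pd i (fun X => q X * φ i X) X)) := by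
      intro X
      simp_rw [fun i j => pd_mul (contDiff_pd (hu i).1 j) (hφ i).1.1 j X,
        fun i => pd_mul hq.1 (hφ i).1.1 i X]
      rw [Finset.mul_sum, Finset.mul_sum, ← Finset.sum_sub_distrib, ← Finset.sum_add_distrib]
      refine Finset.sum_congr rfl fun i _ => ?_
      rw [Finset.sum_add_distrib, ← Finset.sum_mul]
      linear_combination (φ i X) * heq i X
    simp_rw [e]
    have i1 : Integrable (fun X => lam * ∑ i, u X i * φ i X) volΩ :=
      integrable_of_continuous (by fun_prop)
    have i2 : ∀ i j, Integrable (fun X => pd j (fun X => (pd j fun X => u X i) X * φ i X) X) volΩ :=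
      fun i j => integrable_of_continuous
        (contDiff_pd ((contDiff_pd (hu i).1 j).mul (hφ i).1.1) j).continuous
    have i3 : ∀ i, Integrable (fun X => pd i (fun X => q X * φ i X) X) volΩ :=
      fun i => integrable_of_continuous (contDiff_pd (hq.1.mul (hφ i).1.1) i).continuous
    have i4 : ∀ i, Integrable (fun X => ∑ j, pd j (fun X => (pd j fun X => u X i) X * φ i X) X)
      volΩ := fun i => integrable_finsetSum _ fun j _ => i2 i j
    have i5 : ∀ i, Integrable (fun X => (∑ j, pd j (fun X => (pd j fun X => u X i) X * φ i X) X)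
      - pd i (fun X => q X * φ i X) X) volΩ := fun i => (i4 i).sub (i3 i)
    rw [integral_add i1 (integrable_finsetSum _ fun i _ => i5 i), integral_const_mul,
      integral_finsetSum _ fun i _ => i5 i]
    rw [Finset.sum_eq_zero, add_zero]
    intro i _
    rw [integral_sub (i4 i) (i3 i), integral_finsetSum _ fun j _ => i2 i j,
      integral_pd_mul_test hq (hφ i) i,
      Finset.sum_eq_zero fun j _ => integral_pd_mul_test ((hu i).pd j) (hφ i) j, sub_zero]

/-- The weak form, with all derivatives moved to the test field. -/
lemma IsStokesEigenpair.very_weak {lam : ℝ} {u : Pt → Fin 3 → ℝ} {q : Pt → ℝ}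
    (h : IsStokesEigenpair lam u q) (j : Fin 3) {ψ : Pt → ℝ} (hψ : IsTest ψ) :
    ∫ X, q X * pd j ψ X ∂volΩ
      = - ∫ X, u X j * (pd 0 (pd 0 ψ) X + pd 1 (pd 1 ψ) X + pd 2 (pd 2 ψ) X + lam * ψ X) ∂volΩ := by
  obtain ⟨G, hV, hmom⟩ := h.momentum
  have hG := fun k => memLp_integrable ((hV.h1 j).memLp_grad k)
  have hu := memLp_integrable (hV.h1 j).memLp
  have hq := memLp_integrable h.memLp_q
  have hψs := hψ.1.1
  have hc : ∀ k, Continuous (pd k ψ) := fun k => (contDiff_pd hψs k).continuous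
  have hcc : ∀ k, Continuous (pd k (pd k ψ)) := fun k =>
    (contDiff_pd (contDiff_pd hψs k) k).continuous
  have ht : ∀ k, IsTest (pd k ψ) := by
    intro k
    refine ⟨hψ.1.pd k, ?_⟩
    obtain ⟨r, hr, h0⟩ := hψ.2
    refine ⟨(r + 1) / 2, by linarith, fun X hX => ?_⟩
    have : ψ =ᶠ[nhds X] fun _ => 0 := by
      have hop : IsOpen {Y : Pt | r < |Y.2.2|} :=
        isOpen_lt continuous_const (by fun_prop)
      filter_upwards [hop.mem_nhds (show r < |X.2.2| by linarith)] with Y hY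
      exact h0 Y hY.le
    unfold pd
    rw [this.fderiv_eq]; simp
  have h1 := IsStokesEigenpair.momentum_component hmom j hψ
  rw [integral_finThree_test (hG 0) (hG 1) (hG 2) hq (hc 0) (hc 1) (hc 2) (hc j)] at h1
  -- The derivatives `∂ₖψ` are again test functions, so the weak gradient can be removed. The
  -- outcome shows that `∇q` is determined by `u` and `lam`.
  have hw := fun k => (hV.h1 j).weak k _ (ht k)
  have e : ∀ X, u X j * (pd 0 (pd 0 ψ) X + pd 1 (pd 1 ψ) X + pd 2 (pd 2 ψ) X + lam * ψ X)
      = u X j * pd 0 (pd 0 ψ) X + u X j * pd 1 (pd 1 ψ) X + u X j * pd 2 (pd 2 ψ) X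
        - u X j * (-lam * ψ X) := fun X => by ring
  simp_rw [e]
  have hcψ : Continuous fun X => -lam * ψ X := continuous_const.mul hψs.continuous
  rw [integral_finThree_test hu hu hu hu (hcc 0) (hcc 1) (hcc 2) hcψ, hw 0, hw 1, hw 2]
  simp_rw [mul_left_comm (u _ j) (-lam)]
  rw [integral_const_mul]
  linarith

/-! ### Separated fields as classical solutions. -/

/-- The horizontal factor of the `j`-th component. -/
noncomputable def hpoly (j : Fin 3) (m n : ℕ) (κ : Fin 4 → ℝ) (p : ℝ × ℝ) : ℝ :=
  ∑ i, κ i * hsgn j i * te (parX j i) m (parY j i) n p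

/-- The `x`-derivative of `hpoly`. -/
noncomputable def hpolyX (j : Fin 3) (m n : ℕ) (κ : Fin 4 → ℝ) (p : ℝ × ℝ) : ℝ :=
  ∑ i, κ i * hsgn j i * (trSign (parX j i) * m * te (!parX j i) m (parY j i) n p)

/-- The `y`-derivative of `hpoly`. -/
noncomputable def hpolyY (j : Fin 3) (m n : ℕ) (κ : Fin 4 → ℝ) (p : ℝ × ℝ) : ℝ :=
  ∑ i, κ i * hsgn j i * (trSign (parY j i) * n * te (parX j i) m (!parY j i) n p)

lemma hasDerivAt_te_fst (a : Bool) (m : ℕ) (b : Bool) (n : ℕ) (x y : ℝ) :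
    HasDerivAt (fun t => te a m b n (t, y)) (trSign a * m * te (!a) m b n (x, y)) x :=
  ((hasDerivAt_tr a m x).mul_const (tr b n y)).congr_deriv (by simp only [te]; ring)

lemma hasDerivAt_te_snd (a : Bool) (m : ℕ) (b : Bool) (n : ℕ) (x y : ℝ) :
    HasDerivAt (fun t => te a m b n (x, t)) (trSign b * n * te a m (!b) n (x, y)) y :=
  ((hasDerivAt_tr b n y).const_mul (tr a m x)).congr_deriv (by simp only [te]; ring)

section Poly
variable (j : Fin 3) (m n : ℕ) (κ : Fin 4 → ℝ)

lemma hasDerivAt_hpoly_fst (x y : ℝ) :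
    HasDerivAt (fun t => hpoly j m n κ (t, y)) (hpolyX j m n κ (x, y)) x :=
  HasDerivAt.fun_sum fun _ _ => (hasDerivAt_te_fst _ _ _ _ x y).const_mul _

lemma hasDerivAt_hpoly_snd (x y : ℝ) :
    HasDerivAt (fun t => hpoly j m n κ (x, t)) (hpolyY j m n κ (x, y)) y :=
  HasDerivAt.fun_sum fun _ _ => (hasDerivAt_te_snd _ _ _ _ x y).const_mul _

lemma hasDerivAt_hpolyX (x y : ℝ) :
    HasDerivAt (fun t => hpolyX j m n κ (t, y)) (-m ^ 2 * hpoly j m n κ (x, y)) x := by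
  refine (HasDerivAt.fun_sum fun i _ =>
    ((hasDerivAt_te_fst _ _ _ _ x y).const_mul _).const_mul _).congr_deriv ?_
  rw [hpoly, Finset.mul_sum]
  refine Finset.sum_congr rfl fun i _ => ?_
  rw [Bool.not_not]
  linear_combination (κ i * hsgn j i * m ^ 2 * te (parX j i) m (parY j i) n (x, y))
    * trSign_mul_not (parX j i)

lemma hasDerivAt_hpolyY (x y : ℝ) :
    HasDerivAt (fun t => hpolyY j m n κ (x, t)) (-n ^ 2 * hpoly j m n κ (x, y)) y := by
  refine (HasDerivAt.fun_sum fun i _ =>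
    ((hasDerivAt_te_snd _ _ _ _ x y).const_mul _).const_mul _).congr_deriv ?_
  rw [hpoly, Finset.mul_sum]
  refine Finset.sum_congr rfl fun i _ => ?_
  rw [Bool.not_not]
  linear_combination (κ i * hsgn j i * n ^ 2 * te (parX j i) m (parY j i) n (x, y))
    * trSign_mul_not (parY j i)

/-- This and the next three identities make the separation consistent: the divergence is a multiple
of the third factor, and a pressure built on the third factor has a gradient of the same form as the
velocity. -/
lemma hpolyX_zero (p : ℝ × ℝ) : hpolyX 0 m n κ p = -m * hpoly 2 m n κ p := by
  rw [hpoly, hpolyX, Finset.mul_sum]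
  refine Finset.sum_congr rfl fun i _ => ?_
  fin_cases i <;> simp [hsgn, trSign, parX, parY] <;> ring

lemma hpolyY_one (p : ℝ × ℝ) : hpolyY 1 m n κ p = -n * hpoly 2 m n κ p := by
  rw [hpoly, hpolyY, Finset.mul_sum]
  refine Finset.sum_congr rfl fun i _ => ?_
  fin_cases i <;> simp [hsgn, trSign, parX, parY] <;> ring

lemma hpolyX_two (p : ℝ × ℝ) : hpolyX 2 m n κ p = m * hpoly 0 m n κ p := by
  rw [hpoly, hpolyX, Finset.mul_sum]
  refine Finset.sum_congr rfl fun i _ => ?_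
  fin_cases i <;> simp [hsgn, trSign, parX, parY] <;> ring

lemma hpolyY_two (p : ℝ × ℝ) : hpolyY 2 m n κ p = n * hpoly 1 m n κ p := by
  rw [hpoly, hpolyY, Finset.mul_sum]
  refine Finset.sum_congr rfl fun i _ => ?_
  fin_cases i <;> simp [hsgn, trSign, parX, parY] <;> ring

/-- A scalar function with separated vertical profile. -/
noncomputable def sepScalar (χ : ℝ → ℝ) (X : Pt) : ℝ := hpoly j m n κ (X.1, X.2.1) * χ X.2.2

lemma sepField_eq (F : Fin 3 → ℝ → ℝ) :
    (fun X => sepField m n κ F X j) = sepScalar j m n κ (F j) := by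
  ext X
  rw [sepField_apply, sepScalar, hpoly, Finset.sum_mul]
  exact Finset.sum_congr rfl fun i _ => by ring

variable {χ χ' χ'' : ℝ → ℝ}

lemma smoothPeriodic_sepScalar (hχ : ContDiff ℝ ∞ χ) :
    SmoothPeriodic (sepScalar j m n κ χ) := by
  refine ⟨?_, fun x y z => ?_⟩
  · have h1 := fun a => contDiff_tr a m
    have h2 := fun a => contDiff_tr a n
    unfold sepScalar hpoly te
    fun_prop
  · simp [sepScalar, hpoly, te, tr_add_two_pi]

lemma pd_zero_sepScalar (hχ : ContDiff ℝ ∞ χ) :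
    pd 0 (sepScalar j m n κ χ) = fun X => hpolyX j m n κ (X.1, X.2.1) * χ X.2.2 := by
  ext ⟨x, y, z⟩
  exact pd_zero_eq ((smoothPeriodic_sepScalar j m n κ hχ).1.differentiable (by simp) _)
    ((hasDerivAt_hpoly_fst j m n κ x y).mul_const (χ z))

lemma pd_one_sepScalar (hχ : ContDiff ℝ ∞ χ) :
    pd 1 (sepScalar j m n κ χ) = fun X => hpolyY j m n κ (X.1, X.2.1) * χ X.2.2 := by
  ext ⟨x, y, z⟩
  exact pd_one_eq ((smoothPeriodic_sepScalar j m n κ hχ).1.differentiable (by simp) _)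
    ((hasDerivAt_hpoly_snd j m n κ x y).mul_const (χ z))

lemma pd_two_sepScalar (hχ : ContDiff ℝ ∞ χ) (hd : ∀ z, HasDerivAt χ (χ' z) z) :
    pd 2 (sepScalar j m n κ χ) = sepScalar j m n κ χ' := by
  ext ⟨x, y, z⟩
  exact pd_two_eq ((smoothPeriodic_sepScalar j m n κ hχ).1.differentiable (by simp) _)
    ((hd z).const_mul (hpoly j m n κ (x, y)))

lemma laplacian_sepScalar (hχ : ContDiff ℝ ∞ χ) (hd : ∀ z, HasDerivAt χ (χ' z) z)
    (hd' : ∀ z, HasDerivAt χ' (χ'' z) z) (X : Pt) :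
    ∑ k, pd k (pd k (sepScalar j m n κ χ)) X
      = hpoly j m n κ (X.1, X.2.1) * (χ'' X.2.2 - mu m n ^ 2 * χ X.2.2) := by
  have hs := (smoothPeriodic_sepScalar j m n κ hχ).1
  have hχ' : ContDiff ℝ ∞ χ' := by
    have := (contDiff_infty_iff_deriv.1 hχ).2
    rwa [funext fun z => (hd z).deriv] at this
  have hdf := fun k => (contDiff_pd hs k).differentiable (by simp)
  obtain ⟨x, y, z⟩ := X
  have e0 : pd 0 (pd 0 (sepScalar j m n κ χ)) (x, y, z) = -m ^ 2 * hpoly j m n κ (x, y) * χ z := by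
    refine pd_zero_eq (hdf 0 _) ?_
    rw [pd_zero_sepScalar j m n κ hχ]
    exact (hasDerivAt_hpolyX j m n κ x y).mul_const (χ z)
  have e1 : pd 1 (pd 1 (sepScalar j m n κ χ)) (x, y, z) = -n ^ 2 * hpoly j m n κ (x, y) * χ z := by
    refine pd_one_eq (hdf 1 _) ?_
    rw [pd_one_sepScalar j m n κ hχ]
    exact (hasDerivAt_hpolyY j m n κ x y).mul_const (χ z)
  rw [Fin.sum_univ_three, e0, e1, pd_two_sepScalar j m n κ hχ hd, pd_two_sepScalar j m n κ hχ' hd',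
    sepScalar, mu_sq]
  ring

end Poly

/-- Profiles that solve the mode equations give eigenfunctions. -/
lemma isStokesEigenpair_sepField {m n : ℕ} {κ : Fin 4 → ℝ} {F D D' : Fin 3 → ℝ → ℝ} {Q R : ℝ → ℝ}
    {lam : ℝ} (hF : ∀ j, ContDiff ℝ ∞ (F j)) (hQ : ContDiff ℝ ∞ Q)
    (hD : ∀ j z, HasDerivAt (F j) (D j z) z) (hD' : ∀ j z, HasDerivAt (D j) (D' j z) z)
    (hR : ∀ z, HasDerivAt Q (R z) z)
    (e0 : ∀ z, D' 0 z = (mu m n ^ 2 - lam) * F 0 z + m * Q z)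
    (e1 : ∀ z, D' 1 z = (mu m n ^ 2 - lam) * F 1 z + n * Q z)
    (e2 : ∀ z, D' 2 z = (mu m n ^ 2 - lam) * F 2 z + R z)
    (hdiv : ∀ z, m * F 0 z + n * F 1 z = D 2 z)
    (hb : ∀ j, F j 1 = 0 ∧ F j (-1) = 0) (hne : ¬ sepField m n κ F =ᵐ[volΩ] 0) :
    IsStokesEigenpair lam (sepField m n κ F) (sepScalar 2 m n κ Q) := by
  have hb' : ∀ j X, sepField m n κ F X j = hpoly j m n κ (X.1, X.2.1) * F j X.2.2 := fun j X =>
    congrFun (sepField_eq j m n κ F) X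
  refine isStokesEigenpair_of_classical (fun j => ?_) (smoothPeriodic_sepScalar 2 m n κ hQ)
    (fun x y j => by rw [hb', (hb j).1, mul_zero]) (fun x y j => by rw [hb', (hb j).2, mul_zero])
    (fun X => ?_) (fun j X => ?_) hne
  · rw [sepField_eq]; exact smoothPeriodic_sepScalar j m n κ (hF j)
  · simp_rw [sepField_eq]
    rw [Fin.sum_univ_three, pd_zero_sepScalar _ _ _ _ (hF 0), pd_one_sepScalar _ _ _ _ (hF 1),
      pd_two_sepScalar _ _ _ _ (hF 2) (hD 2), sepScalar]
    simp only
    rw [hpolyX_zero, hpolyY_one, ← hdiv]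
    ring
  · rw [hb', sepField_eq, laplacian_sepScalar _ _ _ _ (hF j) (hD j) (hD' j)]
    have h012 : j = 0 ∨ j = 1 ∨ j = 2 := by fin_cases j <;> simp
    rcases h012 with rfl | rfl | rfl
    · rw [pd_zero_sepScalar _ _ _ _ hQ, e0]; simp only [hpolyX_two]; ring
    · rw [pd_one_sepScalar _ _ _ _ hQ, e1]; simp only [hpolyY_two]; ring
    · rw [pd_two_sepScalar _ _ _ _ hQ hR, sepScalar, e2]; ring

lemma contDiff_sinProfile (p : ℕ) : ContDiff ℝ ∞ (sinProfile p) := by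
  unfold sinProfile; fun_prop

/-- A common form for `μ = 0` and `μ > 0`: a sine times a constant horizontal vector orthogonal to
`(m, n)`. The last conditions name a component that does not vanish. -/
lemma torProfile_eq (m n p : ℕ) : ∃ c : Fin 3 → ℝ, c 2 = 0 ∧ m * c 0 + n * c 1 = 0 ∧
    ((0 < n → c 0 ≠ 0) ∧ (n = 0 → c 1 ≠ 0)) ∧
    torProfile m n p = fun j z => c j * sinProfile p z := by
  by_cases h : m = 0 ∧ n = 0
  · refine ⟨![1, 1, 0], by simp, by simp [h], by simp, ?_⟩
    rw [torProfile, if_pos h]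
    ext j z
    fin_cases j <;> simp
  · refine ⟨![n, -m, 0], by simp, by simp; ring, ⟨fun hn => ?_, fun hn => ?_⟩, ?_⟩
    · simpa using hn.ne'
    · have : m ≠ 0 := fun hm => h ⟨hm, hn⟩
      simpa using this
    rw [torProfile, if_neg h]
    ext j z
    fin_cases j <;> simp

lemma contDiff_torProfile (m n p : ℕ) (j : Fin 3) : ContDiff ℝ ∞ (torProfile m n p j) := by
  obtain ⟨c, -, -, -, h⟩ := torProfile_eq m n p
  rw [h]
  exact contDiff_const.mul (contDiff_sinProfile p)

lemma contDiff_polProfile (m n p : ℕ) (j : Fin 3) : ContDiff ℝ ∞ (polProfile m n p j) := by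
  obtain ⟨h1, h2, h3, h4⟩ := contDiff_profile_parts (mu m n) p
  unfold polProfile
  fin_cases j
  · exact contDiff_const.mul (h2.add h4)
  · exact contDiff_const.mul (h2.add h4)
  · exact contDiff_const.mul (h1.add h3)

lemma gradZero_zero : GradZero fun _ => 0 := fun i φ _ => by simp

lemma isStokesEigenpair_tor (m n p : ℕ) {κ : Fin 4 → ℝ}
    (hne : ¬ sepField m n κ (torProfile m n p) =ᵐ[volΩ] 0) :
    IsStokesEigenpair (lamD m n p) (sepField m n κ (torProfile m n p)) fun _ => 0 := by
  have hsm := contDiff_torProfile m n p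
  obtain ⟨c, hc2, hcd, -, h⟩ := torProfile_eq m n p
  have hq : (fun _ => (0 : ℝ)) = sepScalar 2 m n κ fun _ => 0 := by
    ext X; simp [sepScalar]
  rw [hq]
  have d1 : ∀ z, HasDerivAt (sinProfile p)
      (Real.pi / 2 * p * Real.cos (Real.pi / 2 * p * (z + 1))) z := fun z =>
    ((((hasDerivAt_id' z).add_const 1).const_mul (Real.pi / 2 * p)).sin).congr_deriv (by ring)
  have d2 : ∀ z, HasDerivAt (fun z => Real.pi / 2 * p * Real.cos (Real.pi / 2 * p * (z + 1)))
      (-(Real.pi ^ 2 / 4 * p ^ 2) * sinProfile p z) z := fun z =>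
    (((((hasDerivAt_id' z).add_const 1).const_mul (Real.pi / 2 * p)).cos).const_mul
      (Real.pi / 2 * p)).congr_deriv (by rw [sinProfile]; ring)
  refine isStokesEigenpair_sepField (D := fun j z => c j *
      (Real.pi / 2 * p * Real.cos (Real.pi / 2 * p * (z + 1))))
    (D' := fun j z => c j * (-(Real.pi ^ 2 / 4 * p ^ 2) * sinProfile p z)) (R := fun _ => 0)
    hsm contDiff_const ?_ (fun j z => (d2 z).const_mul _)
    (fun z => hasDerivAt_const z 0) ?_ ?_ ?_ ?_ ?_ hne
  · intro j z
    rw [h]; exact (d1 z).const_mul _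
  · intro z; rw [h, lamD]; ring
  · intro z; rw [h, lamD]; ring
  · intro z; rw [h, lamD]; ring
  · intro z
    rw [h]
    simp only
    rw [hc2]
    linear_combination sinProfile p z * hcd
  · intro j
    rw [h]
    have h1 : sinProfile p 1 = 0 := by
      have : Real.pi / 2 * p * (1 + 1) = p * Real.pi := by ring
      rw [sinProfile, this, Real.sin_nat_mul_pi]
    have h2 : sinProfile p (-1) = 0 := by simp [sinProfile]
    simp [h1, h2]

/-- The operator `d²/dz² + σ²` kills the oscillating part and multiplies the hyperbolic part by `σ²
+ μ²`, the eigenvalue. The remainder has to be balanced by the pressure, which explains its profile.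
-/
lemma isStokesEigenpair_pol {m n : ℕ} (hμ : 0 < mu m n) (p : ℕ) {κ : Fin 4 → ℝ}
    (hne : ¬ sepField m n κ (polProfile m n p) =ᵐ[volΩ] 0) :
    IsStokesEigenpair (LamD m n p) (sepField m n κ (polProfile m n p))
      (sepScalar 2 m n κ fun z => LamD m n p * hypPart' (mu m n) p z) := by
  have hsm := contDiff_polProfile m n p
  obtain ⟨s1, s2, s3, s4⟩ := contDiff_profile_parts (mu m n) p
  have o1 := hasDerivAt_oscPart (mu m n) p
  have o2 := hasDerivAt_oscPart' (mu m n) p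
  have h1 := hasDerivAt_hypPart (mu m n) p
  have h2 := hasDerivAt_hypPart' (mu m n) p
  set μ := mu m n with hμd
  have hμ2 : μ ^ 2 = (m : ℝ) ^ 2 + (n : ℝ) ^ 2 := mu_sq m n
  set σ := root μ p with hσd
  have hdd : ∀ z, HasDerivAt (fun z => -σ ^ 2 * oscPart μ p z + μ ^ 2 * hypPart μ p z)
      (-σ ^ 2 * oscPart' μ p z + μ ^ 2 * hypPart' μ p z) z := fun z =>
    ((o1 z).const_mul _).fun_add ((h1 z).const_mul _)
  have hd1 : ∀ z, HasDerivAt (fun z => oscPart' μ p z + hypPart' μ p z)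
      (-σ ^ 2 * oscPart μ p z + μ ^ 2 * hypPart μ p z) z := fun z => (o2 z).fun_add (h2 z)
  have hd0 : ∀ z, HasDerivAt (fun z => oscPart μ p z + hypPart μ p z)
      (oscPart' μ p z + hypPart' μ p z) z := fun z => (o1 z).fun_add (h1 z)
  refine isStokesEigenpair_sepField (D := ![
      fun z => m * (-σ ^ 2 * oscPart μ p z + μ ^ 2 * hypPart μ p z),
      fun z => n * (-σ ^ 2 * oscPart μ p z + μ ^ 2 * hypPart μ p z),
      fun z => μ ^ 2 * (oscPart' μ p z + hypPart' μ p z)])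
    (D' := ![fun z => m * (-σ ^ 2 * oscPart' μ p z + μ ^ 2 * hypPart' μ p z),
      fun z => n * (-σ ^ 2 * oscPart' μ p z + μ ^ 2 * hypPart' μ p z),
      fun z => μ ^ 2 * (-σ ^ 2 * oscPart μ p z + μ ^ 2 * hypPart μ p z)])
    (R := fun z => LamD m n p * (μ ^ 2 * hypPart μ p z))
    hsm (contDiff_const.mul s4) ?_ ?_ (fun z => (h2 z).const_mul _) ?_ ?_ ?_ ?_ ?_ hne
  · intro j z
    fin_cases j
    · exact (hd1 z).const_mul _
    · exact (hd1 z).const_mul _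
    · exact (hd0 z).const_mul _
  · intro j z
    fin_cases j
    · exact (hdd z).const_mul _
    · exact (hdd z).const_mul _
    · exact (hd1 z).const_mul _
  · intro z
    simp only [polProfile, LamD, Matrix.cons_val_zero, ← hμd, ← hσd]; ring
  · intro z
    simp only [polProfile, LamD, Matrix.cons_val_one, Matrix.cons_val_zero, ← hμd, ← hσd]; ring
  · intro z
    simp only [polProfile, LamD, Matrix.cons_val, ← hμd, ← hσd]; ring
  · intro z
    simp only [polProfile, Matrix.cons_val_zero, Matrix.cons_val_one, Matrix.cons_val, ← hμd]
    rw [hμ2]; ring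
  · intro j
    obtain ⟨b1, b2⟩ := profile_boundary hμ p (z := 1) (Or.inl rfl)
    obtain ⟨b3, b4⟩ := profile_boundary hμ p (z := -1) (Or.inr rfl)
    fin_cases j <;> simp [polProfile, b1, b2, b3, b4, ← hμd]

/-! ### Separated fields that do not vanish. -/

lemma coef_ae_eq_zero {u : Pt → Fin 3 → ℝ} (h : u =ᵐ[volΩ] 0) (m n : ℕ) (i : Fin 4) (j : Fin 3) :
    coef u m n i j =ᵐ[zm] 0 := by
  have h0 : (fun X => u X j) =ᵐ[volΩ] fun _ => 0 := by
    filter_upwards [h] with X hX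
    rw [hX]; rfl
  have hi : Integrable (fun X => u X j) volΩ := (integrable_const 0).congr h0.symm
  refine ae_zm_eq_zero (integrable_S_te hi _ _ _ _) fun χ hχ => ?_
  rw [coef, ← integral_mul_ten hi _ _ _ _ hχ.continuous]
  refine integral_eq_zero_of_ae ?_
  filter_upwards [h0] with X hX
  simp [hX]

/-- A single Fourier coefficient detects the field; continuity of the profile upgrades its vanishing
almost everywhere to vanishing at `z`. -/
lemma sepField_not_ae_zero {m n : ℕ} {κ : Fin 4 → ℝ} {F : Fin 3 → ℝ → ℝ}
    {i : Fin 4} {j : Fin 3} (hF : Continuous (F j)) (hκ : κ i ≠ 0) (hN0 : hN j i m n ≠ 0) {z : ℝ}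
    (hz : z ∈ Ioo (-1 : ℝ) 1) (hFz : F j z ≠ 0) : ¬ sepField m n κ F =ᵐ[volΩ] 0 := by
  intro h
  have h1 := coef_ae_eq_zero h m n i j
  have h2 : coef (sepField m n κ F) m n i j = fun z => κ i * hsgn j i * F j z * hN j i m n := by
    ext z; rw [coef_sepField, if_pos ⟨rfl, rfl⟩]
  rw [h2] at h1
  have h3 := eqOn_of_ae_zm h1 (by fun_prop) continuous_const hz
  have hs : hsgn j i ≠ 0 := fun h0 => by
    have := hsgn_mul_self j i
    simp [h0] at this
  exact mul_ne_zero (mul_ne_zero (mul_ne_zero hκ hs) hFz) hN0 h3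

lemma exists_sinProfile_ne_zero {p : ℕ} (hp : 1 ≤ p) :
    ∃ z ∈ Ioo (-1 : ℝ) 1, sinProfile p z ≠ 0 := by
  have hp' : (1 : ℝ) ≤ p := by exact_mod_cast hp
  have hp0 : (0 : ℝ) < p := by linarith
  have hpi : 0 < 1 / (p : ℝ) := by positivity
  -- The first maximum of the sine, where its argument is `π/2`.
  refine ⟨1 / p - 1, ⟨by linarith, ?_⟩, ?_⟩
  · have : 1 / (p : ℝ) ≤ 1 := by rw [div_le_one hp0]; exact hp'
    linarith
  · have : Real.pi / 2 * p * (1 / p - 1 + 1) = Real.pi / 2 := by field_simp; ring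
    rw [sinProfile, this, Real.sin_pi_div_two]
    exact one_ne_zero

/-- The profile is examined at `0`. In the even case its value is `1 - cos σ / cosh μ`, positive as
`cosh μ > 1`; in the odd case its derivative is `σ - μ sin σ / sinh μ`, positive as `sin σ < σ` and
`μ < sinh μ`. -/
lemma exists_vertical_ne_zero {μ : ℝ} (hμ : 0 < μ) (p : ℕ) :
    ∃ z ∈ Ioo (-1 : ℝ) 1, oscPart μ p z + hypPart μ p z ≠ 0 := by
  by_contra! hall
  have h0 : (0 : ℝ) ∈ Ioo (-1 : ℝ) 1 := by norm_num
  have e0 := hall 0 h0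
  have e1 : oscPart' μ p 0 + hypPart' μ p 0 = 0 := by
    refine ((hasDerivAt_oscPart μ p 0).fun_add (hasDerivAt_hypPart μ p 0)).unique
      ((hasDerivAt_const 0 (0 : ℝ)).congr_of_eventuallyEq ?_)
    filter_upwards [Ioo_mem_nhds h0.1 h0.2] with w hw
    exact hall w hw
  have hσ := root_pos hμ p
  have hs : μ < Real.sinh μ := Real.self_lt_sinh_iff.2 hμ
  have hc : 1 < Real.cosh μ := Real.one_lt_cosh.2 hμ.ne'
  unfold oscPart hypPart at e0
  unfold oscPart' hypPart' at e1
  split_ifs at e0 e1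
  · have hcos := Real.cos_le_one (root μ p)
    simp at e0
    field_simp at e0
    linarith
  · have hsin := Real.sin_lt hσ
    simp at e1
    field_simp at e1
    nlinarith

lemma hN_ne_zero_of_pos {m n : ℕ} (hm : 0 < m) (hn : 0 < n) (j : Fin 3) (i : Fin 4) :
    hN j i m n ≠ 0 := by
  have := Real.pi_ne_zero
  simp [hN, trN, hm.ne', hn.ne', this]

lemma hN_ne_zero_of_even {m n : ℕ} {j : Fin 3} {i : Fin 4} (h1 : parX j i = false)
    (h2 : parY j i = false) : hN j i m n ≠ 0 := by
  have := Real.pi_ne_zero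
  rw [hN, h1, h2, trN, trN]
  split_ifs <;> simp_all

lemma exists_single_ne {κ : Fin 4 → ℝ} (h : κ ≠ 0) : ∃ i, κ i ≠ 0 := Function.ne_iff.1 h

lemma tor_not_ae_zero {m n p : ℕ} (hp : 1 ≤ p) :
    (∃ κ, ¬ sepField m n κ (torProfile m n p) =ᵐ[volΩ] 0) ∧
    (0 < m → 0 < n → ∀ κ, κ ≠ 0 → ¬ sepField m n κ (torProfile m n p) =ᵐ[volΩ] 0) := by
  have hcont := fun j => (contDiff_torProfile m n p j).continuous
  obtain ⟨c, hc2, hcd, ⟨hcn, hc0⟩, h⟩ := torProfile_eq m n p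
  obtain ⟨z, hz, hsz⟩ := exists_sinProfile_ne_zero hp
  have hF : ∀ j, c j ≠ 0 → torProfile m n p j z ≠ 0 := fun j hj => by
    rw [h]; exact mul_ne_zero hj hsz
  refine ⟨?_, fun hm hn κ hκ => ?_⟩
  -- The index `i` is the one whose basis function in the component `j` is a product of cosines,
  -- nonzero even if `m` or `n` is zero.
  · rcases Nat.eq_zero_or_pos n with hn | hn
    · exact ⟨Pi.single 1 1, sepField_not_ae_zero (i := 1) (j := 1) (hcont 1) (by simp)
        (hN_ne_zero_of_even rfl rfl) hz (hF 1 (hc0 hn))⟩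
    · exact ⟨Pi.single 3 1, sepField_not_ae_zero (i := 3) (j := 0) (hcont 0) (by simp)
        (hN_ne_zero_of_even rfl rfl) hz (hF 0 (hcn hn))⟩
  · obtain ⟨i, hi⟩ := exists_single_ne hκ
    exact sepField_not_ae_zero (i := i) (j := 0) (hcont 0) hi (hN_ne_zero_of_pos hm hn _ _) hz
      (hF 0 (hcn hn))

lemma pol_not_ae_zero {m n : ℕ} (hμ : 0 < mu m n) (p : ℕ) :
    (∃ κ, ¬ sepField m n κ (polProfile m n p) =ᵐ[volΩ] 0) ∧
    (0 < m → 0 < n → ∀ κ, κ ≠ 0 → ¬ sepField m n κ (polProfile m n p) =ᵐ[volΩ] 0) := by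
  have hcont := fun j => (contDiff_polProfile m n p j).continuous
  obtain ⟨z, hz, hsz⟩ := exists_vertical_ne_zero hμ p
  have hF : polProfile m n p 2 z ≠ 0 := mul_ne_zero (pow_ne_zero 2 hμ.ne') hsz
  refine ⟨⟨Pi.single 2 1, sepField_not_ae_zero (i := 2) (j := 2) (hcont 2) (by simp)
    (hN_ne_zero_of_even rfl rfl) hz hF⟩, fun hm hn κ hκ => ?_⟩
  obtain ⟨i, hi⟩ := exists_single_ne hκ
  exact sepField_not_ae_zero (i := i) (j := 2) (hcont 2) hi (hN_ne_zero_of_pos hm hn _ _) hz hF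

/-! ### Eigenspaces, their decomposition and the pressure. -/

lemma integrable_sepField {m n : ℕ} {κ : Fin 4 → ℝ} {F : Fin 3 → ℝ → ℝ}
    (hF : ∀ j, ContDiff ℝ ∞ (F j)) (j : Fin 3) :
    Integrable (fun X => sepField m n κ F X j) volΩ := by
  rw [sepField_eq]
  exact integrable_of_continuous (smoothPeriodic_sepScalar j m n κ (hF j)).1.continuous

lemma integrable_sum_sepField {ι : Type*} (s : Finset ι) {m n : ι → ℕ} {κ : ι → Fin 4 → ℝ}
    {F : ι → Fin 3 → ℝ → ℝ} (hF : ∀ t j, ContDiff ℝ ∞ (F t j)) (j : Fin 3) :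
    Integrable (fun X => (∑ t ∈ s, sepField (m t) (n t) (κ t) (F t)) X j) volΩ := by
  simp_rw [Finset.sum_apply]
  exact integrable_finsetSum _ fun t _ => integrable_sepField (hF t) j

lemma IsStokesEigenpair.integrable {lam : ℝ} {u : Pt → Fin 3 → ℝ} {q : Pt → ℝ}
    (h : IsStokesEigenpair lam u q) (j : Fin 3) : Integrable (fun X => u X j) volΩ := by
  obtain ⟨G, hV, -⟩ := h.momentum
  exact memLp_integrable (hV.h1 j).memLp

/-- The span of the eigenfunctions with constant pressure and eigenvalue `lam`. -/
def torSpan (lam : ℝ) : Submodule ℝ (Pt → Fin 3 → ℝ) :=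
  Submodule.span ℝ {f | ∃ m n p κ, 1 ≤ p ∧ lamD m n p = lam ∧
    f = sepField m n κ (torProfile m n p)}

/-- The span of the eigenfunctions with non-constant pressure and eigenvalue `lam`. -/
def polSpan (lam : ℝ) : Submodule ℝ (Pt → Fin 3 → ℝ) :=
  Submodule.span ℝ {f | ∃ m n p κ, 0 < mu m n ∧ LamD m n p = lam ∧
    f = sepField m n κ (polProfile m n p)}

/-- The very weak equation without pressure is linear in the field and so passes from the generators
to the span, unlike the notion of eigenfunction, which excludes zero. -/
lemma torSpan_weak {lam : ℝ} {f : Pt → Fin 3 → ℝ} (hf : f ∈ torSpan lam) (j : Fin 3) :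
    Integrable (fun X => f X j) volΩ ∧ ∀ ψ, IsTest ψ →
      ∫ X, f X j * (pd 0 (pd 0 ψ) X + pd 1 (pd 1 ψ) X + pd 2 (pd 2 ψ) X + lam * ψ X) ∂volΩ = 0 := by
  have hcont : ∀ ψ, IsTest ψ → Continuous fun X =>
      pd 0 (pd 0 ψ) X + pd 1 (pd 1 ψ) X + pd 2 (pd 2 ψ) X + lam * ψ X := fun ψ hψ => by
    have h := fun k => (contDiff_pd (contDiff_pd hψ.1.1 k) k).continuous
    exact (((h 0).add (h 1)).add (h 2)).add (continuous_const.mul hψ.1.1.continuous)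
  induction hf using Submodule.span_induction with
  | mem f hf =>
    obtain ⟨m, n, p, κ, hp, rfl, rfl⟩ := hf
    refine ⟨integrable_sepField (contDiff_torProfile m n p) j, fun ψ hψ => ?_⟩
    by_cases h0 : sepField m n κ (torProfile m n p) =ᵐ[volΩ] 0
    · refine integral_eq_zero_of_ae ?_
      filter_upwards [h0] with X hX
      simp [hX]
    · have := (isStokesEigenpair_tor m n p h0).very_weak j hψ
      simp only [zero_mul, integral_zero] at this
      linarith
  | zero => exact ⟨integrable_const 0, fun ψ _ => by simp⟩
  | add f g _ _ hf hg =>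
    refine ⟨hf.1.add hg.1, fun ψ hψ => ?_⟩
    have h1 := integrable_mul_of_continuous hf.1 (hcont ψ hψ)
    have h2 := integrable_mul_of_continuous hg.1 (hcont ψ hψ)
    simp only [Pi.add_apply, add_mul (f _ j)]
    rw [integral_add h1 h2, hf.2 ψ hψ, hg.2 ψ hψ, add_zero]
  | smul c f _ hf =>
    refine ⟨hf.1.const_mul c, fun ψ hψ => ?_⟩
    simp only [Pi.smul_apply, smul_eq_mul, mul_assoc]
    rw [integral_const_mul]
    rw [hf.2 ψ hψ, mul_zero]

/-- The pairing of `q` with `∂ⱼψ` depends only on `u` up to null sets, and for `f` in the span it is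
zero. -/
lemma IsStokesEigenpair.gradZero {lam : ℝ} {u f : Pt → Fin 3 → ℝ} {q : Pt → ℝ}
    (h : IsStokesEigenpair lam u q) (hf : f ∈ torSpan lam) (hu : u =ᵐ[volΩ] f) : GradZero q := by
  intro j ψ hψ
  rw [h.very_weak j hψ, neg_eq_zero, ← (torSpan_weak hf j).2 ψ hψ]
  refine integral_congr_ae ?_
  filter_upwards [hu] with X hX
  rw [hX]

lemma sepField_zero (m n : ℕ) (F : Fin 3 → ℝ → ℝ) : sepField m n 0 F = 0 := by
  ext X j
  rw [sepField_apply]; simp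

lemma sepField_single_mem_torSpan {lam α : ℝ} {m n p : ℕ} (i : Fin 4)
    (h : α ≠ 0 → 1 ≤ p ∧ lamD m n p = lam) :
    sepField m n (Pi.single i α) (torProfile m n p) ∈ torSpan lam := by
  by_cases hα : α = 0
  · rw [hα, Pi.single_zero, sepField_zero]; exact zero_mem _
  · exact Submodule.subset_span ⟨m, n, p, _, (h hα).1, (h hα).2, rfl⟩

lemma sepField_single_mem_polSpan {lam β : ℝ} {m n p : ℕ} (i : Fin 4)
    (h : β ≠ 0 → 0 < mu m n ∧ LamD m n p = lam) :
    sepField m n (Pi.single i β) (polProfile m n p) ∈ polSpan lam := by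
  by_cases hβ : β = 0
  · rw [hβ, Pi.single_zero, sepField_zero]; exact zero_mem _
  · exact Submodule.subset_span ⟨m, n, p, _, (h hβ).1, (h hβ).2, rfl⟩

lemma coef_sepField_single (m n : ℕ) (i : Fin 4) (α : ℝ) (F : Fin 3 → ℝ → ℝ) (m' n' : ℕ)
    (i' : Fin 4) (j : Fin 3) (z : ℝ) : coef (sepField m n (Pi.single i α) F) m' n' i' j z
      = if ((m, n), i) = ((m', n'), i') then α * hsgn j i * F j z * hN j i m n else 0 := by
  rw [coef_sepField]
  by_cases h : m = m' ∧ n = n'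
  · by_cases hi : i = i'
    · obtain ⟨rfl, rfl⟩ := h; subst hi; simp
    · rw [if_pos h, if_neg (by simp [hi]), Pi.single_eq_of_ne (Ne.symm hi)]; simp
  · rw [if_neg h, if_neg]
    simp only [Prod.mk.injEq, not_and]
    exact fun h' => absurd h' h

lemma coef_sum_single (s : Finset ((ℕ × ℕ) × Fin 4)) (α : ℕ → ℕ → Fin 4 → ℝ)
    (F : ℕ → ℕ → Fin 4 → Fin 3 → ℝ → ℝ) (m n : ℕ) (i : Fin 4) (j : Fin 3) (z : ℝ) :
    coef (∑ t ∈ s, sepField t.1.1 t.1.2 (Pi.single t.2 (α t.1.1 t.1.2 t.2)) (F t.1.1 t.1.2 t.2))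
      m n i j z = if ((m, n), i) ∈ s then α m n i * hsgn j i * F m n i j z * hN j i m n else 0 := by
  rw [coef_sum_sepField s (fun t => t.1.1) (fun t => t.1.2)
    (fun t => Pi.single t.2 (α t.1.1 t.1.2 t.2)) (fun t => F t.1.1 t.1.2 t.2)]
  simp_rw [coef_sepField_single, Prod.mk.eta]
  rw [Finset.sum_ite_eq']

lemma le_of_mode_eigenvalue {lam : ℝ} {m n p : ℕ} (h : lamD m n p = lam ∨
    (0 < mu m n ∧ LamD m n p = lam)) : (m : ℝ) ^ 2 + (n : ℝ) ^ 2 ≤ lam := by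
  rcases h with h | ⟨_, h⟩
  · rw [← h, lamD, mu_sq]
    have : 0 ≤ Real.pi ^ 2 / 4 * (p : ℝ) ^ 2 := by positivity
    linarith
  · rw [← h, LamD, mu_sq]
    have : 0 ≤ root (mu m n) p ^ 2 := by positivity
    linarith

/-- A natural number is at most its square. This bounds the modes that can occur and makes the
decomposition finite. -/
lemma lt_of_mode_eigenvalue {lam : ℝ} {m n M : ℕ} (hM : lam < M)
    (h : (m : ℝ) ^ 2 + (n : ℝ) ^ 2 ≤ lam) : m < M ∧ n < M := by
  have hsq : ∀ k : ℕ, (k : ℝ) ≤ (k : ℝ) ^ 2 := fun k => by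
    exact_mod_cast Nat.le_self_pow two_ne_zero k
  have h1 := hsq m
  have h2 := hsq n
  have h3 : (0 : ℝ) ≤ (m : ℝ) ^ 2 := by positivity
  have h4 : (0 : ℝ) ≤ (n : ℝ) ^ 2 := by positivity
  constructor
  · have : (m : ℝ) < M := by linarith
    exact_mod_cast this
  · have : (n : ℝ) < M := by linarith
    exact_mod_cast this

/-- Every eigenfunction is a finite combination of separated eigenfunctions. -/
lemma IsStokesEigenpair.decomposition {lam : ℝ} {u : Pt → Fin 3 → ℝ} {q : Pt → ℝ}
    (h : IsStokesEigenpair lam u q) : ∃ u₁ ∈ torSpan lam, ∃ u₂ ∈ polSpan lam,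
      u =ᵐ[volΩ] u₁ + u₂ ∧ (GradZero q ↔ u₂ = 0) := by
  choose α β p k hα hβ hg hc using h.exists_coef
  obtain ⟨M, hM⟩ := exists_nat_gt lam
  let s : Finset ((ℕ × ℕ) × Fin 4) := (Finset.range M ×ˢ Finset.range M) ×ˢ Finset.univ
  let F₁ := fun m n i => torProfile m n (p m n i)
  let F₂ := fun m n i => polProfile m n (k m n i)
  let u₁ := ∑ t ∈ s, sepField t.1.1 t.1.2 (Pi.single t.2 (α t.1.1 t.1.2 t.2)) (F₁ t.1.1 t.1.2 t.2)
  let u₂ := ∑ t ∈ s, sepField t.1.1 t.1.2 (Pi.single t.2 (β t.1.1 t.1.2 t.2)) (F₂ t.1.1 t.1.2 t.2)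
  have i1 : ∀ j, Integrable (fun X => u₁ X j) volΩ :=
    integrable_sum_sepField s fun t j => contDiff_torProfile _ _ _ j
  have i2 : ∀ j, Integrable (fun X => u₂ X j) volΩ :=
    integrable_sum_sepField s fun t j => contDiff_polProfile _ _ _ j
  have hu₁ : u₁ ∈ torSpan lam :=
    Submodule.sum_mem _ fun t _ => sepField_single_mem_torSpan t.2 (hα _ _ _)
  have hu₂ : u₂ ∈ polSpan lam :=
    Submodule.sum_mem _ fun t _ => sepField_single_mem_polSpan t.2 (hβ _ _ _)
  have hae : u =ᵐ[volΩ] u₁ + u₂ := by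
    -- All coefficients are compared. Outside the finite set `s` both amplitudes are zero, because a
    -- nonzero one would give `m² + n² ≤ lam`.
    have key : (fun X => u X - u₂ X) =ᵐ[volΩ] u₁ := by
      refine ae_eq_of_coef_ae_eq (fun j => (h.integrable j).sub (i2 j)) i1 fun m n i j => ?_
      filter_upwards [S_sub_ae (h.integrable j) (i2 j) (parX j i) m (parY j i) n, hc m n i j]
        with z hz1 hz2
      have e1 : coef (fun X => u X - u₂ X) m n i j z = coef u m n i j z - coef u₂ m n i j z := hz1
      rw [e1, hz2, coef_sum_single, coef_sum_single]
      split_ifs with hmem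
      · simp only [F₁, F₂]; ring
      · have hle : ¬ (m : ℝ) ^ 2 + (n : ℝ) ^ 2 ≤ lam := fun hle => hmem (by
          simpa [s] using lt_of_mode_eigenvalue hM hle)
        have hα0 : α m n i = 0 := by
          by_contra h0
          exact hle (le_of_mode_eigenvalue (Or.inl (hα m n i h0).2))
        have hβ0 : β m n i = 0 := by
          by_contra h0
          exact hle (le_of_mode_eigenvalue (Or.inr (hβ m n i h0)))
        simp [hα0, hβ0]
    filter_upwards [key] with X hX
    rw [Pi.add_apply, ← hX, sub_add_cancel]
  refine ⟨u₁, hu₁, u₂, hu₂, hae, fun hq => ?_, fun h0 => ?_⟩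
  · refine Finset.sum_eq_zero fun t _ => ?_
    rw [hg _ _ _ hq, Pi.single_zero, sepField_zero]
  · rw [h0, add_zero] at hae
    exact h.gradZero hu₁ hae

/-- The eigenvalues of the eigenfunctions of mode `(m, n)`. -/
lemma IsStokesEigenpair.mode_eigenvalue {lam : ℝ} {m n : ℕ} {κ : Fin 4 → ℝ}
    {E : Fin 3 → ℝ → ℝ} {q : Pt → ℝ} (h : IsStokesEigenpair lam (sepField m n κ E) q) :
    (GradZero q → ∃ p, 1 ≤ p ∧ lam = lamD m n p) ∧
      (¬ GradZero q → 0 < mu m n ∧ ∃ p, lam = LamD m n p) := by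
  choose α β p k hα hβ hg hc using h.exists_coef m n
  -- If no pressure-driven part is present, the field lies in `torSpan lam` and the pressure is
  -- constant; otherwise a nonzero `β i` names the eigenvalue and excludes constant pressure.
  by_cases hβ0 : ∀ i, β i = 0
  · let α' : ℕ → ℕ → Fin 4 → ℝ := fun _ _ => α
    let s : Finset ((ℕ × ℕ) × Fin 4) := {(m, n)} ×ˢ Finset.univ
    let F₁ : ℕ → ℕ → Fin 4 → Fin 3 → ℝ → ℝ := fun m n i => torProfile m n (p i)
    let u₁ := ∑ t ∈ s, sepField t.1.1 t.1.2 (Pi.single t.2 (α' t.1.1 t.1.2 t.2))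
      (F₁ t.1.1 t.1.2 t.2)
    have hu₁ : u₁ ∈ torSpan lam := Submodule.sum_mem _ fun t ht => by
      have ht' : t.1 = (m, n) := Finset.mem_singleton.1 (Finset.mem_product.1 ht).1
      rw [ht']
      exact sepField_single_mem_torSpan t.2 (hα t.2)
    have hae : sepField m n κ E =ᵐ[volΩ] u₁ := by
      refine ae_eq_of_coef_ae_eq h.integrable
        (integrable_sum_sepField s fun t j => contDiff_torProfile _ _ _ j) fun m' n' i j => ?_
      by_cases hmn : (m', n') = (m, n)
      · obtain ⟨rfl, rfl⟩ := Prod.mk.inj hmn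
        filter_upwards [hc i j] with z hz
        rw [hz, coef_sum_single, if_pos (by simp [s]), hβ0 i]
        simp only [α', F₁]; ring
      · filter_upwards with z
        rw [coef_sum_single, if_neg fun ht => hmn (Finset.mem_singleton.1 (Finset.mem_product.1 ht).1), coef_sepField, if_neg]
        rintro ⟨rfl, rfl⟩
        exact hmn rfl
    refine ⟨fun _ => ?_, fun hq => absurd (h.gradZero hu₁ hae) hq⟩
    by_contra hno
    refine h.ne_zero ?_
    -- A nonzero amplitude would exhibit `lam` in the first sequence; with none, the field would
    -- vanish.
    have hα0 : ∀ i, α i = 0 := fun i => by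
      by_contra h0
      exact hno ⟨p i, (hα i h0).1, (hα i h0).2.symm⟩
    have : u₁ = 0 := Finset.sum_eq_zero fun t _ => by
      simp only [α', hα0, Pi.single_zero, sepField_zero]
    rwa [this] at hae
  · push Not at hβ0
    obtain ⟨i, hi⟩ := hβ0
    exact ⟨fun hq => absurd (hg i hq) hi, fun _ => ⟨(hβ i hi).1, k i, (hβ i hi).2.symm⟩⟩

/-- No computation with the pressure is needed: were it constant, the eigenvalue would belong to the
first sequence of the same mode. -/
lemma not_gradZero_pol {m n p : ℕ} (hμ : 0 < mu m n) {κ : Fin 4 → ℝ} {E : Fin 3 → ℝ → ℝ}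
    {q : Pt → ℝ} (h : IsStokesEigenpair (LamD m n p) (sepField m n κ E) q) : ¬ GradZero q := by
  intro hq
  obtain ⟨k, _, hk⟩ := h.mode_eigenvalue.1 hq
  exact LamD_ne_lamD hμ p k hk

end StokesChannel

/-! ### The Dirichlet spectrum of the Stokes problem in the channel. -/

open StokesChannel
theorem corollary3p4 :
    -- `Lam m n p` are the non-constant-pressure eigenvalues (`lamD m n p`, `1 ≤ p`, are the
    -- constant-pressure ones); `F m n p` and `K m n p` are the vertical profiles of the
    -- constant-pressure and of the non-constant-pressure eigenfunctions
    ∃ (Lam : ℕ → ℕ → ℕ → ℝ) (F K : ℕ → ℕ → ℕ → Fin 3 → ℝ → ℝ),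
      -- both sequences are positive, increasing and divergent
      (∀ m n : ℕ, (∀ p, 1 ≤ p → 0 < lamD m n p) ∧ StrictMonoOn (lamD m n) (Set.Ici 1) ∧
        Filter.Tendsto (lamD m n) Filter.atTop Filter.atTop) ∧
      (∀ m n : ℕ, 0 < mu m n → (∀ p, 0 < Lam m n p) ∧ StrictMono (Lam m n) ∧
        Filter.Tendsto (Lam m n) Filter.atTop Filter.atTop) ∧
      -- i) the eigenvalues with constant pressure in the mode `(m, n)`
      (∀ m n : ℕ,
        {lam : ℝ | ∃ κ E q, IsStokesEigenpair lam (sepField m n κ E) q ∧ GradZero q}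
          = {lam : ℝ | ∃ p, 1 ≤ p ∧ lam = lamD m n p}) ∧
      -- ii) the eigenvalues with non-constant pressure in the mode `(m, n)`
      (∀ m n : ℕ,
        {lam : ℝ | ∃ κ E q, IsStokesEigenpair lam (sepField m n κ E) q ∧ ¬ GradZero q}
          = {lam : ℝ | 0 < mu m n ∧ ∃ p, lam = Lam m n p}) ∧
      (∀ m n p : ℕ, 0 < mu m n →
        Lam m n p ∈ Set.Ioo (mu m n ^ 2 + Real.pi ^ 2 / 4 * (1 + (p : ℝ)) ^ 2)
          (mu m n ^ 2 + Real.pi ^ 2 / 4 * (2 + (p : ℝ)) ^ 2) ∧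
        (Even p → Real.sqrt (Lam m n p - mu m n ^ 2) * Real.tan (Real.sqrt (Lam m n p - mu m n ^ 2))
          = - mu m n * Real.tanh (mu m n)) ∧
        (Odd p → Real.sqrt (Lam m n p - mu m n ^ 2) * Real.cot (Real.sqrt (Lam m n p - mu m n ^ 2))
          = mu m n * (Real.cosh (mu m n) / Real.sinh (mu m n)))) ∧
      -- the separated eigenfunctions, with constant pressure
      (∀ m n p : ℕ, 1 ≤ p → (∀ i, ContDiff ℝ ∞ (F m n p i)) ∧
        (∀ κ, ¬ sepField m n κ (F m n p) =ᵐ[volΩ] 0 → ∃ q, ContDiff ℝ ∞ q ∧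
          IsStokesEigenpair (lamD m n p) (sepField m n κ (F m n p)) q ∧ GradZero q) ∧
        (∃ κ, ¬ sepField m n κ (F m n p) =ᵐ[volΩ] 0) ∧
        (0 < m → 0 < n → ∀ κ, κ ≠ 0 → ¬ sepField m n κ (F m n p) =ᵐ[volΩ] 0)) ∧
      -- the separated eigenfunctions, with non-constant pressure
      (∀ m n p : ℕ, 0 < mu m n → (∀ i, ContDiff ℝ ∞ (K m n p i)) ∧
        (∀ κ, ¬ sepField m n κ (K m n p) =ᵐ[volΩ] 0 → ∃ q, ContDiff ℝ ∞ q ∧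
          IsStokesEigenpair (Lam m n p) (sepField m n κ (K m n p)) q ∧ ¬ GradZero q) ∧
        (∃ κ, ¬ sepField m n κ (K m n p) =ᵐ[volΩ] 0) ∧
        (0 < m → 0 < n → ∀ κ, κ ≠ 0 → ¬ sepField m n κ (K m n p) =ᵐ[volΩ] 0)) ∧
      -- there are no others: each eigenspace is spanned by these separated eigenfunctions, so
      -- the two sequences list all the eigenvalues of either class with their multiplicity
      (∀ (lam : ℝ) (u : Pt → Fin 3 → ℝ) (q : Pt → ℝ), IsStokesEigenpair lam u q →
        ∃ u₁ ∈ Submodule.span ℝ {f | ∃ m n p κ, 1 ≤ p ∧ lamD m n p = lam ∧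
            f = sepField m n κ (F m n p)},
        ∃ u₂ ∈ Submodule.span ℝ {f | ∃ m n p κ, 0 < mu m n ∧ Lam m n p = lam ∧
            f = sepField m n κ (K m n p)},
          u =ᵐ[volΩ] u₁ + u₂ ∧ (GradZero q ↔ u₂ = 0)) := by
  refine ⟨LamD, torProfile, polProfile,
    fun m n => ⟨fun p hp => lamD_pos hp, lamD_strictMonoOn m n, tendsto_lamD m n⟩,
    fun m n h => ⟨LamD_pos h, LamD_strictMono h, tendsto_LamD h⟩, ?_, ?_, ?_, ?_, ?_, ?_⟩
  · intro m n
    ext lam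
    constructor
    · rintro ⟨κ, E, q, h, hq⟩
      exact h.mode_eigenvalue.1 hq
    · rintro ⟨p, hp, rfl⟩
      obtain ⟨κ, hκ⟩ := (tor_not_ae_zero (m := m) (n := n) hp).1
      exact ⟨κ, _, _, isStokesEigenpair_tor m n p hκ, gradZero_zero⟩
  · intro m n
    ext lam
    constructor
    · rintro ⟨κ, E, q, h, hq⟩
      exact h.mode_eigenvalue.2 hq
    · rintro ⟨hμ, p, rfl⟩
      obtain ⟨κ, hκ⟩ := (pol_not_ae_zero hμ p).1
      have h := isStokesEigenpair_pol hμ p hκ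
      exact ⟨κ, _, _, h, not_gradZero_pol hμ h⟩
  · intro m n p h
    rw [sqrt_LamD_sub h]
    exact ⟨LamD_mem h p, fun hp => tan_root h hp, fun hp => cot_root h hp⟩
  · intro m n p hp
    exact ⟨contDiff_torProfile m n p, fun κ hκ => ⟨fun _ => 0, contDiff_const,
      isStokesEigenpair_tor m n p hκ, gradZero_zero⟩, tor_not_ae_zero hp⟩
  · intro m n p hμ
    refine ⟨contDiff_polProfile m n p, fun κ hκ => ?_, pol_not_ae_zero hμ p⟩
    have h := isStokesEigenpair_pol hμ p hκ
    exact ⟨_, (smoothPeriodic_sepScalar 2 m n κ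
      (contDiff_const.mul (contDiff_profile_parts (mu m n) p).2.2.2)).1, h, not_gradZero_pol hμ h⟩
  · intro lam u q h
    exact h.decomposition
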